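/- Let $\Bbbk$ be a field, $H$ a Hopf algebra over $\Bbbk$ with invertible antipode, and $A$ a right $H$-comodule algebra with coaction $\Delta_A\colon A\to A\otimes H$, $\Delta_A(a)=a_0\otimes a_1$, and coinvariants $B=A^{\mathrm{co}H}=\{a\in A\mid\Delta_A(a)=a\otimes 1\}$. Assume that $B\subseteq A$ is a faithfully flat Hopf--Galois extension: the canonical map $\chi\colon A\otimes_BA\to A\otimes H$, $a\otimes_B a'\mapsto aa'_0\otimes a'_1$, is bijective, and $A$ is faithfully flat as a right $B$-module. Let $\tau\colon H\to A\otimes_BA$, $\tau(h)=\chi^{-1}(1\otimes h)=:h^{\langle1\rangle}\otimes_Bh^{\langle2\rangle}$ be the translation map (a finite sum of such tensors is understood). Let $(\Gamma,\mathrm d)$ be a bicovariant first order differential calculus on $H$ and let $\Omega^\bullet(H)$ be its maximal prolongation, i.e. the tensor algebra of the $H$-bimodule $\Gamma$ modulo the ideal generated by the elements $\sum_i\mathrm da^i\otimes_H\mathrm db^i$ with $a^i,b^i\in H$, $\sum_ia^i\mathrm db^i=0$, with the induced differential. Let $\Omega^\bullet(A)$ be a complete differential calculus on $A$: a differential graded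 algebra with $\Omega^0(A)=A$ and $\Omega^n(A)=\mathrm{span}_\Bbbk\{a^0\mathrm da^1\wedge\cdots\wedge\mathrm da^n\}$ such that $\Delta_A$ extends to a (necessarily unique) morphism of differential graded algebras $\Delta_A^\bullet\colon\Omega^\bullet(A)\to\Omega^\bullet(A)\otimes\Omega^\bullet(H)$. Let $\Omega^\bullet(B)=\{\omega\in\Omega^\bullet(A)\mid\Delta^\bullet_A(\omega)=\omega\otimes1\}$ be the subalgebra of base forms, and write $\otimes_{\Omega}:=\otimes_{\Omega^\bullet(B)}$. The space $\Omega^\bullet(A)\otimes_{\Omega}\Omega^\bullet(A)$ is graded by total degree. Then there is a unique well-defined $\Bbbk$-linear map $$\tau^\bullet\colon\Omega^\bullet(H)\to\Omega^\bullet(A)\otimes_{\Omega^\bullet(B)}\Omega^\bullet(A)$$ of degree $0$ which extends $\tau$ (on $\Omega^0(H)=H$ it is $\tau$ followed by the canonical map $A\otimes_BA\to\Omega^\bullet(A)\otimes_{\Omega}\Omega^\bullet(A)$) and is given by the following formulas, for arbitrary choices of representatives of the tensors $\tau(\cdot)$ in $A\otimes A$. For $h,g,l\in H$, $$\tau^\bullet(h\,\mathrm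 dg)=\mathrm d(g^{\langle1\rangle})h^{\langle1\rangle}\otimes_{\Omega}h^{\langle2\rangle}g^{\langle2\rangle}+g^{\langle1\rangle}h^{\langle1\rangle}\otimes_{\Omega}h^{\langle2\rangle}\mathrm d(g^{\langle2\rangle}),$$ $$\begin{aligned}\tau^\bullet(h\,\mathrm dg\wedge\mathrm dl)=&-\mathrm d(l^{\langle1\rangle})\wedge\mathrm d(g^{\langle1\rangle})h^{\langle1\rangle}\otimes_{\Omega}h^{\langle2\rangle}g^{\langle2\rangle}l^{\langle2\rangle}-\mathrm d(l^{\langle1\rangle})g^{\langle1\rangle}h^{\langle1\rangle}\otimes_{\Omega}h^{\langle2\rangle}\mathrm d(g^{\langle2\rangle})l^{\langle2\rangle}\\&+l^{\langle1\rangle}\mathrm d(g^{\langle1\rangle})h^{\langle1\rangle}\otimes_{\Omega}h^{\langle2\rangle}g^{\langle2\rangle}\mathrm d(l^{\langle2\rangle})+l^{\langle1\rangle}g^{\langle1\rangle}h^{\langle1\rangle}\otimes_{\Omega}h^{\langle2\rangle}\mathrm d(g^{\langle2\rangle})\wedge\mathrm d(l^{\langle2\rangle}).\end{aligned}$$ In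 general, for $h_0,\dots,h_n\in H$, fix representatives of $\tau(h_0),\dots,\tau(h_n)$ in $A\otimes A$ (written $h_i^{\langle1\rangle}\otimes h_i^{\langle2\rangle}$) and define $w_0,\dots,w_n\in\Omega^\bullet(A)\otimes\Omega^\bullet(A)$ by $w_0=h_0^{\langle1\rangle}\otimes h_0^{\langle2\rangle}$ and, writing $w_{i-1}=\sum\omega\otimes\eta$, $$w_i=\sum\Big((-1)^{i-1}\,\mathrm d(h_i^{\langle1\rangle})\wedge\omega\otimes\eta\,h_i^{\langle2\rangle}+h_i^{\langle1\rangle}\omega\otimes\eta\wedge\mathrm d(h_i^{\langle2\rangle})\Big);$$ then $\tau^\bullet(h_0\,\mathrm dh_1\wedge\cdots\wedge\mathrm dh_n)$ is the class of $w_n$ in $\Omega^\bullet(A)\otimes_{\Omega}\Omega^\bullet(A)$. -/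

import Mathlib

open scoped TensorProduct

universe u

noncomputable section

namespace NCG

/-! ### First order differential calculi -/

/-- A first order differential calculus on a `k`-algebra `A` with values in the `A`-bimodule `Γ`
(a bimodule is a left `A`-module and right `A`-module, i.e. `Aᵐᵒᵖ`-module, with commuting actions,
on which both induced actions of `k` agree). -/
structure FODC (k A Γ : Type u) [Field k] [Ring A] [Algebra k A] [AddCommGroup Γ] [Module k Γ]
    [Module A Γ] [Module Aᵐᵒᵖ Γ] [SMulCommClass A Aᵐᵒᵖ Γ]
    [IsScalarTower k A Γ] [IsScalarTower k Aᵐᵒᵖ Γ] where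
  d : A →ₗ[k] Γ
  leibniz : ∀ a b : A, d (a * b) = MulOpposite.op b • d a + a • d b
  span_eq_top : Submodule.span k {γ : Γ | ∃ a b : A, γ = a • d b} = ⊤

/-- The left action of `A` on a left `A`-module, as a `k`-bilinear map. -/
def leftAct (k A Γ : Type u) [Field k] [Ring A] [Algebra k A] [AddCommGroup Γ] [Module k Γ]
    [Module A Γ] [IsScalarTower k A Γ] : A →ₗ[k] Γ →ₗ[k] Γ :=
  (Algebra.lsmul k k Γ : A →ₐ[k] Module.End k Γ).toLinearMap

/-- The right action of `A` on a right `A`-module, as a `k`-bilinear map. -/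
def rightAct (k A Γ : Type u) [Field k] [Ring A] [Algebra k A] [AddCommGroup Γ] [Module k Γ]
    [Module Aᵐᵒᵖ Γ] [IsScalarTower k Aᵐᵒᵖ Γ] : A →ₗ[k] Γ →ₗ[k] Γ :=
  (Algebra.lsmul k k Γ : Aᵐᵒᵖ →ₐ[k] Module.End k Γ).toLinearMap ∘ₗ
    (MulOpposite.opLinearEquiv k : A ≃ₗ[k] Aᵐᵒᵖ).toLinearMap

section MaximalProlongation

variable {k A Γ : Type u} [Field k] [Ring A] [Algebra k A] [AddCommGroup Γ] [Module k Γ]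
  [Module A Γ] [Module Aᵐᵒᵖ Γ] [SMulCommClass A Aᵐᵒᵖ Γ]
  [IsScalarTower k A Γ] [IsScalarTower k Aᵐᵒᵖ Γ]

namespace FODC

/-- The map `A ⊗ A → Γ`, `a ⊗ b ↦ a • d b`. -/
def toForm (F : FODC k A Γ) : A ⊗[k] A →ₗ[k] Γ :=
  TensorProduct.lift ((leftAct k A Γ).compl₂ F.d)

/-- The relations defining the maximal prolongation as a quotient of the free algebra
`T_k(A ⊕ Γ)`. The first four (together with linearity) say that `A` sits inside as a unital
algebra and that the two `A`-actions on `Γ` are given by multiplication, so they present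
the tensor algebra `A ⊕ Γ ⊕ (Γ ⊗_A Γ) ⊕ ⋯` of the bimodule `Γ`; the last one kills `∑ dbᵢ ⊗_A dcᵢ`
whenever `∑ bᵢ dcᵢ = 0` in `Γ`. -/
inductive Rel (F : FODC k A Γ) :
    TensorAlgebra k (A × Γ) → TensorAlgebra k (A × Γ) → Prop
  | one : Rel F (TensorAlgebra.ι k (1, 0)) 1
  | mul (a b : A) :
      Rel F (TensorAlgebra.ι k (a, 0) * TensorAlgebra.ι k (b, 0)) (TensorAlgebra.ι k (a * b, 0))
  | left (a : A) (γ : Γ) :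
      Rel F (TensorAlgebra.ι k (a, 0) * TensorAlgebra.ι k (0, γ)) (TensorAlgebra.ι k (0, a • γ))
  | right (γ : Γ) (a : A) :
      Rel F (TensorAlgebra.ι k (0, γ) * TensorAlgebra.ι k (a, 0))
        (TensorAlgebra.ι k (0, MulOpposite.op a • γ))
  | prolong {n : ℕ} (b c : Fin n → A) (h : ∑ i, b i • F.d (c i) = 0) :
      Rel F (∑ i, TensorAlgebra.ι k (0, F.d (b i)) * TensorAlgebra.ι k (0, F.d (c i))) 0

/-- The underlying algebra of the maximal prolongation of a first order differential calculus. -/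
def MaxProl (F : FODC k A Γ) : Type u := RingQuot (Rel F)

namespace MaxProl

instance (F : FODC k A Γ) : Ring F.MaxProl := inferInstanceAs (Ring (RingQuot (Rel F)))
instance (F : FODC k A Γ) : Algebra k F.MaxProl :=
  inferInstanceAs (Algebra k (RingQuot (Rel F)))

variable (F : FODC k A Γ)

/-- The quotient map. -/
def mk : TensorAlgebra k (A × Γ) →ₐ[k] F.MaxProl := RingQuot.mkAlgHom k (Rel F)

theorem mk_rel {x y : TensorAlgebra k (A × Γ)} (h : Rel F x y) : mk F x = mk F y :=
  RingQuot.mkAlgHom_rel k h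

/-- The inclusion of `A` into the maximal prolongation. -/
def ofAlg : A →ₐ[k] F.MaxProl :=
  AlgHom.ofLinearMap
    ((mk F).toLinearMap ∘ₗ TensorAlgebra.ι k ∘ₗ LinearMap.inl k A Γ)
    (by simpa using mk_rel F Rel.one)
    (fun a b => by simpa using (mk_rel F (Rel.mul a b)).symm)

/-- The map from the one-forms to the maximal prolongation. -/
def ofForm : Γ →ₗ[k] F.MaxProl :=
  (mk F).toLinearMap ∘ₗ TensorAlgebra.ι k ∘ₗ LinearMap.inr k A Γ

theorem ofAlg_eq (a : A) : ofAlg F a = mk F (TensorAlgebra.ι k (a, 0)) := rfl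

theorem ofForm_eq (γ : Γ) : ofForm F γ = mk F (TensorAlgebra.ι k (0, γ)) := rfl

theorem ofForm_smul (a : A) (γ : Γ) : ofForm F (a • γ) = ofAlg F a * ofForm F γ := by
  simpa [ofAlg_eq, ofForm_eq] using (mk_rel F (Rel.left a γ)).symm

theorem ofForm_op_smul (a : A) (γ : Γ) :
    ofForm F (MulOpposite.op a • γ) = ofForm F γ * ofAlg F a := by
  simpa [ofAlg_eq, ofForm_eq] using (mk_rel F (Rel.right γ a)).symm

theorem ofForm_prolong {n : ℕ} (b c : Fin n → A) (h : ∑ i, b i • F.d (c i) = 0) :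
    ∑ i, ofForm F (F.d (b i)) * ofForm F (F.d (c i)) = 0 := by
  simpa [ofForm_eq] using mk_rel F (Rel.prolong b c h)

/-- The universal property of the maximal prolongation. -/
def lift {R : Type*} [Ring R] [Algebra k R] (f : A →ₐ[k] R) (g : Γ →ₗ[k] R)
    (hl : ∀ a γ, g (a • γ) = f a * g γ) (hr : ∀ a γ, g (MulOpposite.op a • γ) = g γ * f a)
    (hp : ∀ (n : ℕ) (b c : Fin n → A), ∑ i, b i • F.d (c i) = 0 →
      ∑ i, g (F.d (b i)) * g (F.d (c i)) = 0) : F.MaxProl →ₐ[k] R :=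
  RingQuot.liftAlgHom k ⟨TensorAlgebra.lift k (f.toLinearMap.coprod g), by
    intro x y h
    cases h with
    | one => simp
    | mul a b => simp
    | left a γ => simp [hl]
    | right γ a => simp [hr]
    | prolong b c h => simpa using hp _ b c h⟩

variable {F} in
@[elab_as_elim]
theorem induction {C : F.MaxProl → Prop} (alg : ∀ a, C (ofAlg F a)) (form : ∀ γ, C (ofForm F γ))
    (mul : ∀ x y, C x → C y → C (x * y)) (add : ∀ x y, C x → C y → C (x + y))
    (x : F.MaxProl) : C x := by
  obtain ⟨x, rfl⟩ := RingQuot.mkAlgHom_surjective k (Rel F) x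
  change C (mk F x)
  induction x using TensorAlgebra.induction with
  | algebraMap r =>
    have := alg (algebraMap k A r)
    rwa [AlgHom.commutes] at this ⊢
  | ι x =>
    have h : mk F (TensorAlgebra.ι k x) = ofAlg F x.1 + ofForm F x.2 := by
      have : x = (x.1, 0) + (0, x.2) := by simp
      conv_lhs => rw [this, map_add, map_add]
      rfl
    rw [h]
    exact add _ _ (alg _) (form _)
  | mul a b ha hb => rw [map_mul]; exact mul _ _ ha hb
  | add a b ha hb => rw [map_add]; exact add _ _ ha hb

section lift
variable {R : Type*} [Ring R] [Algebra k R] (f : A →ₐ[k] R) (g : Γ →ₗ[k] R)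
    (hl : ∀ a γ, g (a • γ) = f a * g γ) (hr : ∀ a γ, g (MulOpposite.op a • γ) = g γ * f a)
    (hp : ∀ (n : ℕ) (b c : Fin n → A), ∑ i, b i • F.d (c i) = 0 →
      ∑ i, g (F.d (b i)) * g (F.d (c i)) = 0)

@[simp] theorem lift_ofAlg (a : A) : lift F f g hl hr hp (ofAlg F a) = f a :=
  (RingQuot.liftAlgHom_mkAlgHom_apply (S := k) _ _ _).trans (by simp)

@[simp] theorem lift_ofForm (γ : Γ) : lift F f g hl hr hp (ofForm F γ) = g γ :=
  (RingQuot.liftAlgHom_mkAlgHom_apply (S := k) _ _ _).trans (by simp)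

end lift

/-- The element `a₀ da₁ ⋯ daₙ`. -/
def word (a : A) (l : List A) : F.MaxProl :=
  ofAlg F a * (l.map fun b => ofForm F (F.d b)).prod

theorem word_append (a : A) (l l' : List A) :
    word F a (l ++ l') = word F a l * (l'.map fun b => ofForm F (F.d b)).prod := by
  simp [word, mul_assoc]

theorem word_snoc (a : A) (l : List A) (b : A) :
    word F a (l ++ [b]) = word F a l * ofForm F (F.d b) := by
  simp [word_append]

/-- The degree `n` part of the maximal prolongation: the span of the elements `a₀ da₁ ⋯ daₙ`. -/
def grade (n : ℕ) : Submodule k F.MaxProl :=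
  Submodule.span k {x | ∃ (a : A) (l : List A), l.length = n ∧ x = word F a l}

theorem word_mem (a : A) (l : List A) : word F a l ∈ grade F l.length :=
  Submodule.subset_span ⟨a, l, rfl, rfl⟩

theorem grade_mul_d {n : ℕ} {x : F.MaxProl} (hx : x ∈ grade F n) (b : A) :
    x * ofForm F (F.d b) ∈ grade F (n + 1) := by
  induction hx using Submodule.span_induction with
  | mem x h =>
    obtain ⟨a, l, rfl, rfl⟩ := h
    rw [← word_snoc]
    simpa using word_mem F a (l ++ [b])
  | zero => simp
  | add x y _ _ hx hy => rw [add_mul]; exact add_mem hx hy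
  | smul r x _ hx => rw [smul_mul_assoc]; exact Submodule.smul_mem _ _ hx

theorem grade_mul_alg (n : ℕ) : ∀ {x : F.MaxProl} (_ : x ∈ grade F n) (b : A),
    x * ofAlg F b ∈ grade F n := by
  induction n with
  | zero =>
    intro x hx b
    induction hx using Submodule.span_induction with
    | mem x h =>
      obtain ⟨a, l, hl, rfl⟩ := h
      obtain rfl := List.length_eq_zero_iff.mp hl
      simpa [word] using word_mem F (a * b) []
    | zero => simp
    | add x y _ _ hx hy => rw [add_mul]; exact add_mem hx hy
    | smul r x _ hx => rw [smul_mul_assoc]; exact Submodule.smul_mem _ _ hx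
  | succ n ih =>
    intro x hx b
    induction hx using Submodule.span_induction with
    | mem x h =>
      obtain ⟨a, l, hl, rfl⟩ := h
      obtain ⟨l, c, rfl⟩ := List.eq_nil_or_concat' l |>.resolve_left (by rintro rfl; simp at hl)
      obtain rfl : l.length = n := by simpa using hl
      have h : word F a (l ++ [c]) * ofAlg F b =
          word F a l * ofForm F (F.d (c * b)) -
            (word F a l * ofAlg F c) * ofForm F (F.d b) := by
        rw [word_snoc, F.leibniz, map_add, ofForm_smul, ofForm_op_smul]
        noncomm_ring
      rw [h]
      exact sub_mem (grade_mul_d F (word_mem F a l) _)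
        (grade_mul_d F (ih (word_mem F a l) c) _)
    | zero => simp
    | add x y _ _ hx hy => rw [add_mul]; exact add_mem hx hy
    | smul r x _ hx => rw [smul_mul_assoc]; exact Submodule.smul_mem _ _ hx

theorem grade_mul {m n : ℕ} {x y : F.MaxProl} (hx : x ∈ grade F m) (hy : y ∈ grade F n) :
    x * y ∈ grade F (m + n) := by
  induction hy using Submodule.span_induction with
  | mem y h =>
    obtain ⟨a, l, rfl, rfl⟩ := h
    induction l using List.reverseRecOn with
    | nil => simpa [word] using grade_mul_alg F m hx a
    | append_singleton l b ih =>
      rw [word_snoc, ← mul_assoc]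
      simpa [add_assoc] using grade_mul_d F ih b
  | zero => simp
  | add x y _ _ hx hy => rw [mul_add]; exact add_mem hx hy
  | smul r x _ hx => rw [mul_smul_comm]; exact Submodule.smul_mem _ _ hx

theorem ofAlg_mem (a : A) : ofAlg F a ∈ grade F 0 := by
  simpa [word] using word_mem F a []

instance : SetLike.GradedMonoid (grade F) where
  one_mem := by simpa using ofAlg_mem F 1
  mul_mem _ _ _ _ hx hy := grade_mul F hx hy

theorem ofForm_mem (γ : Γ) : ofForm F γ ∈ grade F 1 := by
  have h : γ ∈ Submodule.span k {γ : Γ | ∃ a b : A, γ = a • F.d b} := by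
    rw [F.span_eq_top]; trivial
  induction h using Submodule.span_induction with
  | mem x h =>
    obtain ⟨a, b, rfl⟩ := h
    simpa [word, ofForm_smul] using word_mem F a [b]
  | zero => simp
  | add x y _ _ hx hy => rw [map_add]; exact add_mem hx hy
  | smul r x _ hx => rw [map_smul]; exact Submodule.smul_mem _ _ hx

/-- The inclusion of `A` as the degree zero summand. -/
def decompAlg : A →ₐ[k] DirectSum ℕ (fun n => grade F n) :=
  AlgHom.ofLinearMap
    (DirectSum.lof k ℕ (fun n => grade F n) 0 ∘ₗ
      (ofAlg F).toLinearMap.codRestrict (grade F 0) (ofAlg_mem F))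
    (by
      change DirectSum.of (fun n => grade F n) 0 _ = DirectSum.of (fun n => grade F n) 0 _
      congr 1
      exact Subtype.ext (map_one (ofAlg F)))
    (fun a b => by
      change DirectSum.of (fun n => grade F n) 0 _ =
        DirectSum.of (fun n => grade F n) 0 _ * DirectSum.of (fun n => grade F n) 0 _
      rw [DirectSum.of_mul_of]
      exact DirectSum.of_eq_of_gradedMonoid_eq
        (Sigma.subtype_ext rfl (map_mul (ofAlg F) a b)))

/-- The map from the one-forms to the degree one summand. -/
def decompForm : Γ →ₗ[k] DirectSum ℕ (fun n => grade F n) :=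
  DirectSum.lof k ℕ (fun n => grade F n) 1 ∘ₗ (ofForm F).codRestrict (grade F 1) (ofForm_mem F)

theorem decompAlg_apply (a : A) :
    decompAlg F a = DirectSum.of (fun n => grade F n) 0 ⟨ofAlg F a, ofAlg_mem F a⟩ := rfl

theorem decompForm_apply (γ : Γ) :
    decompForm F γ = DirectSum.of (fun n => grade F n) 1 ⟨ofForm F γ, ofForm_mem F γ⟩ := rfl

/-- The decomposition into homogeneous components. -/
def decomp : F.MaxProl →ₐ[k] DirectSum ℕ (fun n => grade F n) :=
  lift F (R := DirectSum ℕ (fun n => grade F n)) (decompAlg F) (decompForm F)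
    (fun a γ => by
      rw [decompAlg_apply, decompForm_apply, decompForm_apply, DirectSum.of_mul_of]
      exact DirectSum.of_eq_of_gradedMonoid_eq
        (Sigma.subtype_ext (zero_add 1).symm (ofForm_smul F a γ)))
    (fun a γ => by
      rw [decompAlg_apply, decompForm_apply, decompForm_apply, DirectSum.of_mul_of]
      exact DirectSum.of_eq_of_gradedMonoid_eq
        (Sigma.subtype_ext (add_zero 1).symm (ofForm_op_smul F a γ)))
    (fun n b c h => by
      simp_rw [decompForm_apply, DirectSum.of_mul_of]
      rw [← map_sum, ← map_zero (DirectSum.of (fun n => grade F n) (1 + 1))]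
      congr 1
      apply Subtype.ext
      simpa [SetLike.coe_gMul] using ofForm_prolong F b c h)

theorem decomp_ofAlg (a : A) :
    decomp F (ofAlg F a) = DirectSum.of (fun n => grade F n) 0 ⟨ofAlg F a, ofAlg_mem F a⟩ := by
  rw [decomp, lift_ofAlg, decompAlg_apply]

theorem decomp_ofForm (γ : Γ) :
    decomp F (ofForm F γ) = DirectSum.of (fun n => grade F n) 1 ⟨ofForm F γ, ofForm_mem F γ⟩ := by
  rw [decomp, lift_ofForm, decompForm_apply]

theorem decomp_word (n : ℕ) (a : A) (l : List A) (hl : l.length = n)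
    (h : word F a l ∈ grade F n) :
    decomp F (word F a l) = DirectSum.of (fun n => grade F n) n ⟨word F a l, h⟩ := by
  induction l using List.reverseRecOn generalizing n with
  | nil =>
    obtain rfl : 0 = n := by simpa using hl
    have h0 : word F a [] = ofAlg F a := by simp [word]
    have := decomp_ofAlg F a
    simp only [h0]
    exact this
  | append_singleton l b ih =>
    obtain rfl : l.length + 1 = n := by simpa using hl
    have h0 := word_snoc F a l b
    simp only [h0, map_mul, decomp_ofForm, ih _ rfl (word_mem F a l), DirectSum.of_mul_of]
    rfl

instance : GradedAlgebra (grade F) :=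
  GradedAlgebra.ofAlgHom (grade F) (decomp F)
    (by
      ext x
      induction x using induction with
      | alg a => simp [decomp_ofAlg]
      | form γ => simp [decomp_ofForm]
      | mul x y hx hy => rw [map_mul, hx, hy, map_mul]
      | add x y hx hy => rw [map_add, hx, hy, map_add])
    (by
      rintro n ⟨x, hx⟩
      change decomp F x = _
      have hx' := hx
      induction hx' using Submodule.span_induction with
      | mem x h =>
        obtain ⟨a, l, hl, rfl⟩ := h
        exact decomp_word F n a l hl hx
      | zero =>
        rw [map_zero]
        exact (map_zero (DirectSum.of (fun n => grade F n) n)).symm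
      | add x y hx' hy' ihx ihy =>
        rw [map_add, ihx hx', ihy hy', ← map_add]
        rfl
      | smul r x hx' ihx =>
        rw [map_smul, ihx hx']
        exact (map_smul (DirectSum.lof k ℕ (fun n => grade F n) n) r ⟨x, hx'⟩).symm)

/-- The retraction onto `A` killing all forms of positive degree. -/
def toAlg : F.MaxProl →ₐ[k] A :=
  lift F (AlgHom.id k A) 0 (by simp) (by simp) (by simp)

theorem ofAlg_injective : Function.Injective (ofAlg F) :=
  Function.LeftInverse.injective (g := toAlg F) fun a => by simp [toAlg]

/-- `A ⊗ A → Γ^∧`, `a ⊗ b ↦ da db`. -/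
def dd : A ⊗[k] A →ₗ[k] F.MaxProl :=
  TensorProduct.lift
    ((LinearMap.mul k F.MaxProl).compl₁₂ (ofForm F ∘ₗ F.d) (ofForm F ∘ₗ F.d))

theorem toForm_surjective : Function.Surjective F.toForm := by
  rw [← LinearMap.range_eq_top, eq_top_iff, ← F.span_eq_top, Submodule.span_le]
  rintro _ ⟨a, b, rfl⟩
  exact ⟨a ⊗ₜ b, rfl⟩

theorem ker_toForm_le : LinearMap.ker F.toForm ≤ LinearMap.ker (dd F) := by
  intro t ht
  rw [LinearMap.mem_ker] at ht ⊢
  obtain ⟨n, b, c, rfl⟩ : ∃ (n : ℕ) (b c : Fin n → A), t = ∑ i, b i ⊗ₜ[k] c i := by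
    obtain ⟨S, rfl⟩ := TensorProduct.exists_finset t
    refine ⟨S.card, fun i => (S.equivFin.symm i).1.1, fun i => (S.equivFin.symm i).1.2, ?_⟩
    rw [← Finset.sum_coe_sort, ← S.equivFin.symm.sum_comp]
  rw [map_sum] at ht ⊢
  exact ofForm_prolong F b c ht

/-- The differential on one-forms, `a db ↦ da db`. -/
def d₁ : Γ →ₗ[k] F.MaxProl :=
  (LinearMap.ker F.toForm).liftQ (dd F) (ker_toForm_le F) ∘ₗ
    (F.toForm.quotKerEquivOfSurjective (toForm_surjective F)).symm.toLinearMap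

theorem d₁_toForm (t : A ⊗[k] A) : d₁ F (F.toForm t) = dd F t := by
  have h : (F.toForm.quotKerEquivOfSurjective (toForm_surjective F)).symm (F.toForm t) =
      Submodule.Quotient.mk t := by
    rw [LinearEquiv.symm_apply_eq]; rfl
  simp [d₁, h]

theorem d₁_smul_d (a b : A) :
    d₁ F (a • F.d b) = ofForm F (F.d a) * ofForm F (F.d b) :=
  d₁_toForm F (a ⊗ₜ b)

theorem fodc_d_one : F.d 1 = 0 := by simpa using F.leibniz 1 1

theorem d₁_d (a : A) : d₁ F (F.d a) = 0 := by
  simpa [fodc_d_one] using d₁_smul_d F 1 a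

theorem form_induction {C : Γ → Prop} (smul_d : ∀ a b : A, C (a • F.d b))
    (add : ∀ x y, C x → C y → C (x + y)) (γ : Γ) : C γ := by
  obtain ⟨t, rfl⟩ := toForm_surjective F γ
  induction t with
  | zero => simpa using smul_d 0 0
  | tmul a b => exact smul_d a b
  | add x y hx hy => rw [map_add]; exact add _ _ hx hy

theorem d₁_smul (a : A) (γ : Γ) :
    d₁ F (a • γ) = ofForm F (F.d a) * ofForm F γ + ofAlg F a * d₁ F γ := by
  induction γ using form_induction F with
  | smul_d b c =>
    rw [← mul_smul, d₁_smul_d, d₁_smul_d, F.leibniz, map_add, ofForm_smul, ofForm_smul,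
      ofForm_op_smul]
    noncomm_ring
  | add x y hx hy => rw [smul_add, map_add, hx, hy, map_add, map_add]; noncomm_ring

theorem d₁_op_smul (a : A) (γ : Γ) :
    d₁ F (MulOpposite.op a • γ) = d₁ F γ * ofAlg F a - ofForm F γ * ofForm F (F.d a) := by
  induction γ using form_induction F with
  | smul_d b c =>
    have h : MulOpposite.op a • b • F.d c = b • F.d (c * a) - (b * c) • F.d a := by
      rw [F.leibniz, smul_add, mul_smul, add_sub_cancel_right,
        ← smul_comm b (MulOpposite.op a)]
    rw [h, map_sub, d₁_smul_d, d₁_smul_d, d₁_smul_d, F.leibniz, F.leibniz, map_add, map_add,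
      ofForm_smul, ofForm_smul, ofForm_op_smul, ofForm_op_smul]
    noncomm_ring
  | add x y hx hy => rw [smul_add, map_add, hx, hy, map_add, map_add]; noncomm_ring

/-- Auxiliary for `triang`. -/
def triangAlg : A →ₐ[k] Matrix (Fin 2) (Fin 2) F.MaxProl :=
  AlgHom.ofLinearMap
    ({ toFun := fun a => !![ofAlg F a, ofForm F (F.d a); 0, ofAlg F a]
       map_add' := fun a b => by ext i j; fin_cases i <;> fin_cases j <;> simp
       map_smul' := fun r a => by ext i j; fin_cases i <;> fin_cases j <;> simp } :
      A →ₗ[k] Matrix (Fin 2) (Fin 2) F.MaxProl)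
    (by ext i j; fin_cases i <;> fin_cases j <;> simp [fodc_d_one])
    (fun a b => by
      ext i j
      fin_cases i <;> fin_cases j <;>
        simp [F.leibniz, ofForm_smul, ofForm_op_smul, add_comm, Matrix.mul_apply])

/-- Auxiliary for `triang`. -/
def triangForm : Γ →ₗ[k] Matrix (Fin 2) (Fin 2) F.MaxProl where
  toFun γ := !![-ofForm F γ, d₁ F γ; 0, ofForm F γ]
  map_add' a b := by ext i j; fin_cases i <;> fin_cases j <;> simp [add_comm]
  map_smul' r a := by ext i j; fin_cases i <;> fin_cases j <;> simp

theorem triangAlg_apply (a : A) :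
    triangAlg F a = !![ofAlg F a, ofForm F (F.d a); 0, ofAlg F a] := rfl

theorem triangForm_apply (γ : Γ) :
    triangForm F γ = !![-ofForm F γ, d₁ F γ; 0, ofForm F γ] := rfl

/-- An auxiliary algebra morphism to triangular matrices, with entries `±x`, `dx`, `x`. -/
def triang : F.MaxProl →ₐ[k] Matrix (Fin 2) (Fin 2) F.MaxProl :=
  lift F (triangAlg F) (triangForm F)
    (fun a γ => by
      ext i j
      fin_cases i <;> fin_cases j <;>
        simp [triangAlg_apply, triangForm_apply, d₁_smul, ofForm_smul, Matrix.mul_apply, add_comm])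
    (fun a γ => by
      ext i j
      fin_cases i <;> fin_cases j <;>
        simp [triangAlg_apply, triangForm_apply, d₁_op_smul, ofForm_op_smul, Matrix.mul_apply,
          sub_eq_add_neg, add_comm])
    (fun n b c h => by
      have := ofForm_prolong F b c h
      ext i j
      fin_cases i <;> fin_cases j <;> simp [triangForm_apply, d₁_d, Matrix.sum_apply, this])

/-- The differential of the maximal prolongation. -/
def d : F.MaxProl →ₗ[k] F.MaxProl where
  toFun x := triang F x 0 1
  map_add' x y := by simp
  map_smul' r x := by simp

/-- The grading involution of the maximal prolongation. -/
def sgn : F.MaxProl →ₗ[k] F.MaxProl where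
  toFun x := triang F x 0 0
  map_add' x y := by simp
  map_smul' r x := by simp

theorem triang_ofAlg (a : A) :
    triang F (ofAlg F a) = !![ofAlg F a, ofForm F (F.d a); 0, ofAlg F a] := by
  rw [triang, lift_ofAlg, triangAlg_apply]

theorem triang_ofForm (γ : Γ) :
    triang F (ofForm F γ) = !![-ofForm F γ, d₁ F γ; 0, ofForm F γ] := by
  rw [triang, lift_ofForm, triangForm_apply]

theorem d_ofAlg (a : A) : d F (ofAlg F a) = ofForm F (F.d a) := by
  simp [d, triang_ofAlg]

theorem d_ofForm (γ : Γ) : d F (ofForm F γ) = d₁ F γ := by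
  simp [d, triang_ofForm]

theorem sgn_ofAlg (a : A) : sgn F (ofAlg F a) = ofAlg F a := by
  simp [sgn, triang_ofAlg]

theorem sgn_ofForm (γ : Γ) : sgn F (ofForm F γ) = -ofForm F γ := by
  simp [sgn, triang_ofForm]

theorem triang_lower (x : F.MaxProl) : triang F x 1 0 = 0 ∧ triang F x 1 1 = x := by
  induction x using induction with
  | alg a => simp [triang_ofAlg]
  | form γ => simp [triang_ofForm]
  | mul x y hx hy => simp [Matrix.mul_apply, hx, hy]
  | add x y hx hy => simp [hx, hy]

theorem sgn_mul (x y : F.MaxProl) : sgn F (x * y) = sgn F x * sgn F y := by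
  simp [sgn, Matrix.mul_apply, triang_lower]

theorem d_mul (x y : F.MaxProl) : d F (x * y) = d F x * y + sgn F x * d F y := by
  simp [sgn, d, Matrix.mul_apply, triang_lower, add_comm]

theorem sgn_dd (t : A ⊗[k] A) : sgn F (dd F t) = dd F t := by
  induction t with
  | zero => simp
  | tmul a b => simp [dd, sgn_mul, sgn_ofForm]
  | add x y hx hy => rw [map_add, map_add, hx, hy]

theorem d_dd (t : A ⊗[k] A) : d F (dd F t) = 0 := by
  induction t with
  | zero => simp
  | tmul a b => simp [dd, d_mul, d_ofForm, d₁_d]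
  | add x y hx hy => rw [map_add, map_add, hx, hy, add_zero]

theorem sgn_d (x : F.MaxProl) : sgn F (d F x) = -d F (sgn F x) := by
  induction x using induction with
  | alg a => simp [sgn_ofAlg, d_ofAlg, sgn_ofForm]
  | form γ =>
    obtain ⟨t, rfl⟩ := toForm_surjective F γ
    simp [sgn_ofForm, d_ofForm, d₁_toForm, sgn_dd]
  | mul x y hx hy =>
    rw [d_mul, map_add, sgn_mul, sgn_mul, sgn_mul, d_mul, hx, hy]; noncomm_ring
  | add x y hx hy => rw [map_add, map_add, hx, hy, map_add, map_add]; abel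

theorem d_d (x : F.MaxProl) : d F (d F x) = 0 := by
  induction x using induction with
  | alg a => simp [d_ofAlg, d_ofForm, d₁_d]
  | form γ =>
    obtain ⟨t, rfl⟩ := toForm_surjective F γ
    simp [d_ofForm, d₁_toForm, d_dd]
  | mul x y hx hy =>
    rw [d_mul, map_add, d_mul, d_mul, hx, hy, sgn_d]; noncomm_ring
  | add x y hx hy => rw [map_add, map_add, hx, hy, add_zero]

theorem sgn_of_mem {n : ℕ} {x : F.MaxProl} (hx : x ∈ grade F n) :
    sgn F x = (-1 : k) ^ n • x := by
  induction hx using Submodule.span_induction with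
  | mem x h =>
    obtain ⟨a, l, rfl, rfl⟩ := h
    induction l using List.reverseRecOn with
    | nil => simp [word, sgn_ofAlg]
    | append_singleton l b ih => simp [word_snoc, sgn_mul, ih, sgn_ofForm, pow_succ]
  | zero => simp
  | add x y _ _ hx hy => rw [map_add, hx, hy, smul_add]
  | smul r x _ hx => rw [map_smul, hx, smul_comm]

theorem d_mem {n : ℕ} {x : F.MaxProl} (hx : x ∈ grade F n) : d F x ∈ grade F (n + 1) := by
  induction hx using Submodule.span_induction with
  | mem x h =>
    obtain ⟨a, l, rfl, rfl⟩ := h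
    induction l using List.reverseRecOn with
    | nil => simpa [word, d_ofAlg] using ofForm_mem F (F.d a)
    | append_singleton l b ih =>
      rw [word_snoc, d_mul, d_ofForm, d₁_d, mul_zero, add_zero]
      simpa using grade_mul_d F ih b
  | zero => simp
  | add x y _ _ hx hy => rw [map_add]; exact add_mem hx hy
  | smul r x _ hx => rw [map_smul]; exact Submodule.smul_mem _ _ hx

end MaxProl
end FODC
end MaximalProlongation

/-! ### Differential calculi -/

/-- A differential calculus on `A`: a differential graded algebra `Ω` (graded by `ℕ`) whose degree
zero part is identified with `A` through `ι`, and which is generated in degree zero, i.e.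
`Ωⁿ` is spanned by the elements `a₀ da₁ ⋯ daₙ`. -/
structure DiffCalc (k A Ω : Type u) [Field k] [Ring A] [Algebra k A] [Ring Ω] [Algebra k Ω] where
  gr : ℕ → Submodule k Ω
  graded : GradedAlgebra gr
  ι : A →ₐ[k] Ω
  ι_injective : Function.Injective ι
  d : Ω →ₗ[k] Ω
  d_mem : ∀ {n : ℕ} {ω : Ω}, ω ∈ gr n → d ω ∈ gr (n + 1)
  d_d : ∀ ω : Ω, d (d ω) = 0
  leibniz : ∀ {n : ℕ} {ω : Ω}, ω ∈ gr n → ∀ η : Ω, d (ω * η) = d ω * η + (-1 : k) ^ n • (ω * d η)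
  gr_eq_span : ∀ n : ℕ, gr n = Submodule.span k {ω : Ω | ∃ (a : A) (l : List A),
    l.length = n ∧ ω = ι a * (l.map fun b => d (ι b)).prod}

attribute [instance] DiffCalc.graded

/-- The maximal prolongation of a first order differential calculus, as a differential calculus. -/
def FODC.maxProlongation {k A Γ : Type u} [Field k] [Ring A] [Algebra k A] [AddCommGroup Γ]
    [Module k Γ] [Module A Γ] [Module Aᵐᵒᵖ Γ] [SMulCommClass A Aᵐᵒᵖ Γ]
    [IsScalarTower k A Γ] [IsScalarTower k Aᵐᵒᵖ Γ] (F : FODC k A Γ) : DiffCalc k A F.MaxProl where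
  gr := MaxProl.grade F
  graded := inferInstance
  ι := MaxProl.ofAlg F
  ι_injective := MaxProl.ofAlg_injective F
  d := MaxProl.d F
  d_mem := MaxProl.d_mem F
  d_d := MaxProl.d_d F
  leibniz := fun hω η => by
    rw [MaxProl.d_mul, MaxProl.sgn_of_mem F hω, smul_mul_assoc]
  gr_eq_span := fun n => by
    simp only [MaxProl.grade, MaxProl.word, MaxProl.d_ofAlg]

namespace DiffCalc

variable {k A Ω H Ξ : Type u} [Field k] [Ring A] [Algebra k A] [Ring Ω] [Algebra k Ω]
  [Ring H] [Algebra k H] [Ring Ξ] [Algebra k Ξ]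

/-- The form `a₀ da₁ ⋯ daₙ`. -/
def form (C : DiffCalc k A Ω) (a : A) (l : List A) : Ω :=
  C.ι a * (l.map fun b => C.d (C.ι b)).prod

/-- The grading involution `ω ↦ (-1)^|ω| ω`. -/
def sgn (C : DiffCalc k A Ω) : Ω →ₗ[k] Ω :=
  DirectSum.toModule k ℕ Ω (fun n => (-1 : k) ^ n • (C.gr n).subtype) ∘ₗ
    (DirectSum.decomposeLinearEquiv C.gr).toLinearMap

/-- The differential `ω ⊗ η ↦ dω ⊗ η + (-1)^|ω| ω ⊗ dη` of the tensor product calculus, whose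
product `(ω ⊗ η)(ω' ⊗ η') = (-1)^(|η||ω'|) ωω' ⊗ ηη'` is that of Mathlib's graded tensor product. -/
def tensorD (C : DiffCalc k A Ω) (D : DiffCalc k H Ξ) :
    (C.gr ᵍ⊗[k] D.gr) →ₗ[k] (C.gr ᵍ⊗[k] D.gr) :=
  (GradedTensorProduct.of k C.gr D.gr).toLinearMap ∘ₗ
    (TensorProduct.map C.d LinearMap.id + TensorProduct.map C.sgn D.d) ∘ₗ
      (GradedTensorProduct.of k C.gr D.gr).symm.toLinearMap

/-- The degree `n` part of the tensor product calculus. -/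
def tensorGr (C : DiffCalc k A Ω) (D : DiffCalc k H Ξ) (n : ℕ) : Submodule k (C.gr ᵍ⊗[k] D.gr) :=
  Submodule.span k {x | ∃ (r s : ℕ) (ω : Ω) (η : Ξ), r + s = n ∧ ω ∈ C.gr r ∧ η ∈ D.gr s ∧
    x = GradedTensorProduct.of k C.gr D.gr (ω ⊗ₜ η)}

end DiffCalc

/-! ### Bicovariant first order calculi on a Hopf algebra -/

section Bicovariant

variable {k H Γ : Type u} [Field k] [Ring H] [HopfAlgebra k H] [AddCommGroup Γ]
  [Module k Γ] [Module H Γ] [Module Hᵐᵒᵖ Γ] [SMulCommClass H Hᵐᵒᵖ Γ]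
  [IsScalarTower k H Γ] [IsScalarTower k Hᵐᵒᵖ Γ]

/-- The coactions making `Γ` a bicovariant `H`-bimodule (both coactions are bimodule maps over the
comultiplication, and they commute) for which the differential is left and right colinear. -/
structure FODC.Bicovariance (F : FODC k H Γ) where
  /-- the right coaction -/
  right : Γ →ₗ[k] Γ ⊗[k] H
  right_coassoc : (TensorProduct.assoc k Γ H H).toLinearMap ∘ₗ right.rTensor H ∘ₗ right =
    (Coalgebra.comul (R := k) (A := H)).lTensor Γ ∘ₗ right
  right_counit : (TensorProduct.rid k Γ).toLinearMap ∘ₗ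
    (Coalgebra.counit (R := k) (A := H)).lTensor Γ ∘ₗ right = LinearMap.id
  right_smul : ∀ (h : H) (γ : Γ), right (h • γ) =
    TensorProduct.map₂ (leftAct k H Γ) (LinearMap.mul k H) (Coalgebra.comul (R := k) h) (right γ)
  right_op_smul : ∀ (h : H) (γ : Γ), right (MulOpposite.op h • γ) =
    TensorProduct.map₂ (rightAct k H Γ) (LinearMap.mul k H).flip (Coalgebra.comul (R := k) h)
      (right γ)
  right_d : ∀ h : H, right (F.d h) = F.d.rTensor H (Coalgebra.comul (R := k) h)
  /-- the left coaction -/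
  left : Γ →ₗ[k] H ⊗[k] Γ
  left_coassoc : (TensorProduct.assoc k H H Γ).toLinearMap ∘ₗ
    (Coalgebra.comul (R := k) (A := H)).rTensor Γ ∘ₗ left = left.lTensor H ∘ₗ left
  left_counit : (TensorProduct.lid k Γ).toLinearMap ∘ₗ
    (Coalgebra.counit (R := k) (A := H)).rTensor Γ ∘ₗ left = LinearMap.id
  left_smul : ∀ (h : H) (γ : Γ), left (h • γ) =
    TensorProduct.map₂ (LinearMap.mul k H) (leftAct k H Γ) (Coalgebra.comul (R := k) h) (left γ)
  left_op_smul : ∀ (h : H) (γ : Γ), left (MulOpposite.op h • γ) =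
    TensorProduct.map₂ (LinearMap.mul k H).flip (rightAct k H Γ) (Coalgebra.comul (R := k) h)
      (left γ)
  left_d : ∀ h : H, left (F.d h) = F.d.lTensor H (Coalgebra.comul (R := k) h)
  left_right : (TensorProduct.assoc k H Γ H).toLinearMap ∘ₗ left.rTensor H ∘ₗ right =
    right.lTensor H ∘ₗ left

/-- A first order differential calculus on a Hopf algebra is bicovariant if it admits left and
right coactions as above (they are then unique). -/
def FODC.IsBicovariant (F : FODC k H Γ) : Prop := Nonempty F.Bicovariance

end Bicovariant

/-! ### Balanced tensor products and faithful flatness -/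

section Balanced

variable {k R : Type u} [Field k] [Ring R] [Algebra k R] (S : Subalgebra k R)

/-- The relations `rs ⊗ m = r ⊗ sm` of the balanced tensor product. -/
def balancedRel (M : Type u) [AddCommGroup M] [Module k M] [Module S M] :
    Submodule k (R ⊗[k] M) :=
  Submodule.span k {z | ∃ (r : R) (s : S) (m : M), z = (r * s) ⊗ₜ[k] m - r ⊗ₜ[k] (s • m)}

/-- The balanced tensor product `R ⊗_S M` of the right `S`-module `R` with a left `S`-module. -/
abbrev BalTensor (M : Type u) [AddCommGroup M] [Module k M] [Module S M] : Type u :=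
  (R ⊗[k] M) ⧸ balancedRel S M

/-- The projection `R ⊗_k M → R ⊗_S M`. -/
abbrev toBal (M : Type u) [AddCommGroup M] [Module k M] [Module S M] :
    R ⊗[k] M →ₗ[k] BalTensor S M :=
  (balancedRel S M).mkQ

/-- The element `r ⊗_S m`. -/
def balTmul {M : Type u} [AddCommGroup M] [Module k M] [Module S M] (r : R) (m : M) :
    BalTensor S M :=
  toBal S M (r ⊗ₜ m)

variable {S}

theorem balancedRel_le_ker {M N : Type u} [AddCommGroup M] [Module k M] [Module S M]
    [AddCommGroup N] [Module k N] (f : R ⊗[k] M →ₗ[k] N)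
    (h : ∀ (r : R) (s : S) (m : M), f ((r * s) ⊗ₜ m) = f (r ⊗ₜ (s • m))) :
    balancedRel S M ≤ LinearMap.ker f := by
  rw [balancedRel, Submodule.span_le]
  rintro _ ⟨r, s, m, rfl⟩
  simp [h]

/-- The map `id ⊗_S f : R ⊗_S M → R ⊗_S N` induced by an `S`-linear map. -/
def balMap {M N : Type u} [AddCommGroup M] [Module k M] [Module S M] [IsScalarTower k S M]
    [AddCommGroup N] [Module k N] [Module S N] [IsScalarTower k S N] (f : M →ₗ[S] N) :
    BalTensor S M →ₗ[k] BalTensor S N :=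
  (balancedRel S M).liftQ (toBal S N ∘ₗ (f.restrictScalars k).lTensor R)
    (balancedRel_le_ker _ fun r s m => by
      rw [← sub_eq_zero, ← map_sub]
      simp only [LinearMap.comp_apply, map_sub, LinearMap.lTensor_tmul,
        LinearMap.restrictScalars_apply, map_smul]
      rw [← map_sub]
      exact (Submodule.Quotient.mk_eq_zero _).mpr (Submodule.subset_span ⟨r, s, f m, rfl⟩))

variable (S)

/-- `R` is faithfully flat as a right `S`-module: the functor `R ⊗_S -` from left `S`-modules to
`k`-vector spaces preserves and reflects exact sequences. (The `k`-structure of an `S`-module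
is the restriction of its `S`-structure.) -/
def IsRightFaithfullyFlat : Prop :=
  ∀ (M N P : Type u) [AddCommGroup M] [Module k M] [Module S M] [IsScalarTower k S M]
    [AddCommGroup N] [Module k N] [Module S N] [IsScalarTower k S N]
    [AddCommGroup P] [Module k P] [Module S P] [IsScalarTower k S P]
    (f : M →ₗ[S] N) (g : N →ₗ[S] P),
    Function.Exact f g ↔ Function.Exact (balMap f) (balMap g)

end Balanced

/-! ### Comodule algebras and quantum principal bundles -/

/-- A right `H`-comodule algebra structure on `A`. -/
structure ComodAlg (k H A : Type u) [Field k] [Ring H] [HopfAlgebra k H] [Ring A]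
    [Algebra k A] where
  coact : A →ₐ[k] A ⊗[k] H
  coassoc : (TensorProduct.assoc k A H H).toLinearMap ∘ₗ coact.toLinearMap.rTensor H ∘ₗ
    coact.toLinearMap = (Coalgebra.comul (R := k) (A := H)).lTensor A ∘ₗ coact.toLinearMap
  counit : (TensorProduct.rid k A).toLinearMap ∘ₗ
    (Coalgebra.counit (R := k) (A := H)).lTensor A ∘ₗ coact.toLinearMap = LinearMap.id

namespace ComodAlg

variable {k H A : Type u} [Field k] [Ring H] [HopfAlgebra k H] [Ring A] [Algebra k A]

/-- The subalgebra `B = {a | Δ(a) = a ⊗ 1}` of coinvariants. -/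
def coinv (ρ : ComodAlg k H A) : Subalgebra k A :=
  AlgHom.equalizer ρ.coact Algebra.TensorProduct.includeLeft

theorem coact_coinv (ρ : ComodAlg k H A) (b : ρ.coinv) : ρ.coact b = (b : A) ⊗ₜ 1 := b.2

/-- The canonical map `χ : A ⊗_B A → A ⊗ H`, `a ⊗ a' ↦ a Δ(a')`. -/
def canon (ρ : ComodAlg k H A) : BalTensor ρ.coinv A →ₗ[k] A ⊗[k] H :=
  (balancedRel ρ.coinv A).liftQ
    (TensorProduct.lift ((LinearMap.mul k (A ⊗[k] H)).compl₁₂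
      (Algebra.TensorProduct.includeLeft : A →ₐ[k] A ⊗[k] H).toLinearMap ρ.coact.toLinearMap))
    (balancedRel_le_ker _ fun a b a' => by
      simp [Subalgebra.smul_def, coact_coinv, ← mul_assoc])

/-- `B ⊆ A` is a faithfully flat Hopf–Galois extension. -/
structure IsQPB (ρ : ComodAlg k H A) : Prop where
  galois : Function.Bijective ρ.canon
  faithfullyFlat : IsRightFaithfullyFlat ρ.coinv

/-- The translation map `τ : H → A ⊗_B A`, `τ(h) = χ⁻¹(1 ⊗ h)`. -/
def translation (ρ : ComodAlg k H A) (hρ : ρ.IsQPB) : H →ₗ[k] BalTensor ρ.coinv A :=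
  (LinearEquiv.ofBijective ρ.canon hρ.galois).symm.toLinearMap ∘ₗ TensorProduct.mk k A H 1

end ComodAlg

/-! ### Complete calculi -/

/-- Completeness of a differential calculus `C` on the comodule algebra `A`, with respect to a
calculus `D` on `H`: the coaction extends to a morphism `Ω(A) → Ω(A) ⊗ Ω(H)` of differential
graded algebras (which is then unique). -/
structure ComodAlg.Completeness {k H A Ω Ξ : Type u} [Field k] [Ring H] [HopfAlgebra k H] [Ring A]
    [Algebra k A] [Ring Ω] [Algebra k Ω] [Ring Ξ] [Algebra k Ξ]
    (ρ : ComodAlg k H A) (C : DiffCalc k A Ω) (D : DiffCalc k H Ξ) where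
  coact : Ω →ₐ[k] C.gr ᵍ⊗[k] D.gr
  coact_mem : ∀ {n : ℕ} {ω : Ω}, ω ∈ C.gr n → coact ω ∈ C.tensorGr D n
  coact_d : ∀ ω : Ω, coact (C.d ω) = C.tensorD D (coact ω)
  coact_ι : ∀ a : A, coact (C.ι a) = GradedTensorProduct.of k C.gr D.gr
    (TensorProduct.map C.ι.toLinearMap D.ι.toLinearMap (ρ.coact a))

namespace ComodAlg.Completeness

variable {k H A Ω Ξ : Type u} [Field k] [Ring H] [HopfAlgebra k H] [Ring A]
  [Algebra k A] [Ring Ω] [Algebra k Ω] [Ring Ξ] [Algebra k Ξ]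
  {ρ : ComodAlg k H A} {C : DiffCalc k A Ω} {D : DiffCalc k H Ξ}

/-- The base forms `Ω(B) = {ω | Δ(ω) = ω ⊗ 1}`. -/
def base (Δ : ρ.Completeness C D) : Subalgebra k Ω :=
  AlgHom.equalizer Δ.coact (GradedTensorProduct.includeLeft C.gr D.gr)

theorem ι_mem_base (Δ : ρ.Completeness C D) (b : ρ.coinv) : C.ι b ∈ Δ.base := by
  change Δ.coact (C.ι b) = GradedTensorProduct.of k C.gr D.gr (C.ι b ⊗ₜ 1)
  rw [Δ.coact_ι, ρ.coact_coinv]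
  simp

/-- The balanced tensor product `Ω(A) ⊗_{Ω(B)} Ω(A)`. -/
abbrev Bal (Δ : ρ.Completeness C D) : Type u := BalTensor Δ.base Ω

/-- The element `ω ⊗_{Ω(B)} η`. -/
abbrev tmul (Δ : ρ.Completeness C D) (ω η : Ω) : Δ.Bal := balTmul Δ.base ω η

/-- The degree `n` part of `Ω(A) ⊗_{Ω(B)} Ω(A)`. -/
def balGr (Δ : ρ.Completeness C D) (n : ℕ) : Submodule k Δ.Bal :=
  Submodule.span k {x | ∃ (r s : ℕ) (ω η : Ω), r + s = n ∧ ω ∈ C.gr r ∧ η ∈ C.gr s ∧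
    x = Δ.tmul ω η}

/-- The map `A ⊗_B A → Ω(A) ⊗_{Ω(B)} Ω(A)` induced by the inclusion of `A` in degree zero. -/
def incl (Δ : ρ.Completeness C D) : BalTensor ρ.coinv A →ₗ[k] Δ.Bal :=
  (balancedRel ρ.coinv A).liftQ
    (toBal Δ.base Ω ∘ₗ TensorProduct.map C.ι.toLinearMap C.ι.toLinearMap)
    (balancedRel_le_ker _ fun a b a' => by
      rw [← sub_eq_zero, ← map_sub]
      refine (Submodule.Quotient.mk_eq_zero _).mpr
        (Submodule.subset_span ⟨C.ι a, ⟨C.ι b, Δ.ι_mem_base b⟩, C.ι a', ?_⟩)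
      simp [Subalgebra.smul_def])

end ComodAlg.Completeness

/-! ### The "inside-out" expressions -/

namespace DiffCalc

variable {k A Ω : Type u} [Field k] [Ring A] [Algebra k A] [Ring Ω] [Algebra k Ω]

/-- Insertion of the second argument into the middle of the first one:
`(x ⊗ y, ω ⊗ η) ↦ xω ⊗ ηy`. -/
def insert (k Ω : Type u) [Field k] [Ring Ω] [Algebra k Ω] :
    Ω ⊗[k] Ω →ₗ[k] Ω ⊗[k] Ω →ₗ[k] Ω ⊗[k] Ω :=
  TensorProduct.map₂ (LinearMap.mul k Ω) (LinearMap.mul k Ω).flip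

/-- Passing from a form `θ` of degree `n` to `θ ∧ dg`: if `x ⊗ y` represents `τ(g)`, then `ω ⊗ η`
is replaced by `(-1)^n dx ω ⊗ η y + x ω ⊗ η dy`. -/
def insideOutStep (C : DiffCalc k A Ω) (n : ℕ) (t : A ⊗[k] A) (w : Ω ⊗[k] Ω) : Ω ⊗[k] Ω :=
  (-1 : k) ^ n •
      insert k Ω (TensorProduct.map (C.d ∘ₗ C.ι.toLinearMap) C.ι.toLinearMap t) w +
    insert k Ω (TensorProduct.map C.ι.toLinearMap (C.d ∘ₗ C.ι.toLinearMap) t) w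

/-- Iteration of `insideOutStep`, starting in degree `n`. -/
def insideOutAux (C : DiffCalc k A Ω) : ℕ → Ω ⊗[k] Ω → List (A ⊗[k] A) → Ω ⊗[k] Ω
  | _, w, [] => w
  | n, w, t :: ts => insideOutAux C (n + 1) (insideOutStep C n t w) ts

/-- The inside-out expression for `h₀ dh₁ ⋯ dhₙ`, in terms of representatives
`t₀, t₁, …, tₙ ∈ A ⊗_k A` of `τ(h₀), τ(h₁), …, τ(hₙ)`. -/
def insideOut (C : DiffCalc k A Ω) (t₀ : A ⊗[k] A) (ts : List (A ⊗[k] A)) : Ω ⊗[k] Ω :=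
  insideOutAux C 0 (TensorProduct.map C.ι.toLinearMap C.ι.toLinearMap t₀) ts

end DiffCalc

end NCG
end

/-!
The space `M = Ω(A) ⊗_{Ω(B)} Ω(A)` is a differential graded bimodule over `Ω(A)`, and the *graded
centralizer* of `Ω(B)` in `M` (`Completeness.centralizer`),
`Z = {z | β z = ± z β for all base forms β}`, is an algebra under insertion,
`z * (ω ⊗ η) = ± ω z η`. The inside-out formula says exactly that the extended translation map is
an algebra morphism `Ω(H) → Z` with `h ↦ τ(h)` and `dh ↦ d(τ(h))`, where `d` is the differential of
`M`. As `Ω(H)` is presented by generators `H`, `Γ` and relations, it suffices to prove that `τ(h)`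
is in `Z`, that `τ(hg) = τ(h) * τ(g)`, and that the relations are respected.

* `τ(h)` centralizes `Ω(B)` (`balRight_translation`). This and the relations on one-forms depend on
  the identification of the horizontal forms `hor(A)`, those `v` with `Δ(v) ∈ Ω(A) ⊗ H`, as
  `A Ω(B) = hor(A) = Ω(B) A` (`IsHorizontal.mem_span_ι_mul` and `IsHorizontal.mem_span_mul_ι`). For
  the first equality, `v` is the product of the factors of `τ(S⁻¹(v₁)) v₀`, a tensor which lies in
  `A ⊗_B Ω(B)` by flatness. Then `A ⊗_B hor(A) ≅ hor(A) ⊗ H`, and in this description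
  `A ⊗_B Ω(B) A` is everything, so faithful flatness gives the second equality. Consequently `x ⊗ v`
  in `M`, with `v` horizontal, is determined by `x v₀ ⊗ v₁ ∈ Ω(A) ⊗ H` (`tmul_horizontal`).
* If `∑ aᵢ dbᵢ = 0` in `Γ` then `∑ τ(aᵢ) * d(τ(bᵢ)) = 0` (`lift_balSandwich_eq_zero`). Each term
  is a sum of `d(b⁽¹⁾) a⁽¹⁾ ⊗ a⁽²⁾ b⁽²⁾` and `b⁽¹⁾ a⁽¹⁾ ⊗ a⁽²⁾ d(b⁽²⁾)`. The defect of the second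
  summand to lie in `A ⊗_B hor(A)` depends only on the coactions of `H` on the one-form `a db`, by
  bicovariance. So the second summands add up to an element of `A ⊗_B hor(A)`, which is determined
  by its image in `Ω(A) ⊗ H`; by the Leibniz rule this image is the negative of that of the first
  summands.
* The relations `∑ dbᵢ ∧ dcᵢ = 0` of the maximal prolongation are the differentials of the relations
  `∑ bᵢ dcᵢ = 0`, and `d(τ(b) * d(τ(c))) = d(τ(b)) * d(τ(c))`
  (`sum_translationD_mul_translationD`).
-/

noncomputable section

namespace NCG

/-! ### The inverse antipode -/

section Antipode

variable {k H : Type u} [Field k] [Ring H] [HopfAlgebra k H]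

/-- The inverse of a bijective antipode. -/
def antipodeInv (hS : Function.Bijective (HopfAlgebra.antipode k (A := H))) : H →ₗ[k] H :=
  (LinearEquiv.ofBijective (HopfAlgebra.antipode k (A := H)) hS).symm.toLinearMap

variable (hS : Function.Bijective (HopfAlgebra.antipode k (A := H)))

@[simp] theorem antipode_antipodeInv (h : H) :
    HopfAlgebra.antipode k (antipodeInv hS h) = h :=
  (LinearEquiv.ofBijective (HopfAlgebra.antipode k (A := H)) hS).apply_symm_apply h

theorem antipodeInv_mul (a b : H) :
    antipodeInv hS (a * b) = antipodeInv hS b * antipodeInv hS a := by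
  apply hS.1
  simp [HopfAlgebra.antipode_mul_antidistrib]

theorem counit_antipodeInv (h : H) :
    Coalgebra.counit (R := k) (antipodeInv hS h) = Coalgebra.counit (R := k) h := by
  rw [← HopfAlgebra.counit_antipode, antipode_antipodeInv]

/-- `h₂ S⁻¹(h₁) = ε(h)`. -/
theorem mul_antipodeInv_comul (h : H) :
    TensorProduct.lift ((LinearMap.mul k H).flip ∘ₗ antipodeInv hS) (Coalgebra.comul (R := k) h) =
      algebraMap k H (Coalgebra.counit (R := k) h) := by
  apply hS.1
  rw [← HopfAlgebra.mul_antipode_lTensor_comul_apply]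
  have : ∀ x : H ⊗[k] H, HopfAlgebra.antipode k
      (TensorProduct.lift ((LinearMap.mul k H).flip ∘ₗ antipodeInv hS) x) =
      LinearMap.mul' k H ((HopfAlgebra.antipode k).lTensor H x) := by
    intro x
    induction x with
    | zero => simp
    | tmul a b => simp [HopfAlgebra.antipode_mul_antidistrib]
    | add x y hx hy => simp only [map_add, hx, hy]
  rw [this, HopfAlgebra.mul_antipode_lTensor_comul_apply, Algebra.algebraMap_eq_smul_one, map_smul,
    HopfAlgebra.antipode_one]

/-- `S⁻¹(h₂) h₁ = ε(h)`. -/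
theorem antipodeInv_mul_comul (h : H) :
    TensorProduct.lift ((LinearMap.mul k H).flip.compl₂ (antipodeInv hS))
      (Coalgebra.comul (R := k) h) = algebraMap k H (Coalgebra.counit (R := k) h) := by
  apply hS.1
  have : ∀ x : H ⊗[k] H, HopfAlgebra.antipode k
      (TensorProduct.lift ((LinearMap.mul k H).flip.compl₂ (antipodeInv hS)) x) =
      LinearMap.mul' k H ((HopfAlgebra.antipode k).rTensor H x) := by
    intro x
    induction x with
    | zero => simp
    | tmul a b => simp [HopfAlgebra.antipode_mul_antidistrib]
    | add x y hx hy => simp only [map_add, hx, hy]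
  rw [this, HopfAlgebra.mul_antipode_rTensor_comul_apply, Algebra.algebraMap_eq_smul_one, map_smul,
    HopfAlgebra.antipode_one]

/-- `Δ(h₂) (S⁻¹(h₁) ⊗ 1) = 1 ⊗ h`. -/
theorem comul_mul_antipodeInv (h : H) :
    TensorProduct.lift ((LinearMap.mul k (H ⊗[k] H)).flip.compl₁₂
      ((TensorProduct.mk k H H).flip 1 ∘ₗ antipodeInv hS) (Coalgebra.comul (R := k) (A := H)))
      (Coalgebra.comul (R := k) h) = 1 ⊗ₜ h := by
  let t : H ⊗[k] (H ⊗[k] H) →ₗ[k] H ⊗[k] H :=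
    (TensorProduct.lift ((LinearMap.mul k H).flip ∘ₗ antipodeInv hS)).rTensor H ∘ₗ
      (TensorProduct.assoc k H H H).symm.toLinearMap
  have h1 : ∀ x : H ⊗[k] H, TensorProduct.lift ((LinearMap.mul k (H ⊗[k] H)).flip.compl₁₂
      ((TensorProduct.mk k H H).flip 1 ∘ₗ antipodeInv hS) (Coalgebra.comul (R := k) (A := H))) x =
      t ((Coalgebra.comul (R := k) (A := H)).lTensor H x) := by
    intro x
    induction x with
    | zero => simp
    | add x y hx hy => simp only [map_add, hx, hy]
    | tmul a b =>
      simp only [TensorProduct.lift.tmul, LinearMap.compl₁₂_apply, LinearMap.flip_apply,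
        LinearMap.comp_apply, LinearMap.mul_apply', LinearMap.lTensor_tmul, TensorProduct.mk_apply]
      generalize Coalgebra.comul (R := k) b = c
      induction c with
      | zero => simp
      | add x y hx hy => simp only [add_mul, TensorProduct.tmul_add, map_add, hx, hy]
      | tmul c e => simp [t]
  rw [h1, ← Coalgebra.coassoc_apply]
  have h2 : ∀ x : H ⊗[k] H, t (TensorProduct.assoc k H H H
      ((Coalgebra.comul (R := k) (A := H)).rTensor H x)) =
      ((Algebra.linearMap k H) ∘ₗ (Coalgebra.counit (R := k) (A := H))).rTensor H x := by
    intro x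
    induction x with
    | zero => simp
    | add x y hx hy => simp only [map_add, hx, hy]
    | tmul a b => simp [t, mul_antipodeInv_comul]
  rw [h2, LinearMap.rTensor_comp, LinearMap.comp_apply, Coalgebra.rTensor_counit_comul]
  simp

/-- `Δ(S⁻¹(h₂)) (1 ⊗ h₁) = S⁻¹(h) ⊗ 1`. -/
theorem comul_antipodeInv_mul (h : H) :
    TensorProduct.lift ((LinearMap.mul k (H ⊗[k] H)).flip.compl₁₂
      (TensorProduct.mk k H H 1) ((Coalgebra.comul (R := k) (A := H)) ∘ₗ antipodeInv hS))
      (Coalgebra.comul (R := k) h) = antipodeInv hS h ⊗ₜ 1 := by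
  let t : H ⊗[k] (H ⊗[k] H) →ₗ[k] H ⊗[k] H :=
    TensorProduct.lift ((LinearMap.mul k (H ⊗[k] H)).flip.compl₁₂
      ((TensorProduct.mk k H H).flip 1 ∘ₗ antipodeInv hS)
      ((Coalgebra.comul (R := k) (A := H)) ∘ₗ
        TensorProduct.lift ((LinearMap.mul k H).flip.compl₂ (antipodeInv hS))))
  have h1 : ∀ x : H ⊗[k] H, TensorProduct.lift ((LinearMap.mul k (H ⊗[k] H)).flip.compl₁₂
      (TensorProduct.mk k H H 1) ((Coalgebra.comul (R := k) (A := H)) ∘ₗ antipodeInv hS)) x =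
      t (TensorProduct.assoc k H H H ((Coalgebra.comul (R := k) (A := H)).rTensor H x)) := by
    intro x
    induction x with
    | zero => simp
    | add x y hx hy => simp only [map_add, hx, hy]
    | tmul a b =>
      simp only [TensorProduct.lift.tmul, LinearMap.compl₁₂_apply, LinearMap.flip_apply,
        LinearMap.comp_apply, LinearMap.mul_apply', LinearMap.rTensor_tmul, TensorProduct.mk_apply]
      conv_lhs => rw [← comul_mul_antipodeInv hS a]
      generalize Coalgebra.comul (R := k) a = c
      induction c with
      | zero => simp
      | add x y hx hy => simp only [mul_add, TensorProduct.add_tmul, map_add, hx, hy]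
      | tmul c e => simp [t, mul_assoc]
  rw [h1, Coalgebra.coassoc_apply]
  have h2 : ∀ x : H ⊗[k] H, t ((Coalgebra.comul (R := k) (A := H)).lTensor H x) =
      (TensorProduct.mk k H H).flip 1 (antipodeInv hS (TensorProduct.rid k H
        ((Coalgebra.counit (R := k) (A := H)).lTensor H x))) := by
    intro x
    induction x with
    | zero => simp
    | add x y hx hy => simp only [map_add, hx, hy]
    | tmul a b =>
      simp [t, antipodeInv_mul_comul, Algebra.algebraMap_eq_smul_one, TensorProduct.smul_tmul']
  rw [h2, Coalgebra.lTensor_counit_comul]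
  simp

end Antipode

/-! ### Differential calculi and the coaction on forms -/

namespace DiffCalc

variable {k A Ω H Ξ : Type u} [Field k] [Ring A] [Algebra k A] [Ring Ω] [Algebra k Ω]
  [Ring H] [Algebra k H] [Ring Ξ] [Algebra k Ξ]

@[elab_as_elim]
theorem homogeneous_induction (C : DiffCalc k A Ω) {P : Ω → Prop} (zero : P 0)
    (homog : ∀ (n : ℕ) (ω : Ω), ω ∈ C.gr n → P ω) (add : ∀ x y, P x → P y → P (x + y))
    (ω : Ω) : P ω :=
  DirectSum.Decomposition.inductionOn C.gr zero (fun m => homog _ _ m.2) add ω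

theorem sgn_of_mem (C : DiffCalc k A Ω) {n : ℕ} {ω : Ω} (h : ω ∈ C.gr n) :
    C.sgn ω = (-1 : k) ^ n • ω := by
  simp only [sgn, LinearMap.comp_apply, LinearEquiv.coe_coe,
    DirectSum.decomposeLinearEquiv_apply]
  rw [DirectSum.decompose_of_mem _ h]
  exact (DirectSum.toModule_lof k n _).trans rfl

theorem ι_mem (C : DiffCalc k A Ω) (a : A) : C.ι a ∈ C.gr 0 := by
  rw [C.gr_eq_span]
  exact Submodule.subset_span ⟨a, [], rfl, by simp⟩

@[simp] theorem sgn_ι (C : DiffCalc k A Ω) (a : A) : C.sgn (C.ι a) = C.ι a := by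
  simp [C.sgn_of_mem (C.ι_mem a)]

theorem sgn_mul (C : DiffCalc k A Ω) (x y : Ω) : C.sgn (x * y) = C.sgn x * C.sgn y := by
  induction x using C.homogeneous_induction with
  | zero => simp
  | add x x' hx hx' => simp only [add_mul, map_add, hx, hx']
  | homog m x hx =>
    induction y using C.homogeneous_induction with
    | zero => simp
    | add x x' hx hx' => simp only [mul_add, map_add, hx, hx']
    | homog n y hy =>
      rw [C.sgn_of_mem hx, C.sgn_of_mem hy, C.sgn_of_mem (SetLike.mul_mem_graded hx hy),
        smul_mul_smul_comm, pow_add]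

@[simp] theorem sgn_sgn (C : DiffCalc k A Ω) (x : Ω) : C.sgn (C.sgn x) = x := by
  induction x using C.homogeneous_induction with
  | zero => simp
  | add x x' hx hx' => simp only [map_add, hx, hx']
  | homog m x hx =>
    rw [C.sgn_of_mem hx, map_smul, C.sgn_of_mem hx, smul_smul, ← pow_add, Even.neg_one_pow ⟨m, rfl⟩,
      one_smul]

theorem sgn_d (C : DiffCalc k A Ω) (x : Ω) : C.sgn (C.d x) = -C.d (C.sgn x) := by
  induction x using C.homogeneous_induction with
  | zero => simp
  | add x x' hx hx' => simp only [map_add, hx, hx', neg_add]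
  | homog m x hx =>
    rw [C.sgn_of_mem hx, map_smul, C.sgn_of_mem (C.d_mem hx), pow_succ]
    simp

theorem d_mul (C : DiffCalc k A Ω) (x y : Ω) :
    C.d (x * y) = C.d x * y + C.sgn x * C.d y := by
  induction x using C.homogeneous_induction with
  | zero => simp
  | add x x' hx hx' => simp only [add_mul, map_add, hx, hx']; abel
  | homog m x hx => rw [C.leibniz hx, C.sgn_of_mem hx, smul_mul_assoc]

@[simp] theorem d_one (C : DiffCalc k A Ω) : C.d 1 = 0 := by
  have h := C.d_mul 1 1
  have h1 : C.sgn 1 = 1 := by simpa using C.sgn_ι 1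
  simpa [h1] using h

/-- The product of the graded tensor product agrees with the ungraded product as soon as the
first factor has degree zero. -/
theorem of_map_ι_mul_of (C : DiffCalc k A Ω) (D : DiffCalc k H Ξ) (t : A ⊗[k] H) (y : Ω ⊗[k] Ξ) :
    GradedTensorProduct.of k C.gr D.gr (Algebra.TensorProduct.map C.ι D.ι t) *
      GradedTensorProduct.of k C.gr D.gr y =
    GradedTensorProduct.of k C.gr D.gr (Algebra.TensorProduct.map C.ι D.ι t * y) := by
  induction t with
  | zero => simp
  | add x x' hx hx' => simp only [add_mul, map_add, hx, hx']
  | tmul a h =>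
    induction y with
    | zero => simp
    | add x x' hx hx' => simp only [mul_add, map_add, hx, hx']
    | tmul ω ξ =>
      induction ω using C.homogeneous_induction with
      | zero => simp
      | add x x' hx hx' => simp only [TensorProduct.add_tmul, mul_add, map_add, hx, hx']
      | homog n ω hω =>
        rw [Algebra.TensorProduct.map_tmul, Algebra.TensorProduct.tmul_mul_tmul]
        exact (GradedTensorProduct.tmul_zero_coe_mul_coe_tmul C.gr D.gr (C.ι a)
          ⟨D.ι h, D.ι_mem h⟩ ⟨ω, hω⟩ ξ)

/-- The product of the graded tensor product agrees with the ungraded product as soon as the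
second factor has degree zero. -/
theorem of_mul_of_map_ι (C : DiffCalc k A Ω) (D : DiffCalc k H Ξ) (t : A ⊗[k] H) (y : Ω ⊗[k] Ξ) :
    GradedTensorProduct.of k C.gr D.gr y *
      GradedTensorProduct.of k C.gr D.gr (Algebra.TensorProduct.map C.ι D.ι t) =
    GradedTensorProduct.of k C.gr D.gr (y * Algebra.TensorProduct.map C.ι D.ι t) := by
  induction t with
  | zero => simp
  | add x x' hx hx' => simp only [mul_add, map_add, hx, hx']
  | tmul a h =>
    induction y with
    | zero => simp
    | add x x' hx hx' => simp only [add_mul, map_add, hx, hx']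
    | tmul ω ξ =>
      induction ξ using D.homogeneous_induction with
      | zero => simp
      | add x x' hx hx' => simp only [TensorProduct.tmul_add, add_mul, map_add, hx, hx']
      | homog n ξ hξ =>
        rw [Algebra.TensorProduct.map_tmul, Algebra.TensorProduct.tmul_mul_tmul]
        exact (GradedTensorProduct.tmul_coe_mul_zero_coe_tmul C.gr D.gr ω
          ⟨ξ, hξ⟩ ⟨C.ι a, C.ι_mem a⟩ (D.ι h))

end DiffCalc

namespace ComodAlg.Completeness

variable {k H A Ω Ξ : Type u} [Field k] [Ring H] [HopfAlgebra k H] [Ring A]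
  [Algebra k A] [Ring Ω] [Algebra k Ω] [Ring Ξ] [Algebra k Ξ]
  {ρ : ComodAlg k H A} {C : DiffCalc k A Ω} {D : DiffCalc k H Ξ}

/-- The coaction on forms with values in the ungraded tensor product `Ω(A) ⊗ Ω(H)`. Most products
which matter have a factor of degree zero, for which the Koszul sign is trivial
(`DiffCalc.of_map_ι_mul_of`, `DiffCalc.of_mul_of_map_ι`). -/
def coactLin (Δ : ρ.Completeness C D) : Ω →ₗ[k] Ω ⊗[k] Ξ :=
  (GradedTensorProduct.of k C.gr D.gr).symm.toLinearMap ∘ₗ Δ.coact.toLinearMap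

theorem of_coactLin (Δ : ρ.Completeness C D) (ω : Ω) :
    GradedTensorProduct.of k C.gr D.gr (Δ.coactLin ω) = Δ.coact ω := rfl

theorem coactLin_eq_iff (Δ : ρ.Completeness C D) (ω : Ω) (x : Ω ⊗[k] Ξ) :
    Δ.coactLin ω = x ↔ Δ.coact ω = GradedTensorProduct.of k C.gr D.gr x := Iff.rfl

theorem coactLin_ι (Δ : ρ.Completeness C D) (a : A) :
    Δ.coactLin (C.ι a) = Algebra.TensorProduct.map C.ι D.ι (ρ.coact a) :=
  (Δ.coactLin_eq_iff _ _).2 (Δ.coact_ι a)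

theorem coactLin_ι_mul (Δ : ρ.Completeness C D) (a : A) (ω : Ω) :
    Δ.coactLin (C.ι a * ω) =
      Algebra.TensorProduct.map C.ι D.ι (ρ.coact a) * Δ.coactLin ω := by
  rw [coactLin_eq_iff, map_mul, ← DiffCalc.of_map_ι_mul_of, of_coactLin, ← Δ.coactLin_ι,
    of_coactLin]

theorem coactLin_mul_ι (Δ : ρ.Completeness C D) (a : A) (ω : Ω) :
    Δ.coactLin (ω * C.ι a) =
      Δ.coactLin ω * Algebra.TensorProduct.map C.ι D.ι (ρ.coact a) := by
  rw [coactLin_eq_iff, map_mul, ← DiffCalc.of_mul_of_map_ι, of_coactLin, ← Δ.coactLin_ι,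
    of_coactLin]

theorem coactLin_d (Δ : ρ.Completeness C D) (ω : Ω) :
    Δ.coactLin (C.d ω) =
      TensorProduct.map C.d LinearMap.id (Δ.coactLin ω) +
        TensorProduct.map C.sgn D.d (Δ.coactLin ω) := by
  rw [coactLin_eq_iff, Δ.coact_d]
  rfl

theorem coactLin_sgn (Δ : ρ.Completeness C D) (ω : Ω) :
    Δ.coactLin (C.sgn ω) = TensorProduct.map C.sgn D.sgn (Δ.coactLin ω) := by
  induction ω using C.homogeneous_induction with
  | zero => simp
  | add x x' hx hx' => simp only [map_add, hx, hx']
  | homog n ω hω =>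
    rw [C.sgn_of_mem hω, map_smul]
    have key : ∀ x ∈ C.tensorGr D n, (-1 : k) ^ n • (GradedTensorProduct.of k C.gr D.gr).symm x =
        TensorProduct.map C.sgn D.sgn ((GradedTensorProduct.of k C.gr D.gr).symm x) := by
      intro x hx
      induction hx using Submodule.span_induction with
      | mem x h =>
        obtain ⟨r, s, ω, η, rfl, hω, hη, rfl⟩ := h
        rw [GradedTensorProduct.of_symm_of, TensorProduct.map_tmul, C.sgn_of_mem hω,
          D.sgn_of_mem hη, TensorProduct.smul_tmul_smul, pow_add]
      | zero => simp
      | add x y _ _ hx hy => simp only [map_add, smul_add, hx, hy]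
      | smul r x _ hx => rw [map_smul, map_smul, smul_comm, hx]
    exact key _ (Δ.coact_mem hω)

theorem mem_base_iff (Δ : ρ.Completeness C D) (β : Ω) :
    β ∈ Δ.base ↔ Δ.coactLin β = β ⊗ₜ 1 := Iff.rfl

theorem sgn_mem_base (Δ : ρ.Completeness C D) {β : Ω} (h : β ∈ Δ.base) : C.sgn β ∈ Δ.base := by
  rw [mem_base_iff] at h ⊢
  have h1 : D.sgn 1 = 1 := by simpa using D.sgn_ι 1
  rw [coactLin_sgn, h, TensorProduct.map_tmul, h1]

theorem d_mem_base (Δ : ρ.Completeness C D) {β : Ω} (h : β ∈ Δ.base) : C.d β ∈ Δ.base := by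
  rw [mem_base_iff] at h ⊢
  simp [coactLin_d, h]

end ComodAlg.Completeness

/-! ### Balanced tensor products -/

section Balanced

variable {k R : Type u} [Field k] [Ring R] [Algebra k R] (S : Subalgebra k R)
  {M N : Type u} [AddCommGroup M] [Module k M] [AddCommGroup N] [Module k N]

@[elab_as_elim]
theorem bal_induction [Module S M] {P : BalTensor S M → Prop} (zero : P 0)
    (tmul : ∀ (r : R) (m : M), P (balTmul S r m)) (add : ∀ x y, P x → P y → P (x + y))
    (x : BalTensor S M) : P x := by
  obtain ⟨t, rfl⟩ := (balancedRel S M).mkQ_surjective x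
  induction t with
  | zero => simpa using zero
  | tmul r m => exact tmul r m
  | add x y hx hy => rw [map_add]; exact add _ _ hx hy

theorem balTmul_mul [Module S M] (r : R) (s : S) (m : M) :
    balTmul S (r * s) m = balTmul S r (s • m) := by
  rw [← sub_eq_zero]
  exact (Submodule.Quotient.mk_eq_zero _).2 (Submodule.subset_span ⟨r, s, m, rfl⟩)

theorem balTmul_add [Module S M] (r : R) (m m' : M) :
    balTmul S r (m + m') = balTmul S r m + balTmul S r m' := by
  rw [balTmul, TensorProduct.tmul_add, map_add]; rfl

theorem balTmul_sub [Module S M] (r : R) (m m' : M) :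
    balTmul S r (m - m') = balTmul S r m - balTmul S r m' := by
  rw [balTmul, TensorProduct.tmul_sub, map_sub]; rfl

@[simp] theorem balTmul_zero [Module S M] (r : R) : balTmul S r (0 : M) = 0 := by
  rw [balTmul, TensorProduct.tmul_zero, map_zero]

theorem balTmul_smul [Module S M] (c : k) (r : R) (m : M) :
    balTmul S r (c • m) = c • balTmul S r m := by
  rw [balTmul, TensorProduct.tmul_smul, map_smul]; rfl

theorem add_balTmul [Module S M] (r r' : R) (m : M) :
    balTmul S (r + r') m = balTmul S r m + balTmul S r' m := by
  rw [balTmul, TensorProduct.add_tmul, map_add]; rfl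

theorem smul_balTmul [Module S M] (c : k) (r : R) (m : M) :
    balTmul S (c • r) m = c • balTmul S r m := by
  rw [balTmul, ← TensorProduct.smul_tmul', map_smul]; rfl

/-- The left multiplication of `R` on `R ⊗_S M`. -/
def balLeft (M : Type u) [AddCommGroup M] [Module k M] [Module S M] :
    R →ₗ[k] BalTensor S M →ₗ[k] BalTensor S M where
  toFun r := (balancedRel S M).liftQ (toBal S M ∘ₗ (LinearMap.mulLeft k r).rTensor M)
    (balancedRel_le_ker _ fun r' s m => by
      simpa [mul_assoc, balTmul] using balTmul_mul S (r * r') s m)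
  map_add' r r' := by
    ext x
    simp [add_mul, TensorProduct.add_tmul]
  map_smul' c r := by
    ext x y
    simp only [smul_mul_assoc, LinearMap.mulLeft_apply, LinearMap.rTensor_tmul,
      LinearMap.comp_apply,
      TensorProduct.AlgebraTensorModule.curry_apply, LinearMap.restrictScalars_self,
      TensorProduct.curry_apply, Submodule.liftQ_mkQ, LinearMap.smul_apply, RingHom.id_apply,
      Submodule.mkQ_apply, Submodule.liftQ_apply, ← TensorProduct.smul_tmul',
      Submodule.Quotient.mk_smul]

@[simp] theorem balLeft_balTmul [Module S M] (r r' : R) (m : M) :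
    balLeft S M r (balTmul S r' m) = balTmul S (r * r') m := rfl

theorem balLeft_mul [Module S M] (r r' : R) (x : BalTensor S M) :
    balLeft S M (r * r') x = balLeft S M r (balLeft S M r' x) := by
  induction x using bal_induction with
  | zero => simp
  | add x y hx hy => simp only [map_add, hx, hy]
  | tmul x y => simp [mul_assoc]

@[simp] theorem balLeft_one [Module S M] (x : BalTensor S M) : balLeft S M 1 x = x := by
  induction x using bal_induction with
  | zero => simp
  | add x y hx hy => simp only [map_add, hx, hy]
  | tmul x y => simp

/-- The right multiplication of `R` on `R ⊗_S R`. -/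
def balRight : R →ₗ[k] BalTensor S R →ₗ[k] BalTensor S R where
  toFun r := (balancedRel S R).liftQ (toBal S R ∘ₗ (LinearMap.mulRight k r).lTensor R)
    (balancedRel_le_ker _ fun r' s m => by
      simpa [Subalgebra.smul_def, mul_assoc, balTmul] using balTmul_mul S r' s (m * r))
  map_add' r r' := by
    ext x y
    exact (congrArg (balTmul S x) (mul_add y r r')).trans (balTmul_add S x _ _)
  map_smul' c r := by
    ext x y
    exact (congrArg (balTmul S x) (mul_smul_comm c y r)).trans (balTmul_smul S c x _)

@[simp] theorem balRight_balTmul (r x y : R) :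
    balRight S r (balTmul S x y) = balTmul S x (y * r) := rfl

theorem balRight_mul (r r' : R) (z : BalTensor S R) :
    balRight S (r * r') z = balRight S r' (balRight S r z) := by
  induction z using bal_induction with
  | zero => simp
  | add x y hx hy => simp only [map_add, hx, hy]
  | tmul x y => simp [mul_assoc]

@[simp] theorem balRight_one (z : BalTensor S R) : balRight S 1 z = z := by
  induction z using bal_induction with
  | zero => simp
  | add x y hx hy => simp only [map_add, hx, hy]
  | tmul x y => simp

theorem balRight_balLeft (r r' : R) (z : BalTensor S R) :
    balRight S r' (balLeft S R r z) = balLeft S R r (balRight S r' z) := by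
  induction z using bal_induction with
  | zero => simp
  | add x y hx hy => simp only [map_add, hx, hy]
  | tmul x y => simp

/-- The two-sided multiplication `x ⊗ y ↦ (z ↦ x z y)` on `R ⊗_S R`. -/
def balSandwich : R ⊗[k] R →ₗ[k] BalTensor S R →ₗ[k] BalTensor S R :=
  TensorProduct.lift (LinearMap.mk₂ k (fun r r' => balRight S r' ∘ₗ balLeft S R r)
    (fun r r' s => by simp [LinearMap.comp_add]) (fun c r s => by simp [LinearMap.comp_smul])
    (fun r r' s => by simp [LinearMap.add_comp]) (fun c r s => by simp [LinearMap.smul_comp]))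

@[simp] theorem balSandwich_tmul (r r' : R) (z : BalTensor S R) :
    balSandwich S (r ⊗ₜ r') z = balRight S r' (balLeft S R r z) := rfl

theorem balMap_balTmul [Module S M] [IsScalarTower k S M] [Module S N] [IsScalarTower k S N]
    (f : M →ₗ[S] N) (r : R) (m : M) : balMap f (balTmul S r m) = balTmul S r (f m) := rfl

variable [Module R M] [IsScalarTower k R M]

/-- The right multiplication `(r ⊗ r') · m = r ⊗ r' m`, mapping `R ⊗_S R` and a left `R`-module `M`
to `R ⊗_S M`. -/
def balAct (M : Type u) [AddCommGroup M] [Module k M] [Module R M] [IsScalarTower k R M] :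
    BalTensor S R →ₗ[k] M →ₗ[k] BalTensor S M :=
  (balancedRel S R).liftQ
    (TensorProduct.curry (toBal S M ∘ₗ (TensorProduct.lift (leftAct k R M)).lTensor R ∘ₗ
      (TensorProduct.assoc k R R M).toLinearMap))
    (balancedRel_le_ker _ fun r s r' => by
      ext m
      simpa [leftAct, Subalgebra.smul_def, mul_smul, balTmul] using balTmul_mul S r s (r' • m))

@[simp] theorem balAct_balTmul (r r' : R) (m : M) :
    balAct S M (balTmul S r r') m = balTmul S r (r' • m) := rfl

/-- The multiplication map `R ⊗_S M → M`. -/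
def balMul (M : Type u) [AddCommGroup M] [Module k M] [Module R M] [IsScalarTower k R M] :
    BalTensor S M →ₗ[k] M :=
  (balancedRel S M).liftQ (TensorProduct.lift (leftAct k R M))
    (balancedRel_le_ker _ fun r s m => by simp [leftAct, Subalgebra.smul_def])

@[simp] theorem balMul_balTmul (r : R) (m : M) : balMul S M (balTmul S r m) = r • m := rfl

end Balanced

/-! ### The canonical map and the translation map -/

namespace ComodAlg

variable {k H A : Type u} [Field k] [Ring H] [HopfAlgebra k H] [Ring A] [Algebra k A]
  (ρ : ComodAlg k H A)

theorem coassoc_apply (a : A) :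
    ρ.coact.toLinearMap.rTensor H (ρ.coact a) =
      (TensorProduct.assoc k A H H).symm
        ((Coalgebra.comul (R := k) (A := H)).lTensor A (ρ.coact a)) := by
  rw [LinearEquiv.eq_symm_apply]
  exact LinearMap.congr_fun ρ.coassoc a

theorem counit_apply (a : A) :
    TensorProduct.rid k A ((Coalgebra.counit (R := k) (A := H)).lTensor A (ρ.coact a)) = a :=
  LinearMap.congr_fun ρ.counit a

@[simp] theorem canon_balTmul (a a' : A) :
    ρ.canon (balTmul ρ.coinv a a') = (a ⊗ₜ 1) * ρ.coact a' := rfl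

/-- `∑ (1 ⊗ S⁻¹(a₁)) Δ(a₀) = a ⊗ 1`. -/
theorem antipodeInv_mul_coact (hS : Function.Bijective (HopfAlgebra.antipode k (A := H))) (a : A) :
    TensorProduct.lift ((LinearMap.mul k (A ⊗[k] H)).flip.compl₁₂ ρ.coact.toLinearMap
      (TensorProduct.mk k A H 1 ∘ₗ antipodeInv hS)) (ρ.coact a) = a ⊗ₜ 1 := by
  let t : (A ⊗[k] H) ⊗[k] H →ₗ[k] A ⊗[k] H :=
    (TensorProduct.lift ((LinearMap.mul k H).flip.compl₂ (antipodeInv hS))).lTensor A ∘ₗ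
      (TensorProduct.assoc k A H H).toLinearMap
  have h1 : ∀ x : A ⊗[k] H, TensorProduct.lift ((LinearMap.mul k (A ⊗[k] H)).flip.compl₁₂
      ρ.coact.toLinearMap (TensorProduct.mk k A H 1 ∘ₗ antipodeInv hS)) x =
      t (ρ.coact.toLinearMap.rTensor H x) := by
    intro x
    induction x with
    | zero => simp
    | add x y hx hy => simp only [map_add, hx, hy]
    | tmul a h =>
      simp only [TensorProduct.lift.tmul, LinearMap.compl₁₂_apply, LinearMap.flip_apply,
        LinearMap.comp_apply, LinearMap.mul_apply', LinearMap.rTensor_tmul, TensorProduct.mk_apply,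
        AlgHom.toLinearMap_apply]
      generalize ρ.coact a = c
      induction c with
      | zero => simp
      | add x y hx hy => simp only [mul_add, TensorProduct.add_tmul, map_add, hx, hy]
      | tmul c e => simp [t]
  rw [h1, coassoc_apply]
  have h2 : ∀ x : A ⊗[k] H, t ((TensorProduct.assoc k A H H).symm
        ((Coalgebra.comul (R := k) (A := H)).lTensor A x)) =
      (TensorProduct.rid k A ((Coalgebra.counit (R := k) (A := H)).lTensor A x)) ⊗ₜ 1 := by
    intro x
    induction x with
    | zero => simp
    | add x y hx hy => simp only [map_add, hx, hy, TensorProduct.add_tmul]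
    | tmul a b =>
      simp [t, antipodeInv_mul_comul, Algebra.algebraMap_eq_smul_one, TensorProduct.smul_tmul']
  rw [h2, counit_apply]

variable (hρ : ρ.IsQPB)

/-- The inverse `A ⊗ H → A ⊗_B A` of the canonical map. -/
def canonInv : A ⊗[k] H →ₗ[k] BalTensor ρ.coinv A :=
  (LinearEquiv.ofBijective ρ.canon hρ.galois).symm.toLinearMap

@[simp] theorem canon_canonInv (t : A ⊗[k] H) : ρ.canon (ρ.canonInv hρ t) = t :=
  (LinearEquiv.ofBijective ρ.canon hρ.galois).apply_symm_apply t

@[simp] theorem canonInv_canon (z : BalTensor ρ.coinv A) : ρ.canonInv hρ (ρ.canon z) = z :=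
  (LinearEquiv.ofBijective ρ.canon hρ.galois).symm_apply_apply z

theorem translation_apply (h : H) : ρ.translation hρ h = ρ.canonInv hρ (1 ⊗ₜ h) := rfl

@[simp] theorem canon_translation (h : H) : ρ.canon (ρ.translation hρ h) = 1 ⊗ₜ h := by
  rw [translation_apply, canon_canonInv]

theorem canonInv_mul_coact (a a' : A) :
    ρ.canonInv hρ ((a ⊗ₜ 1) * ρ.coact a') = balTmul ρ.coinv a a' := by
  rw [← canon_balTmul, canonInv_canon]

theorem canonInv_tmul_one (a : A) : ρ.canonInv hρ (a ⊗ₜ 1) = balTmul ρ.coinv a 1 := by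
  rw [← canonInv_mul_coact, map_one, mul_one]

theorem canonInv_tmul_one_mul (a : A) (t : A ⊗[k] H) :
    ρ.canonInv hρ ((a ⊗ₜ 1) * t) = balLeft ρ.coinv A a (ρ.canonInv hρ t) := by
  obtain ⟨z, rfl⟩ := hρ.galois.2 t
  rw [canonInv_canon]
  induction z using bal_induction with
  | zero => simp
  | add x y hx hy => simp only [map_add, hx, hy, mul_add]
  | tmul x y =>
    rw [canon_balTmul, ← mul_assoc, Algebra.TensorProduct.tmul_mul_tmul, one_mul,
      canonInv_mul_coact, balLeft_balTmul]

theorem translation_one : ρ.translation hρ 1 = balTmul ρ.coinv 1 1 := by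
  rw [translation_apply, canonInv_tmul_one]

theorem canon_smul_mul (x a' a : A) : ρ.canon (balTmul ρ.coinv x (a' * a)) =
    ρ.canon (balTmul ρ.coinv x a') * ρ.coact a := by
  simp [mul_assoc]

variable {M : Type u} [AddCommGroup M] [Module k M] [Module A M] [IsScalarTower k A M]

theorem balAct_canonInv_smul (t : A ⊗[k] H) (a : A) (m : M) :
    balAct ρ.coinv M (ρ.canonInv hρ t) (a • m) =
      balAct ρ.coinv M (ρ.canonInv hρ (t * ρ.coact a)) m := by
  obtain ⟨z, rfl⟩ := hρ.galois.2 t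
  rw [canonInv_canon]
  induction z using bal_induction with
  | zero => simp
  | tmul x y => rw [← canon_smul_mul, canonInv_canon, balAct_balTmul, balAct_balTmul, mul_smul]
  | add x y hx hy => simp only [map_add, LinearMap.add_apply, hx, hy, add_mul]

theorem balMul_balAct_canonInv (t : A ⊗[k] H) (m : M) :
    balMul ρ.coinv M (balAct ρ.coinv M (ρ.canonInv hρ t) m) =
      (TensorProduct.rid k A ((Coalgebra.counit (R := k) (A := H)).lTensor A t)) • m := by
  obtain ⟨z, rfl⟩ := hρ.galois.2 t
  rw [canonInv_canon]
  induction z using bal_induction with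
  | zero => simp
  | add x y hx hy => simp only [map_add, LinearMap.add_apply, hx, hy, add_smul]
  | tmul x y =>
    have : ∀ c : A ⊗[k] H, TensorProduct.rid k A ((Coalgebra.counit (R := k) (A := H)).lTensor A
        ((x ⊗ₜ 1) * c)) =
        x * TensorProduct.rid k A ((Coalgebra.counit (R := k) (A := H)).lTensor A c) := by
      intro c
      induction c with
      | zero => simp
      | add x y hx hy => simp only [mul_add, map_add, hx, hy]
      | tmul c e => simp
    rw [canon_balTmul, this, counit_apply, balAct_balTmul, balMul_balTmul, mul_smul]

/-- `∑ τ(S⁻¹(a₁)) a₀ m = a ⊗ m`. -/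
theorem balAct_translation_antipodeInv
    (hS : Function.Bijective (HopfAlgebra.antipode k (A := H))) (a : A) (m : M) :
    TensorProduct.lift ((balAct ρ.coinv M).flip.compl₁₂ ((leftAct k A M).flip m)
      (ρ.translation hρ ∘ₗ antipodeInv hS)) (ρ.coact a) = balTmul ρ.coinv a m := by
  have h1 : ∀ x : A ⊗[k] H, TensorProduct.lift ((balAct ρ.coinv M).flip.compl₁₂
      ((leftAct k A M).flip m) (ρ.translation hρ ∘ₗ antipodeInv hS)) x =
      balAct ρ.coinv M (ρ.canonInv hρ (TensorProduct.lift ((LinearMap.mul k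
        (A ⊗[k] H)).flip.compl₁₂ ρ.coact.toLinearMap
      (TensorProduct.mk k A H 1 ∘ₗ antipodeInv hS)) x)) m := by
    intro x
    induction x with
    | zero => simp
    | add x y hx hy => simp only [map_add, LinearMap.add_apply, hx, hy]
    | tmul a h =>
      simpa [leftAct, translation_apply] using
        ρ.balAct_canonInv_smul hρ (1 ⊗ₜ antipodeInv hS h) a m
  rw [h1, antipodeInv_mul_coact, canonInv_tmul_one, balAct_balTmul, one_smul]

/-- The coaction `x ⊗ y ↦ x ⊗ y₀ ⊗ y₁` of `H` on `A ⊗_B A`, read off from `id ⊗ Δ` on `A ⊗ H`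
through the canonical map. -/
def balCoact : BalTensor ρ.coinv A →ₗ[k] BalTensor ρ.coinv A ⊗[k] H :=
  (ρ.canonInv hρ).rTensor H ∘ₗ (TensorProduct.assoc k A H H).symm.toLinearMap ∘ₗ
    (Coalgebra.comul (R := k) (A := H)).lTensor A ∘ₗ ρ.canon

omit hρ in
theorem comul_canon_balTmul (x y : A) : (TensorProduct.assoc k A H H).symm
    ((Coalgebra.comul (R := k) (A := H)).lTensor A (ρ.canon (balTmul ρ.coinv x y))) =
    ((x ⊗ₜ 1) ⊗ₜ 1) * ρ.coact.toLinearMap.rTensor H (ρ.coact y) := by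
  rw [coassoc_apply, canon_balTmul]
  generalize ρ.coact y = c
  induction c with
  | zero => simp
  | add x y hx hy => simp only [mul_add, map_add, hx, hy]
  | tmul c e =>
    simp only [Algebra.TensorProduct.tmul_mul_tmul, one_mul, LinearMap.lTensor_tmul]
    generalize Coalgebra.comul (R := k) e = e
    induction e with
    | zero => simp
    | add x y hx hy => simp only [TensorProduct.tmul_add, mul_add, map_add, hx, hy]
    | tmul c e => simp

theorem balCoact_balTmul (x y : A) : ρ.balCoact hρ (balTmul ρ.coinv x y) =
    (toBal ρ.coinv A ∘ₗ TensorProduct.mk k A A x).rTensor H (ρ.coact y) := by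
  simp only [balCoact, LinearMap.comp_apply, LinearEquiv.coe_coe, comul_canon_balTmul]
  generalize ρ.coact y = c
  induction c with
  | zero => simp
  | add x y hx hy => simp only [mul_add, map_add, hx, hy]
  | tmul c e =>
    simp only [LinearMap.rTensor_tmul, AlgHom.toLinearMap_apply,
      Algebra.TensorProduct.tmul_mul_tmul, one_mul, canonInv_mul_coact]
    rfl

theorem balCoact_canonInv_tmul (x : A) (h : H) : ρ.balCoact hρ (ρ.canonInv hρ (x ⊗ₜ h)) =
    (ρ.canonInv hρ ∘ₗ TensorProduct.mk k A H x).rTensor H (Coalgebra.comul (R := k) h) := by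
  simp only [balCoact, LinearMap.comp_apply, LinearEquiv.coe_coe, canon_canonInv,
    LinearMap.lTensor_tmul]
  generalize Coalgebra.comul (R := k) h = c
  induction c with
  | zero => simp
  | add x y hx hy => simp only [TensorProduct.tmul_add, map_add, hx, hy]
  | tmul c e => simp

theorem balCoact_translation (h : H) : ρ.balCoact hρ (ρ.translation hρ h) =
    (ρ.translation hρ).rTensor H (Coalgebra.comul (R := k) h) :=
  ρ.balCoact_canonInv_tmul hρ 1 h

theorem balRight_canonInv (c : A) (t : A ⊗[k] H) :
    balRight ρ.coinv c (ρ.canonInv hρ t) = ρ.canonInv hρ (t * ρ.coact c) := by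
  obtain ⟨z, rfl⟩ := hρ.galois.2 t
  rw [canonInv_canon]
  induction z using bal_induction with
  | zero => simp
  | add x y hx hy => simp only [map_add, hx, hy, add_mul]
  | tmul x y => rw [← canon_smul_mul, canonInv_canon, balRight_balTmul]

end ComodAlg

namespace ComodAlg.Completeness

variable {k H A Ω Ξ : Type u} [Field k] [Ring H] [HopfAlgebra k H] [Ring A] [Algebra k A]
  [Ring Ω] [Algebra k Ω] [Ring Ξ] [Algebra k Ξ] {ρ : ComodAlg k H A} {C : DiffCalc k A Ω}
  {D : DiffCalc k H Ξ} (Δ : ρ.Completeness C D)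

@[simp] theorem incl_balTmul (a a' : A) :
    Δ.incl (balTmul ρ.coinv a a') = Δ.tmul (C.ι a) (C.ι a') := rfl

theorem incl_balLeft (a : A) (z : BalTensor ρ.coinv A) :
    Δ.incl (balLeft ρ.coinv A a z) = balLeft Δ.base Ω (C.ι a) (Δ.incl z) := by
  induction z using bal_induction with
  | zero => simp
  | add x y hx hy => simp only [map_add, hx, hy]
  | tmul x y => simp

end ComodAlg.Completeness

/-! ### Horizontal forms -/

namespace ComodAlg.Completeness

variable {k H A Γ Ω : Type u} [Field k] [Ring H] [HopfAlgebra k H] [Ring A] [Algebra k A]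
  [AddCommGroup Γ] [Module k Γ] [Module H Γ] [Module Hᵐᵒᵖ Γ] [SMulCommClass H Hᵐᵒᵖ Γ]
  [IsScalarTower k H Γ] [IsScalarTower k Hᵐᵒᵖ Γ] {F : FODC k H Γ} [Ring Ω] [Algebra k Ω]
  {ρ : ComodAlg k H A} {C : DiffCalc k A Ω} (Δ : ρ.Completeness C F.maxProlongation)

/-- The component `Ω(A) → Ω(A) ⊗ H` of the coaction on forms of degree zero in `Ω(H)`. -/
def coactZero : Ω →ₗ[k] Ω ⊗[k] H :=
  (Algebra.TensorProduct.map (AlgHom.id k Ω) (FODC.MaxProl.toAlg F)).toLinearMap ∘ₗ Δ.coactLin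

@[simp] theorem _root_.NCG.FODC.MaxProl.toAlg_ofAlg (F : FODC k H Γ) (h : H) :
    FODC.MaxProl.toAlg F (FODC.MaxProl.ofAlg F h) = h := by
  simp [FODC.MaxProl.toAlg]

@[simp] theorem _root_.NCG.FODC.MaxProl.toAlg_ι (F : FODC k H Γ) (h : H) :
    FODC.MaxProl.toAlg F (F.maxProlongation.ι h) = h := FODC.MaxProl.toAlg_ofAlg F h

@[simp] theorem _root_.NCG.FODC.MaxProl.toAlg_ofForm (F : FODC k H Γ) (γ : Γ) :
    FODC.MaxProl.toAlg F (FODC.MaxProl.ofForm F γ) = 0 := by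
  simp [FODC.MaxProl.toAlg]

theorem _root_.NCG.FODC.maxProlongation_d_ι (F : FODC k H Γ) (h : H) :
    F.maxProlongation.d (F.maxProlongation.ι h) = FODC.MaxProl.ofForm F (F.d h) :=
  FODC.MaxProl.d_ofAlg F h

theorem map_toAlg_map_ι (t : A ⊗[k] H) :
    Algebra.TensorProduct.map (AlgHom.id k Ω) (FODC.MaxProl.toAlg F)
      (Algebra.TensorProduct.map C.ι F.maxProlongation.ι t) =
    Algebra.TensorProduct.map C.ι (AlgHom.id k H) t := by
  induction t with
  | zero => simp
  | add x y hx hy => simp only [map_add, hx, hy]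
  | tmul a h => simp

theorem coactZero_ι_mul (a : A) (ω : Ω) : Δ.coactZero (C.ι a * ω) =
    Algebra.TensorProduct.map C.ι (AlgHom.id k H) (ρ.coact a) * Δ.coactZero ω := by
  simp only [coactZero, LinearMap.comp_apply, coactLin_ι_mul, AlgHom.toLinearMap_apply,
    map_mul, map_toAlg_map_ι]

theorem coactZero_mul_ι (a : A) (ω : Ω) : Δ.coactZero (ω * C.ι a) =
    Δ.coactZero ω * Algebra.TensorProduct.map C.ι (AlgHom.id k H) (ρ.coact a) := by
  simp only [coactZero, LinearMap.comp_apply, coactLin_mul_ι, AlgHom.toLinearMap_apply,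
    map_mul, map_toAlg_map_ι]

theorem coactZero_base {β : Ω} (h : β ∈ Δ.base) : Δ.coactZero β = β ⊗ₜ 1 := by
  rw [mem_base_iff] at h
  simp [coactZero, h]

theorem coactLin_dι (a : A) : Δ.coactLin (C.d (C.ι a)) =
    TensorProduct.map (C.d ∘ₗ C.ι.toLinearMap) F.maxProlongation.ι.toLinearMap (ρ.coact a) +
    TensorProduct.map C.ι.toLinearMap (FODC.MaxProl.ofForm F ∘ₗ F.d) (ρ.coact a) := by
  rw [coactLin_d, coactLin_ι]
  generalize ρ.coact a = c
  induction c with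
  | zero => simp
  | add x y hx hy =>
    simp only [map_add] at hx hy ⊢
    rw [add_add_add_comm, hx, hy]
    abel
  | tmul a h => simp [FODC.maxProlongation_d_ι]

theorem coactZero_dι (a : A) : Δ.coactZero (C.d (C.ι a)) =
    (C.d ∘ₗ C.ι.toLinearMap).rTensor H (ρ.coact a) := by
  simp only [coactZero, LinearMap.comp_apply, coactLin_dι]
  generalize ρ.coact a = c
  induction c with
  | zero => simp
  | add x y hx hy =>
    simp only [map_add] at hx hy ⊢
    rw [add_add_add_comm, hx, hy]
  | tmul a h => simp

variable (Ω F) in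
/-- The map `ω ⊗ h ↦ ω ⊗ h₁ ⊗ h₂`, the middle factor regarded as a form on `H`. -/
def comulForm : Ω ⊗[k] H →ₐ[k] (Ω ⊗[k] F.MaxProl) ⊗[k] H :=
  (Algebra.TensorProduct.assoc k k k Ω F.MaxProl H).symm.toAlgHom.comp
    (Algebra.TensorProduct.map (AlgHom.id k Ω)
      ((Algebra.TensorProduct.map F.maxProlongation.ι (AlgHom.id k H)).comp
        (Bialgebra.comulAlgHom k H)))

theorem comulForm_tmul (ω : Ω) (h : H) : comulForm Ω F (ω ⊗ₜ h) =
    (TensorProduct.mk k Ω F.MaxProl ω ∘ₗ F.maxProlongation.ι.toLinearMap).rTensor H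
      (Coalgebra.comul (R := k) h) := by
  simp only [comulForm, AlgHom.comp_apply, Algebra.TensorProduct.map_tmul,
    Bialgebra.comulAlgHom_apply]
  generalize Coalgebra.comul (R := k) h = c
  induction c with
  | zero => simp
  | add x y hx hy => simp only [map_add, TensorProduct.tmul_add, hx, hy]
  | tmul a h => simp

theorem comulForm_tmul_one (ω : Ω) : comulForm Ω F (ω ⊗ₜ 1) = (ω ⊗ₜ 1) ⊗ₜ 1 := by
  simp [comulForm_tmul, Algebra.TensorProduct.one_def]

theorem comulForm_coact (a : A) :
    comulForm Ω F (Algebra.TensorProduct.map C.ι (AlgHom.id k H) (ρ.coact a)) =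
    Algebra.TensorProduct.map (Algebra.TensorProduct.map C.ι F.maxProlongation.ι) (AlgHom.id k H)
      (ρ.coact.toLinearMap.rTensor H (ρ.coact a)) := by
  rw [ρ.coassoc_apply]
  generalize ρ.coact a = c
  induction c with
  | zero => simp
  | add x y hx hy => simp only [map_add, hx, hy]
  | tmul a h =>
    simp only [Algebra.TensorProduct.map_tmul, comulForm_tmul, LinearMap.lTensor_tmul,
      AlgHom.id_apply]
    generalize Coalgebra.comul (R := k) h = c
    induction c with
    | zero => simp
    | add x y hx hy => simp only [map_add, TensorProduct.tmul_add, hx, hy]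
    | tmul a h => simp

theorem rTensor_coactLin_map_ι_mul (t : A ⊗[k] H) (u : Ω ⊗[k] H) :
    Δ.coactLin.rTensor H (Algebra.TensorProduct.map C.ι (AlgHom.id k H) t * u) =
    Algebra.TensorProduct.map (Algebra.TensorProduct.map C.ι F.maxProlongation.ι) (AlgHom.id k H)
      (ρ.coact.toLinearMap.rTensor H t) * Δ.coactLin.rTensor H u := by
  induction t with
  | zero => simp
  | add x y hx hy => simp only [map_add, add_mul, hx, hy]
  | tmul a h =>
    induction u with
    | zero => simp
    | add x y hx hy => simp only [map_add, mul_add, hx, hy]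
    | tmul ω g => simp [coactLin_ι_mul]

theorem rTensor_coactLin_mul_map_ι (t : A ⊗[k] H) (u : Ω ⊗[k] H) :
    Δ.coactLin.rTensor H (u * Algebra.TensorProduct.map C.ι (AlgHom.id k H) t) =
    Δ.coactLin.rTensor H u *
    Algebra.TensorProduct.map (Algebra.TensorProduct.map C.ι F.maxProlongation.ι) (AlgHom.id k H)
      (ρ.coact.toLinearMap.rTensor H t) := by
  induction t with
  | zero => simp
  | add x y hx hy => simp only [map_add, mul_add, hx, hy]
  | tmul a h =>
    induction u with
    | zero => simp
    | add x y hx hy => simp only [map_add, add_mul, hx, hy]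
    | tmul ω g => simp [coactLin_mul_ι]

theorem rTensor_coactLin_ι_mul (a : A) (u : Ω ⊗[k] H) :
    Δ.coactLin.rTensor H (Algebra.TensorProduct.map C.ι (AlgHom.id k H) (ρ.coact a) * u) =
    comulForm Ω F (Algebra.TensorProduct.map C.ι (AlgHom.id k H) (ρ.coact a)) *
      Δ.coactLin.rTensor H u := by
  rw [rTensor_coactLin_map_ι_mul, comulForm_coact]

theorem rTensor_coactLin_mul_ι (a : A) (u : Ω ⊗[k] H) :
    Δ.coactLin.rTensor H (u * Algebra.TensorProduct.map C.ι (AlgHom.id k H) (ρ.coact a)) =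
    Δ.coactLin.rTensor H u *
      comulForm Ω F (Algebra.TensorProduct.map C.ι (AlgHom.id k H) (ρ.coact a)) := by
  rw [rTensor_coactLin_mul_map_ι, comulForm_coact]

variable (k H Ω) in
/-- The map `id ⊗ ε : Ω(A) ⊗ H → Ω(A)`. -/
def counitRight : Ω ⊗[k] H →ₐ[k] Ω :=
  (Algebra.TensorProduct.rid k k Ω).toAlgHom.comp
    (Algebra.TensorProduct.map (AlgHom.id k Ω) (Bialgebra.counitAlgHom k H))

@[simp] theorem counitRight_tmul (ω : Ω) (h : H) :
    counitRight k H Ω (ω ⊗ₜ h) = Coalgebra.counit (R := k) h • ω := by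
  simp [counitRight]

theorem counitRight_coact (a : A) :
    counitRight k H Ω (Algebra.TensorProduct.map C.ι (AlgHom.id k H) (ρ.coact a)) = C.ι a := by
  conv_rhs => rw [← ρ.counit_apply a]
  generalize ρ.coact a = c
  induction c with
  | zero => simp
  | add x y hx hy => simp only [map_add, hx, hy]
  | tmul a h => simp

/-- The defect `((Δ ⊗ id)δ(v) - (id ⊗ Δ_H)δ(v), (id ⊗ ε)δ(v) - v)` for `v` to be horizontal, where
`Δ` is the coaction on forms and `δ` its component with values in `Ω(A) ⊗ H`. -/
def horDefect : Ω →ₗ[k] ((Ω ⊗[k] F.MaxProl) ⊗[k] H) × Ω :=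
  ((Δ.coactLin.rTensor H - (comulForm Ω F).toLinearMap) ∘ₗ Δ.coactZero).prod
    ((counitRight k H Ω).toLinearMap ∘ₗ Δ.coactZero - LinearMap.id)

/-- Horizontal forms, i.e. those with `Δ(v) ∈ Ω(A) ⊗ H`. The definition is arranged so that the
space of horizontal forms is an `H`-comodule without any further argument. -/
def IsHorizontal (v : Ω) : Prop := Δ.horDefect v = 0

theorem isHorizontal_iff (v : Ω) : Δ.IsHorizontal v ↔
    Δ.coactLin.rTensor H (Δ.coactZero v) = comulForm Ω F (Δ.coactZero v) ∧
      counitRight k H Ω (Δ.coactZero v) = v := by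
  simp [IsHorizontal, horDefect, Prod.ext_iff, sub_eq_zero]

theorem horDefect_ι_mul (a : A) (v : Ω) : Δ.horDefect (C.ι a * v) =
    (comulForm Ω F (Algebra.TensorProduct.map C.ι (AlgHom.id k H) (ρ.coact a)) *
      (Δ.horDefect v).1, C.ι a * (Δ.horDefect v).2) := by
  simp [horDefect, coactZero_ι_mul, rTensor_coactLin_ι_mul, mul_sub, counitRight_coact]

variable {Δ}

theorem IsHorizontal.ι_mul {v : Ω} (h : Δ.IsHorizontal v) (a : A) :
    Δ.IsHorizontal (C.ι a * v) := by
  rw [isHorizontal_iff] at h ⊢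
  rw [coactZero_ι_mul, rTensor_coactLin_ι_mul, h.1, ← map_mul, map_mul (counitRight k H Ω), h.2,
    counitRight_coact]
  exact ⟨rfl, rfl⟩

theorem IsHorizontal.mul_ι {v : Ω} (h : Δ.IsHorizontal v) (a : A) :
    Δ.IsHorizontal (v * C.ι a) := by
  rw [isHorizontal_iff] at h ⊢
  rw [coactZero_mul_ι, rTensor_coactLin_mul_ι, h.1, ← map_mul, map_mul (counitRight k H Ω), h.2,
    counitRight_coact]
  exact ⟨rfl, rfl⟩

theorem isHorizontal_of_mem_base {β : Ω} (h : β ∈ Δ.base) : Δ.IsHorizontal β := by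
  rw [isHorizontal_iff, coactZero_base Δ h, comulForm_tmul_one]
  rw [mem_base_iff] at h
  simp [h]

theorem IsHorizontal.coassoc {v : Ω} (h : Δ.IsHorizontal v) :
    Δ.coactZero.rTensor H (Δ.coactZero v) = (TensorProduct.assoc k Ω H H).symm
      ((Coalgebra.comul (R := k) (A := H)).lTensor Ω (Δ.coactZero v)) := by
  rw [isHorizontal_iff] at h
  have h1 := congrArg ((Algebra.TensorProduct.map (AlgHom.id k Ω)
    (FODC.MaxProl.toAlg F)).toLinearMap.rTensor H) h.1
  rw [← LinearMap.comp_apply, ← LinearMap.rTensor_comp] at h1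
  refine h1.trans ?_
  generalize Δ.coactZero v = c
  induction c with
  | zero => simp
  | add x y hx hy => simp only [map_add, hx, hy]
  | tmul a h =>
    simp only [comulForm_tmul, LinearMap.lTensor_tmul]
    generalize Coalgebra.comul (R := k) h = c
    induction c with
    | zero => simp
    | add x y hx hy => simp only [map_add, TensorProduct.tmul_add, hx, hy]
    | tmul a h => simp

end ComodAlg.Completeness

/-! ### Horizontal forms as a left module over the total algebra -/

namespace ComodAlg.Completeness

variable {k H A Γ Ω : Type u} [Field k] [Ring H] [HopfAlgebra k H] [Ring A] [Algebra k A]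
  [AddCommGroup Γ] [Module k Γ] [Module H Γ] [Module Hᵐᵒᵖ Γ] [SMulCommClass H Hᵐᵒᵖ Γ]
  [IsScalarTower k H Γ] [IsScalarTower k Hᵐᵒᵖ Γ] {F : FODC k H Γ} [Ring Ω] [Algebra k Ω]
  {ρ : ComodAlg k H A} {C : DiffCalc k A Ω} (Δ : ρ.Completeness C F.maxProlongation)
  (hρ : ρ.IsQPB) (hS : Function.Bijective (HopfAlgebra.antipode k (A := H)))
  [Module A Ω] [IsScalarTower k A Ω]

section
-- The left `A`-module structure of `Ω(A)` is that given by multiplication through `ι`.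
variable (hι : ∀ (a : A) (ω : Ω), a • ω = C.ι a * ω)
include hι

theorem smul_tmul_eq {Y : Type u} [Ring Y] [Algebra k Y] (a : A) (x : Ω ⊗[k] Y) :
    a • x = (C.ι a ⊗ₜ 1) * x := by
  induction x with
  | zero => simp
  | add x y hx hy => simp only [smul_add, mul_add, hx, hy]
  | tmul x y => simp [TensorProduct.smul_tmul', hι]

theorem smul_tmul_tmul_eq {Y Z : Type u} [Ring Y] [Algebra k Y] [Ring Z] [Algebra k Z] (a : A)
    (x : (Ω ⊗[k] Y) ⊗[k] Z) : a • x = ((C.ι a ⊗ₜ 1) ⊗ₜ 1) * x := by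
  induction x with
  | zero => simp
  | add x y hx hy => simp only [smul_add, mul_add, hx, hy]
  | tmul x y => simp [TensorProduct.smul_tmul', smul_tmul_eq hι]

theorem horDefect_smul (b : ρ.coinv) (v : Ω) : Δ.horDefect (b • v) = b • Δ.horDefect v := by
  rw [Subalgebra.smul_def, Subalgebra.smul_def, hι, horDefect_ι_mul, ρ.coact_coinv,
    Algebra.TensorProduct.map_tmul, map_one, comulForm_tmul_one]
  ext1
  · exact (smul_tmul_tmul_eq hι _ _).symm
  · exact (hι _ _).symm
end

/-- `horDefect` as a left `B`-linear map, whose kernel consists of the horizontal forms. -/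
def horDefectB (hι : ∀ (a : A) (ω : Ω), a • ω = C.ι a * ω) :
    Ω →ₗ[ρ.coinv] ((Ω ⊗[k] F.MaxProl) ⊗[k] H) × Ω where
  toFun := Δ.horDefect
  map_add' := map_add _
  map_smul' := Δ.horDefect_smul hι

/-- The map `ω ↦ Δ(ω) - ω ⊗ 1`, whose kernel consists of the base forms. -/
def baseDefectB (hι : ∀ (a : A) (ω : Ω), a • ω = C.ι a * ω) :
    Ω →ₗ[ρ.coinv] Ω ⊗[k] F.MaxProl where
  toFun ω := Δ.coactLin ω - ω ⊗ₜ 1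
  map_add' x y := by rw [map_add, TensorProduct.add_tmul]; abel
  map_smul' b v := by
    simp [Subalgebra.smul_def, hι, smul_tmul_eq hι, coactLin_ι_mul, ρ.coact_coinv, mul_sub]

/-- The linear map `ω ⊗ g ⊗ h ↦ τ(h S⁻¹(g)) ω`. -/
def transAux : (Ω ⊗[k] H) ⊗[k] H →ₗ[k] BalTensor ρ.coinv Ω :=
  TensorProduct.lift (balAct ρ.coinv Ω).flip ∘ₗ
    (ρ.translation hρ ∘ₗ TensorProduct.lift ((LinearMap.mul k H).flip ∘ₗ antipodeInv hS)).lTensor Ω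
      ∘ₗ (TensorProduct.assoc k Ω H H).toLinearMap

@[simp] theorem transAux_tmul (ω : Ω) (g h : H) :
    transAux hρ hS ((ω ⊗ₜ g) ⊗ₜ h) =
      balAct ρ.coinv Ω (ρ.translation hρ (h * antipodeInv hS g)) ω := by
  simp [transAux]

/-- The map `ω ⊗ h ↦ τ(h S⁻¹(ω₁)) ω₀` from `Ω(A) ⊗ H` to `A ⊗_B Ω(A)`. On horizontal forms it
inverts `a ⊗ v ↦ a v₀ ⊗ v₁`. -/
def trans : Ω ⊗[k] H →ₗ[k] BalTensor ρ.coinv Ω :=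
  transAux hρ hS ∘ₗ Δ.coactZero.rTensor H

theorem trans_tmul_one (v : Ω) : Δ.trans hρ hS (v ⊗ₜ 1) =
    TensorProduct.lift ((balAct ρ.coinv Ω).flip.compl₂ (ρ.translation hρ ∘ₗ antipodeInv hS))
      (Δ.coactZero v) := by
  simp only [trans, LinearMap.comp_apply, LinearMap.rTensor_tmul]
  generalize Δ.coactZero v = c
  induction c with
  | zero => simp
  | add x y hx hy => simp only [map_add, TensorProduct.add_tmul, hx, hy]
  | tmul a h => simp

theorem balMul_trans_tmul_one {v : Ω} (hv : Δ.IsHorizontal v) :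
    balMul ρ.coinv Ω (Δ.trans hρ hS (v ⊗ₜ 1)) = v := by
  conv_rhs => rw [← ((Δ.isHorizontal_iff v).1 hv).2]
  rw [trans_tmul_one]
  generalize Δ.coactZero v = c
  induction c with
  | zero => simp
  | add x y hx hy => simp only [map_add, hx, hy]
  | tmul a h =>
    simp [translation_apply, balMul_balAct_canonInv, counit_antipodeInv]

section
variable (hι : ∀ (a : A) (ω : Ω), a • ω = C.ι a * ω)
include hι

theorem trans_coactZero {v : Ω} (hv : Δ.IsHorizontal v) (a : A) :
    Δ.trans hρ hS ((C.ι a ⊗ₜ 1) * Δ.coactZero v) = balTmul ρ.coinv a v := by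
  let G : A ⊗[k] H →ₗ[k] (Ω ⊗[k] H) ⊗[k] H →ₗ[k] BalTensor ρ.coinv Ω :=
    LinearMap.compr₂ ((LinearMap.mul k ((Ω ⊗[k] H) ⊗[k] H)) ∘ₗ
      (TensorProduct.mk k (Ω ⊗[k] H) H).flip 1 ∘ₗ
      (Algebra.TensorProduct.map C.ι (AlgHom.id k H)).toLinearMap) (transAux hρ hS)
  have hG : ∀ t u, G t u = transAux hρ hS
      ((Algebra.TensorProduct.map C.ι (AlgHom.id k H) t ⊗ₜ 1) * u) := fun _ _ => rfl
  have h1 : ∀ x : Ω ⊗[k] H, Δ.trans hρ hS ((C.ι a ⊗ₜ 1) * x) =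
      G (ρ.coact a) (Δ.coactZero.rTensor H x) := by
    intro x
    induction x with
    | zero => simp
    | add x y hx hy => simp only [map_add, mul_add, hx, hy]
    | tmul ω h => simp [hG, trans, coactZero_ι_mul]
  have h2 : ∀ (t : A ⊗[k] H) (ω : Ω) (h : H), G t ((TensorProduct.assoc k Ω H H).symm
      (ω ⊗ₜ Coalgebra.comul (R := k) h)) = Coalgebra.counit (R := k) h •
      TensorProduct.lift ((balAct ρ.coinv Ω).flip.compl₁₂ ((leftAct k A Ω).flip ω)
      (ρ.translation hρ ∘ₗ antipodeInv hS)) t := by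
    intro t ω h
    induction t with
    | zero => simp
    | add x y hx hy => simp only [map_add, LinearMap.add_apply, hx, hy, smul_add]
    | tmul a g =>
      have h3 : ∀ c : H ⊗[k] H, G (a ⊗ₜ g) ((TensorProduct.assoc k Ω H H).symm (ω ⊗ₜ c)) =
          balAct ρ.coinv Ω (ρ.translation hρ (TensorProduct.lift
            ((LinearMap.mul k H).flip ∘ₗ antipodeInv hS) c * antipodeInv hS g)) (a • ω) := by
        intro c
        induction c with
        | zero => simp
        | add x y hx hy =>
          simp only [map_add, TensorProduct.tmul_add, hx, hy, add_mul, LinearMap.add_apply]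
        | tmul c e => simp [hG, hι, antipodeInv_mul, mul_assoc]
      rw [h3, mul_antipodeInv_comul]
      simp [leftAct, Algebra.algebraMap_eq_smul_one]
  rw [h1, hv.coassoc]
  conv_rhs => rw [← ((Δ.isHorizontal_iff v).1 hv).2]
  generalize Δ.coactZero v = c
  induction c with
  | zero => simp
  | add x y hx hy => simp only [map_add, hx, hy, balTmul_add]
  | tmul ω h =>
    rw [LinearMap.lTensor_tmul, h2, balAct_translation_antipodeInv, counitRight_tmul, balTmul_smul]

theorem balTmul_coactLin_smul (x y : A) (w : Ω) :
    balTmul ρ.coinv x (Δ.coactLin (y • w)) =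
    TensorProduct.lift ((balAct ρ.coinv (Ω ⊗[k] F.MaxProl)).compl₂
      ((LinearMap.mulRight k (Δ.coactLin w)) ∘ₗ
        TensorProduct.mk k Ω F.MaxProl 1 ∘ₗ F.maxProlongation.ι.toLinearMap))
      (ρ.balCoact hρ (balTmul ρ.coinv x y)) := by
  rw [balCoact_balTmul, hι, coactLin_ι_mul]
  generalize ρ.coact y = c
  induction c with
  | zero => simp
  | add a b ha hb => simp only [map_add, add_mul, balTmul_add, ha, hb]
  | tmul a h =>
    change _ = balAct ρ.coinv (Ω ⊗[k] F.MaxProl) (balTmul ρ.coinv x a) _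
    simp [smul_tmul_eq hι, ← mul_assoc]

theorem balMap_baseDefectB_balAct (z : BalTensor ρ.coinv A) (w : Ω) :
    balMap (Δ.baseDefectB hι) (balAct ρ.coinv Ω z w) =
    TensorProduct.lift ((balAct ρ.coinv (Ω ⊗[k] F.MaxProl)).compl₂
      ((LinearMap.mulRight k (Δ.coactLin w)) ∘ₗ
        TensorProduct.mk k Ω F.MaxProl 1 ∘ₗ F.maxProlongation.ι.toLinearMap))
      (ρ.balCoact hρ z) - balAct ρ.coinv (Ω ⊗[k] F.MaxProl) z (w ⊗ₜ 1) := by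
  induction z using bal_induction with
  | zero => simp
  | add a b ha hb => simp only [map_add, LinearMap.add_apply, ha, hb]; abel
  | tmul x y =>
    rw [balAct_balTmul, balMap_balTmul, ← balTmul_coactLin_smul Δ hρ hι, balAct_balTmul,
      ← balTmul_sub, TensorProduct.smul_tmul']
    rfl

/-- `τ(S⁻¹(v₁)) v₀` lies in `A ⊗_B Ω(B)`, for `v` horizontal. -/
theorem balMap_baseDefectB_trans {v : Ω} (hv : Δ.IsHorizontal v) :
    balMap (Δ.baseDefectB hι) (Δ.trans hρ hS (v ⊗ₜ 1)) = 0 := by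
  -- `N u (x ⊗ y) = τ(x) (1 ⊗ y) u`, so that `id ⊗ Δ` of `τ(h) w` is `N (Δ(w)) (Δ_H(h))`
  let N : Ω ⊗[k] F.MaxProl →ₗ[k] H ⊗[k] H →ₗ[k] BalTensor ρ.coinv (Ω ⊗[k] F.MaxProl) :=
    LinearMap.mk₂ k (fun u c => TensorProduct.lift ((balAct ρ.coinv (Ω ⊗[k] F.MaxProl)).compl₁₂
      (ρ.translation hρ) ((LinearMap.mulRight k u) ∘ₗ
        TensorProduct.mk k Ω F.MaxProl 1 ∘ₗ F.maxProlongation.ι.toLinearMap)) c)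
      (fun u u' c => by
        induction c with
        | zero => simp
        | add a b ha hb => simp only [map_add, ha, hb]; abel
        | tmul a b => simp [mul_add])
      (fun r u c => by
        induction c with
        | zero => simp
        | add a b ha hb => simp only [map_add, ha, hb, smul_add]
        | tmul a b => simp)
      (fun u c c' => map_add _ _ _) (fun r u c => map_smul _ _ _)
  have hN : ∀ u x y, N u (x ⊗ₜ y) = balAct ρ.coinv (Ω ⊗[k] F.MaxProl) (ρ.translation hρ x)
      ((1 ⊗ₜ F.maxProlongation.ι y) * u) := fun u x y => rfl
  -- `L` and `L'` compute the images of `τ(S⁻¹(v₁)) v₀` under `id ⊗ Δ` and `ω ↦ ω ⊗ 1`; they agree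
  -- on `v₀ ⊗ v₁ ⊗ v₂` by `Δ_H(S⁻¹(h₂)) (1 ⊗ h₁) = S⁻¹(h) ⊗ 1`
  let L : (Ω ⊗[k] F.MaxProl) ⊗[k] H →ₗ[k] BalTensor ρ.coinv (Ω ⊗[k] F.MaxProl) :=
    TensorProduct.lift (N.compl₂ (Coalgebra.comul (R := k) (A := H) ∘ₗ antipodeInv hS))
  let L' : Ω ⊗[k] H →ₗ[k] BalTensor ρ.coinv (Ω ⊗[k] F.MaxProl) :=
    TensorProduct.lift ((balAct ρ.coinv (Ω ⊗[k] F.MaxProl)).flip.compl₁₂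
      ((TensorProduct.mk k Ω F.MaxProl).flip 1) (ρ.translation hρ ∘ₗ antipodeInv hS))
  have h1 : ∀ x : Ω ⊗[k] H, balMap (Δ.baseDefectB hι) (TensorProduct.lift
      ((balAct ρ.coinv Ω).flip.compl₂ (ρ.translation hρ ∘ₗ antipodeInv hS)) x) =
      L (Δ.coactLin.rTensor H x) - L' x := by
    intro x
    induction x with
    | zero => simp
    | add a b ha hb => simp only [map_add, ha, hb]; abel
    | tmul w g =>
      simp only [TensorProduct.lift.tmul, LinearMap.compl₂_apply, LinearMap.flip_apply,
        LinearMap.comp_apply, balMap_baseDefectB_balAct Δ hρ hι, balCoact_translation,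
        LinearMap.rTensor_tmul, L, L', LinearMap.compl₁₂_apply, TensorProduct.mk_apply]
      congr 1
      generalize Coalgebra.comul (R := k) (antipodeInv hS g) = c
      induction c with
      | zero => simp
      | add a b ha hb => simp only [map_add, ha, hb]
      | tmul a b => simp [hN]
  have h2 : ∀ x : Ω ⊗[k] H, L (comulForm Ω F x) = L' x := by
    intro x
    induction x with
    | zero => simp
    | add a b ha hb => simp only [map_add, ha, hb]
    | tmul w h =>
      rw [comulForm_tmul]
      have h3 : ∀ c : H ⊗[k] H, L ((TensorProduct.mk k Ω F.MaxProl w ∘ₗ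
          F.maxProlongation.ι.toLinearMap).rTensor H c) = N (w ⊗ₜ 1)
          (TensorProduct.lift ((LinearMap.mul k (H ⊗[k] H)).flip.compl₁₂
            (TensorProduct.mk k H H 1) ((Coalgebra.comul (R := k) (A := H)) ∘ₗ antipodeInv hS))
            c) := by
        intro c
        induction c with
        | zero => simp
        | add a b ha hb => simp only [map_add, ha, hb]
        | tmul a b =>
          simp only [LinearMap.rTensor_tmul, LinearMap.comp_apply, TensorProduct.mk_apply,
            TensorProduct.lift.tmul, LinearMap.compl₁₂_apply, LinearMap.flip_apply,
            LinearMap.mul_apply', L, LinearMap.compl₂_apply]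
          generalize Coalgebra.comul (R := k) (antipodeInv hS b) = c
          induction c with
          | zero => simp
          | add a b ha hb => simp only [map_add, add_mul, ha, hb]
          | tmul a b => simp [hN]
      rw [h3, comul_antipodeInv_mul, hN]
      simp [L']
  rw [trans_tmul_one, h1, ((Δ.isHorizontal_iff v).1 hv).1, h2, sub_self]

omit hι in
theorem balMul_mem_span (N : Submodule ρ.coinv Ω) (z : BalTensor ρ.coinv N) :
    balMul ρ.coinv Ω (balMap N.subtype z) ∈
      Submodule.span k {ω : Ω | ∃ (a : A) (β : Ω), β ∈ N ∧ ω = a • β} := by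
  induction z using bal_induction with
  | zero => simp
  | add a b ha hb => simp only [map_add]; exact add_mem ha hb
  | tmul x y => exact Submodule.subset_span ⟨x, y, y.2, rfl⟩

include hρ hS in
/-- Horizontal forms are generated by base forms as a left `A`-module: `v` is the product of the two
factors of `τ(S⁻¹(v₁)) v₀ ∈ A ⊗_B Ω(A)`, and this tensor lies in `A ⊗_B Ω(B)` because `A ⊗_B -`
preserves the exact sequence defining `Ω(B)`. -/
theorem IsHorizontal.mem_span_ι_mul {v : Ω} (hv : Δ.IsHorizontal v) :
    v ∈ Submodule.span k {ω : Ω | ∃ (a : A) (β : Ω), β ∈ Δ.base ∧ ω = C.ι a * β} := by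
  have hex : Function.Exact (LinearMap.ker (Δ.baseDefectB hι)).subtype (Δ.baseDefectB hι) :=
    LinearMap.exact_subtype_ker_map _
  obtain ⟨z, hz⟩ := ((hρ.faithfullyFlat _ _ _ _ _).1 hex _).1
    (Δ.balMap_baseDefectB_trans hρ hS hι hv)
  have h := balMul_mem_span _ z
  rw [hz, balMul_trans_tmul_one Δ hρ hS hv] at h
  refine Submodule.span_mono ?_ h
  rintro _ ⟨a, β, hβ, rfl⟩
  exact ⟨a, β, (Δ.mem_base_iff β).2 (sub_eq_zero.1 hβ), hι a β⟩

end
end ComodAlg.Completeness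

/-! ### Horizontal forms as a right module over the total algebra -/

namespace ComodAlg.Completeness

variable {k H A Γ Ω : Type u} [Field k] [Ring H] [HopfAlgebra k H] [Ring A] [Algebra k A]
  [AddCommGroup Γ] [Module k Γ] [Module H Γ] [Module Hᵐᵒᵖ Γ] [SMulCommClass H Hᵐᵒᵖ Γ]
  [IsScalarTower k H Γ] [IsScalarTower k Hᵐᵒᵖ Γ] {F : FODC k H Γ} [Ring Ω] [Algebra k Ω]
  {ρ : ComodAlg k H A} {C : DiffCalc k A Ω} (Δ : ρ.Completeness C F.maxProlongation)
  (hρ : ρ.IsQPB) (hS : Function.Bijective (HopfAlgebra.antipode k (A := H)))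

/-- The map `ω ⊗ h ↦ ω τ(h)` from `Ω(A) ⊗ H` to `Ω(A) ⊗_{Ω(B)} Ω(A)`. -/
def formTrans : Ω ⊗[k] H →ₗ[k] Δ.Bal :=
  TensorProduct.lift ((balLeft Δ.base Ω).compl₂ (Δ.incl ∘ₗ ρ.translation hρ))

theorem formTrans_tmul (ω : Ω) (h : H) :
    Δ.formTrans hρ (ω ⊗ₜ h) = balLeft Δ.base Ω ω (Δ.incl (ρ.translation hρ h)) := rfl

theorem formTrans_mul_map_ι (ω : Ω) (t : A ⊗[k] H) :
    Δ.formTrans hρ ((ω ⊗ₜ 1) * Algebra.TensorProduct.map C.ι (AlgHom.id k H) t) =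
      balLeft Δ.base Ω ω (Δ.incl (ρ.canonInv hρ t)) := by
  induction t with
  | zero => simp
  | add x y hx hy => simp only [map_add, mul_add, hx, hy]
  | tmul a h =>
    have : (a ⊗ₜ h : A ⊗[k] H) = (a ⊗ₜ 1) * (1 ⊗ₜ h) := by simp
    conv_rhs => rw [this, canonInv_tmul_one_mul, incl_balLeft, ← balLeft_mul]
    simp [formTrans_tmul, translation_apply]

theorem formTrans_mul_coact (ω : Ω) (c : A) :
    Δ.formTrans hρ ((ω ⊗ₜ 1) * Algebra.TensorProduct.map C.ι (AlgHom.id k H) (ρ.coact c)) =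
      Δ.tmul ω (C.ι c) := by
  have h := ρ.canonInv_mul_coact hρ 1 c
  rw [← Algebra.TensorProduct.one_def, one_mul] at h
  rw [formTrans_mul_map_ι, h]
  simp

variable [Module A Ω] [IsScalarTower k A Ω]
  (hι : ∀ (a : A) (ω : Ω), a • ω = C.ι a * ω)

/-- The left `B`-submodule `Ω(B) A` of `Ω(A)`. -/
def baseMul (_ : ∀ (a : A) (ω : Ω), a • ω = C.ι a * ω) : Submodule ρ.coinv Ω :=
  Submodule.span ρ.coinv {ω : Ω | ∃ (β : Ω) (c : A), β ∈ Δ.base ∧ ω = β * C.ι c}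

/-- The image of `A ⊗_B Ω(B) A` in `A ⊗_B Ω(A)`. -/
def baseMulRange : Submodule k (BalTensor ρ.coinv Ω) :=
  LinearMap.range (balMap (Δ.baseMul hι).subtype)

theorem balTmul_mem_baseMulRange {v : Ω} (hv : v ∈ Δ.baseMul hι) (a : A) :
    balTmul ρ.coinv a v ∈ Δ.baseMulRange hι :=
  ⟨balTmul ρ.coinv a ⟨v, hv⟩, rfl⟩

section
include hρ hS hι

/-- The map `trans` sends `u c₀ ⊗ c₁` to the image of `A ⊗_B Ω(B) A`, for `u` horizontal: on
`u = a β` with `β` a base form its value is `a ⊗ β c`. -/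
theorem trans_mul_coact_mem {u : Ω} (hu : Δ.IsHorizontal u) (c : A) :
    Δ.trans hρ hS ((u ⊗ₜ 1) * Algebra.TensorProduct.map C.ι (AlgHom.id k H) (ρ.coact c)) ∈
      Δ.baseMulRange hι := by
  have h := IsHorizontal.mem_span_ι_mul Δ hρ hS hι hu
  clear hu
  induction h using Submodule.span_induction with
  | zero => simp
  | add x y _ _ hx hy =>
    rw [TensorProduct.add_tmul, add_mul, map_add]
    exact add_mem hx hy
  | smul r x _ hx =>
    rw [← TensorProduct.smul_tmul', smul_mul_assoc, map_smul]
    exact Submodule.smul_mem _ _ hx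
  | mem x hx =>
    obtain ⟨a, β, hβ, rfl⟩ := hx
    have h1 : (((C.ι a * β) ⊗ₜ 1 : Ω ⊗[k] H) *
        Algebra.TensorProduct.map C.ι (AlgHom.id k H) (ρ.coact c)) =
        (C.ι a ⊗ₜ 1) * Δ.coactZero (β * C.ι c) := by
      rw [coactZero_mul_ι, coactZero_base Δ hβ, ← mul_assoc, Algebra.TensorProduct.tmul_mul_tmul,
        one_mul]
    rw [h1, trans_coactZero Δ hρ hS hι ((isHorizontal_of_mem_base hβ).mul_ι c)]
    exact Δ.balTmul_mem_baseMulRange hι (Submodule.subset_span ⟨β, c, hβ, rfl⟩) a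

/-- The membership `trans_mul_coact_mem` extends to all `w ⊗ h`, since `1 ⊗ h` is a sum of
elements `(x ⊗ 1) Δ(y)` by the Galois condition. -/
theorem trans_tmul_mem {w : Ω} (hw : Δ.IsHorizontal w) (h : H) :
    Δ.trans hρ hS (w ⊗ₜ h) ∈ Δ.baseMulRange hι := by
  have h1 : ∀ z : BalTensor ρ.coinv A, Δ.trans hρ hS ((w ⊗ₜ 1) *
      Algebra.TensorProduct.map C.ι (AlgHom.id k H) (ρ.canon z)) ∈ Δ.baseMulRange hι := by
    intro z
    induction z using bal_induction with
    | zero => simp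
    | add x y hx hy => simp only [map_add, mul_add]; exact add_mem hx hy
    | tmul x y =>
      rw [canon_balTmul, map_mul (Algebra.TensorProduct.map _ _), ← mul_assoc,
        Algebra.TensorProduct.map_tmul, Algebra.TensorProduct.tmul_mul_tmul, map_one, one_mul]
      exact Δ.trans_mul_coact_mem hρ hS hι (hw.mul_ι x) y
  simpa using h1 (ρ.translation hρ h)

/-- The image of `A ⊗_B Ω(B) A` in `A ⊗_B Ω(A)` contains all `a ⊗ v` with `v` horizontal, because
`a ⊗ a' β` is the image of `a a'₀ β ⊗ a'₁` under `trans`, where `a a'₀ β` is horizontal. -/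
theorem balTmul_horizontal_mem {v : Ω} (hv : Δ.IsHorizontal v) (a : A) :
    balTmul ρ.coinv a v ∈ Δ.baseMulRange hι := by
  have h := IsHorizontal.mem_span_ι_mul Δ hρ hS hι hv
  clear hv
  induction h using Submodule.span_induction with
  | zero => simp
  | add x y _ _ hx hy => rw [balTmul_add]; exact add_mem hx hy
  | smul r x _ hx => rw [balTmul_smul]; exact Submodule.smul_mem _ _ hx
  | mem x hx =>
    obtain ⟨a', β, hβ, rfl⟩ := hx
    rw [← trans_coactZero Δ hρ hS hι ((isHorizontal_of_mem_base hβ).ι_mul a'), coactZero_ι_mul,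
      coactZero_base Δ hβ]
    generalize ρ.coact a' = c
    induction c with
    | zero => simp
    | add x y hx hy => simp only [map_add, add_mul, mul_add]; exact add_mem hx hy
    | tmul c g =>
      simp only [Algebra.TensorProduct.map_tmul, Algebra.TensorProduct.tmul_mul_tmul, one_mul,
        mul_one]
      exact Δ.trans_tmul_mem hρ hS hι (((isHorizontal_of_mem_base hβ).ι_mul c).ι_mul a) _

/-- Horizontal forms are generated by base forms as a right `A`-module: after applying
`A ⊗_B -`, this is the surjectivity established in `balTmul_horizontal_mem`, and faithful flatness
allows to descend. -/
theorem IsHorizontal.mem_span_mul_ι {v : Ω} (hv : Δ.IsHorizontal v) :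
    v ∈ Submodule.span k {ω : Ω | ∃ (β : Ω) (c : A), β ∈ Δ.base ∧ ω = β * C.ι c} := by
  have hle : ∀ ω ∈ Δ.baseMul hι, Δ.horDefectB hι ω = 0 := by
    intro ω hω
    induction hω using Submodule.span_induction with
    | zero => simp
    | add x y _ _ hx hy => rw [map_add, hx, hy, add_zero]
    | smul r x _ hx => rw [map_smul, hx, smul_zero]
    | mem x hx =>
      obtain ⟨β, c, hβ, rfl⟩ := hx
      exact (isHorizontal_of_mem_base hβ).mul_ι c
  have hex : Function.Exact (LinearMap.ker (Δ.horDefectB hι)).subtype (Δ.horDefectB hι) :=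
    LinearMap.exact_subtype_ker_map _
  have hex' : Function.Exact (Δ.baseMul hι).subtype (Δ.horDefectB hι) := by
    rw [hρ.faithfullyFlat]
    intro x
    rw [(hρ.faithfullyFlat _ _ _ _ _).1 hex x]
    constructor
    · rintro ⟨z, rfl⟩
      change _ ∈ Δ.baseMulRange hι
      induction z using bal_induction with
      | zero => simp
      | add x y hx hy => rw [map_add]; exact add_mem hx hy
      | tmul a w => exact Δ.balTmul_horizontal_mem hρ hS hι w.2 a
    · rintro ⟨z, rfl⟩
      refine ⟨balMap (Submodule.inclusion (p := Δ.baseMul hι)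
        (p' := LinearMap.ker (Δ.horDefectB hι)) hle) z, ?_⟩
      induction z using bal_induction with
      | zero => simp
      | add x y hx hy => rw [map_add, map_add, hx, hy, map_add]
      | tmul a w => rfl
  obtain ⟨⟨w, hw⟩, rfl⟩ := (hex' v).1 hv
  clear hv
  change w ∈ _
  induction hw using Submodule.span_induction with
  | zero => simp
  | add x y _ _ hx hy => exact add_mem hx hy
  | mem x hx => exact Submodule.subset_span hx
  | smul b x _ hx =>
    rw [Subalgebra.smul_def, hι]
    rename_i hx'
    clear hx'
    -- `b (β c) = (b β) c` with `b β` again a base form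
    induction hx using Submodule.span_induction with
    | zero => simp
    | add x y _ _ hx hy => rw [mul_add]; exact add_mem hx hy
    | smul r x _ hx => rw [mul_smul_comm]; exact Submodule.smul_mem _ _ hx
    | mem x hx =>
      obtain ⟨β, c, hβ, rfl⟩ := hx
      exact Submodule.subset_span
        ⟨C.ι b * β, c, mul_mem (Δ.ι_mem_base b) hβ, (mul_assoc _ _ _).symm⟩

end

include hS hι in
/-- In `Ω(A) ⊗_{Ω(B)} Ω(A)`, the element `x ⊗ v` with `v` horizontal is determined by its image
`x v₀ ⊗ v₁` under the canonical map. -/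
theorem tmul_horizontal (x : Ω) {v : Ω} (hv : Δ.IsHorizontal v) :
    Δ.tmul x v = Δ.formTrans hρ ((x ⊗ₜ 1) * Δ.coactZero v) := by
  have h := IsHorizontal.mem_span_mul_ι Δ hρ hS hι hv
  clear hv
  induction h using Submodule.span_induction with
  | zero => simp [tmul]
  | add y z _ _ hy hz => rw [tmul, balTmul_add, map_add, mul_add, map_add, ← hy, ← hz]
  | smul r y _ hy => rw [tmul, balTmul_smul, map_smul, mul_smul_comm, map_smul, ← hy]
  | mem y hy =>
    obtain ⟨β, c, hβ, rfl⟩ := hy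
    rw [coactZero_mul_ι, coactZero_base Δ hβ, ← mul_assoc, Algebra.TensorProduct.tmul_mul_tmul,
      one_mul, formTrans_mul_coact]
    exact (balTmul_mul Δ.base x ⟨β, hβ⟩ (C.ι c)).symm

end ComodAlg.Completeness

/-! ### The translation map: centrality and the relations on one-forms -/

namespace ComodAlg.Completeness

variable {k H A Γ Ω : Type u} [Field k] [Ring H] [HopfAlgebra k H] [Ring A] [Algebra k A]
  [AddCommGroup Γ] [Module k Γ] [Module H Γ] [Module Hᵐᵒᵖ Γ] [SMulCommClass H Hᵐᵒᵖ Γ]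
  [IsScalarTower k H Γ] [IsScalarTower k Hᵐᵒᵖ Γ] {F : FODC k H Γ} [Ring Ω] [Algebra k Ω]
  {ρ : ComodAlg k H A} {C : DiffCalc k A Ω} (Δ : ρ.Completeness C F.maxProlongation)
  (hρ : ρ.IsQPB) (hS : Function.Bijective (HopfAlgebra.antipode k (A := H)))
  (hF : F.Bicovariance)

/-- The map `a ⊗ γ ↦ a ⊗ γ₀ ⊗ γ₁` given by the right coaction of `H` on one-forms. -/
def rightForm (C : DiffCalc k A Ω) (hF : F.Bicovariance) :
    A ⊗[k] Γ →ₗ[k] (Ω ⊗[k] F.MaxProl) ⊗[k] H :=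
  (TensorProduct.assoc k Ω F.MaxProl H).symm.toLinearMap ∘ₗ
    TensorProduct.map C.ι.toLinearMap ((FODC.MaxProl.ofForm F).rTensor H ∘ₗ hF.right)

theorem rightForm_tmul_smul_d (a a' : A) (g h : H) :
    rightForm C hF ((a * a') ⊗ₜ (g • F.d h)) =
      comulForm Ω F (C.ι a ⊗ₜ g) * rightForm C hF (a' ⊗ₜ F.d h) := by
  simp only [rightForm, LinearMap.comp_apply, LinearEquiv.coe_coe, TensorProduct.map_tmul,
    hF.right_smul, hF.right_d, comulForm_tmul]
  generalize Coalgebra.comul (R := k) g = c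
  generalize Coalgebra.comul (R := k) h = e
  induction c with
  | zero => simp
  | add x y hx hy =>
    simp only [map_add, LinearMap.add_apply, TensorProduct.tmul_add, add_mul, hx, hy]
  | tmul c c' =>
    induction e with
    | zero => simp
    | add x y hx hy => simp only [map_add, TensorProduct.tmul_add, mul_add, hx, hy]
    | tmul e e' =>
      simp [leftAct, FODC.MaxProl.ofForm_smul]
      rfl

theorem horDefect_fst (v : Ω) : (Δ.horDefect v).1 =
    Δ.coactLin.rTensor H (Δ.coactZero v) - comulForm Ω F (Δ.coactZero v) := rfl

theorem horDefect_snd (v : Ω) : (Δ.horDefect v).2 = counitRight k H Ω (Δ.coactZero v) - v := rfl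

/-- The defect of `dy` is `y₀ ⊗ dy₁`, with the right coaction of `H` applied to the form `dy₁`. -/
theorem horDefect_dι (y : A) :
    Δ.horDefect (C.d (C.ι y)) = (rightForm C hF (F.d.lTensor A (ρ.coact y)), 0) := by
  have h1 : Δ.coactLin.rTensor H ((C.d ∘ₗ C.ι.toLinearMap).rTensor H (ρ.coact y)) =
      ((TensorProduct.map (C.d ∘ₗ C.ι.toLinearMap) F.maxProlongation.ι.toLinearMap).rTensor H +
        (TensorProduct.map C.ι.toLinearMap (FODC.MaxProl.ofForm F ∘ₗ F.d)).rTensor H)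
        (ρ.coact.toLinearMap.rTensor H (ρ.coact y)) := by
    generalize ρ.coact y = c
    induction c with
    | zero => simp
    | add x y hx hy => simp only [map_add, hx, hy]
    | tmul a h => simp [coactLin_dι, TensorProduct.add_tmul]
  have h2 : counitRight k H Ω ((C.d ∘ₗ C.ι.toLinearMap).rTensor H (ρ.coact y)) =
      C.d (C.ι y) := by
    conv_rhs => rw [← ρ.counit_apply y]
    generalize ρ.coact y = c
    induction c with
    | zero => simp
    | add x y hx hy => simp only [map_add, hx, hy]
    | tmul a h => simp
  ext1
  · rw [horDefect_fst, coactZero_dι, h1, ρ.coassoc_apply]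
    generalize ρ.coact y = c
    induction c with
    | zero => simp
    | add x y hx hy =>
      simp only [map_add] at hx hy ⊢
      rw [← hx, ← hy]
      abel
    | tmul a h =>
      simp only [LinearMap.lTensor_tmul, LinearMap.rTensor_tmul, AlgHom.toLinearMap_apply,
        comulForm_tmul, rightForm, LinearMap.comp_apply, LinearEquiv.coe_coe,
        TensorProduct.map_tmul, hF.right_d]
      generalize Coalgebra.comul (R := k) h = c
      induction c with
      | zero => simp
      | add x y hx hy =>
        simp only [map_add, TensorProduct.tmul_add] at hx hy ⊢
        rw [← hx, ← hy]
        abel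
      | tmul c e => simp
  · rw [horDefect_snd, coactZero_dι, h2, sub_self]

section
variable [Module A Ω] [IsScalarTower k A Ω] (hι : ∀ (a : A) (ω : Ω), a • ω = C.ι a * ω)

/-- The map `z ⊗ γ ↦ z · (1 ⊗ γ₀ ⊗ γ₁)`. -/
def balRightForm (C : DiffCalc k A Ω) (hF : F.Bicovariance) (ρ : ComodAlg k H A) :
    BalTensor ρ.coinv A ⊗[k] Γ →ₗ[k] BalTensor ρ.coinv (((Ω ⊗[k] F.MaxProl) ⊗[k] H) × Ω) :=
  TensorProduct.lift ((balAct ρ.coinv (((Ω ⊗[k] F.MaxProl) ⊗[k] H) × Ω)).compl₂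
    (LinearMap.inl k _ _ ∘ₗ rightForm C hF ∘ₗ TensorProduct.mk k A Γ 1))

include hι

theorem balRightForm_tmul (x y : A) (γ : Γ) :
    balRightForm C hF ρ (balTmul ρ.coinv x y ⊗ₜ γ) =
      balTmul ρ.coinv x (rightForm C hF (y ⊗ₜ γ), 0) := by
  simp only [balRightForm, TensorProduct.lift.tmul, LinearMap.compl₂_apply, balAct_balTmul,
    LinearMap.comp_apply, LinearMap.inl_apply, Prod.smul_mk, smul_zero, TensorProduct.mk_apply]
  rw [smul_tmul_tmul_eq hι]
  congr 2
  simp only [rightForm, LinearMap.comp_apply, LinearEquiv.coe_coe, TensorProduct.map_tmul]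
  generalize hF.right γ = c
  induction c with
  | zero => simp
  | add x y hx hy => simp only [map_add, TensorProduct.tmul_add, mul_add, hx, hy]
  | tmul c e => simp

theorem balMap_horDefectB_balAct (z : BalTensor ρ.coinv A) (y : A) :
    balMap (Δ.horDefectB hι) (balAct ρ.coinv Ω z (C.d (C.ι y))) =
      balRightForm C hF ρ (TensorProduct.map₂ (balRight ρ.coinv).flip
        ((leftAct k H Γ).compl₂ F.d) (ρ.balCoact hρ z) (ρ.coact y)) := by
  induction z using bal_induction with
  | zero => simp
  | add a b ha hb => simp only [map_add, LinearMap.add_apply, ha, hb]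
  | tmul x' y' =>
    have h : Δ.horDefectB hι (y' • C.d (C.ι y)) =
        LinearMap.inl k ((Ω ⊗[k] F.MaxProl) ⊗[k] H) Ω (comulForm Ω F (Algebra.TensorProduct.map C.ι
        (AlgHom.id k H) (ρ.coact y')) * rightForm C hF (F.d.lTensor A (ρ.coact y))) := by
      change Δ.horDefect (y' • C.d (C.ι y)) = _
      rw [hι, horDefect_ι_mul, horDefect_dι Δ hF, mul_zero]
      rfl
    rw [balAct_balTmul, balMap_balTmul, h, balCoact_balTmul]
    generalize ρ.coact y = e
    generalize ρ.coact y' = c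
    induction c with
    | zero => simp; exact balTmul_zero _ _
    | add a b ha hb =>
      simp only [map_add, add_mul, LinearMap.add_apply, balTmul_add, ha, hb]
    | tmul c g =>
      induction e with
      | zero => simp; exact balTmul_zero _ _
      | add a b ha hb => simp only [map_add, mul_add, balTmul_add, ha, hb]
      | tmul e h =>
        simp only [Algebra.TensorProduct.map_tmul, AlgHom.id_apply, LinearMap.lTensor_tmul,
          LinearMap.rTensor_tmul, TensorProduct.map₂_apply_tmul, TensorProduct.map_tmul,
          ← rightForm_tmul_smul_d]
        exact (balRightForm_tmul hF hι x' (c * e) (g • F.d h)).symm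

/-- The defect of `x a⁽¹⁾ ⊗ a⁽²⁾ dy` to lie in `A ⊗_B hor(A)`, in terms of the comultiplication
of `a` and the canonical image of `x ⊗ y`. -/
theorem balMap_horDefectB_canonInv (a : H) (x y : A) :
    balMap (Δ.horDefectB hι) (balAct ρ.coinv Ω (ρ.canonInv hρ (x ⊗ₜ a)) (C.d (C.ι y))) =
      balRightForm C hF ρ (TensorProduct.map₂
        (((LinearMap.mul k (A ⊗[k] H)) ∘ₗ TensorProduct.mk k A H 1).compr₂ (ρ.canonInv hρ))
        ((leftAct k H Γ).compl₂ F.d) (Coalgebra.comul (R := k) a)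
        ((TensorProduct.assoc k A H H).symm ((Coalgebra.comul (R := k) (A := H)).lTensor A
          (ρ.canon (balTmul ρ.coinv x y))))) := by
  rw [balMap_horDefectB_balAct Δ hρ hF hι, balCoact_canonInv_tmul, comul_canon_balTmul]
  congr 1
  generalize ρ.coact y = e
  generalize Coalgebra.comul (R := k) a = c
  induction c with
  | zero => simp
  | add a b ha hb => simp only [map_add, LinearMap.add_apply, ha, hb]
  | tmul c g =>
    induction e with
    | zero => simp
    | add a b ha hb => simp only [map_add, mul_add, ha, hb]
    | tmul e h =>
      simp [balRight_canonInv, ← mul_assoc]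

omit hι in
theorem map₂_comul_left (a b : H) :
    TensorProduct.map₂
        (((LinearMap.mul k (A ⊗[k] H)) ∘ₗ TensorProduct.mk k A H 1).compr₂ (ρ.canonInv hρ))
        ((leftAct k H Γ).compl₂ F.d) (Coalgebra.comul (R := k) a)
        ((TensorProduct.assoc k A H H).symm ((Coalgebra.comul (R := k) (A := H)).lTensor A
          (1 ⊗ₜ b))) = (ρ.translation hρ).rTensor Γ (hF.left (a • F.d b)) := by
  rw [hF.left_smul, hF.left_d, LinearMap.lTensor_tmul]
  generalize Coalgebra.comul (R := k) a = c
  generalize Coalgebra.comul (R := k) b = e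
  induction c with
  | zero => simp
  | add a b ha hb => simp only [map_add, LinearMap.add_apply, ha, hb]
  | tmul c g =>
    induction e with
    | zero => simp
    | add a b ha hb => simp only [map_add, TensorProduct.tmul_add, ha, hb]
    | tmul e h => simp [leftAct, translation_apply]

omit hι in
/-- The map `h ⊗ (x ⊗ y) ↦ x h⁽¹⁾ ⊗ h⁽²⁾ dy`. -/
def secondSummand (C : DiffCalc k A Ω) : H →ₗ[k] A ⊗[k] A →ₗ[k] BalTensor ρ.coinv Ω :=
  LinearMap.mk₂ k (fun a => TensorProduct.lift ((balAct ρ.coinv Ω).compl₁₂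
      (ρ.canonInv hρ ∘ₗ (TensorProduct.mk k A H).flip a) (C.d ∘ₗ C.ι.toLinearMap)))
    (fun a a' t => by
      induction t with
      | zero => simp
      | add x y hx hy =>
        simp only [map_add] at hx hy ⊢
        rw [hx, hy]
        abel
      | tmul x y => simp)
    (fun c a t => by
      induction t with
      | zero => simp
      | add x y hx hy => simp only [map_add, hx, hy, smul_add]
      | tmul x y => simp)
    (fun _ _ _ => map_add _ _ _) (fun _ _ _ => map_smul _ _ _)

omit hι in
theorem secondSummand_tmul (a : H) (x y : A) : secondSummand hρ C a (x ⊗ₜ y) =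
    balAct ρ.coinv Ω (ρ.canonInv hρ (x ⊗ₜ a)) (C.d (C.ι y)) := rfl

/-- By left covariance of the calculus, the horizontality defect of `b⁽¹⁾ a⁽¹⁾ ⊗ a⁽²⁾ d(b⁽²⁾)` is a
function of the form `a db` alone. -/
theorem balMap_horDefectB_secondSummand (a b : H) (t : A ⊗[k] A)
    (ht : toBal ρ.coinv A t = ρ.translation hρ b) :
    balMap (Δ.horDefectB hι) (secondSummand hρ C a t) =
      balRightForm C hF ρ ((ρ.translation hρ).rTensor Γ (hF.left (a • F.d b))) := by
  rw [← map₂_comul_left, ← ρ.canon_translation hρ, ← ht]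
  clear ht
  induction t with
  | zero => simp
  | add x y hx hy => simp only [map_add, hx, hy]
  | tmul x y => exact Δ.balMap_horDefectB_canonInv hρ hF hι a x y

omit hι in
/-- The map `A ⊗_B Ω(A) → Ω(A) ⊗_{Ω(B)} Ω(A)`. -/
def toBalForm (hι : ∀ (a : A) (ω : Ω), a • ω = C.ι a * ω) :
    BalTensor ρ.coinv Ω →ₗ[k] Δ.Bal :=
  (balancedRel ρ.coinv Ω).liftQ (toBal Δ.base Ω ∘ₗ C.ι.toLinearMap.rTensor Ω)
    (balancedRel_le_ker _ fun a b ω => by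
      simpa [balTmul, Subalgebra.smul_def, hι] using
        balTmul_mul Δ.base (C.ι a) ⟨C.ι b, Δ.ι_mem_base b⟩ ω)

omit hι in
/-- The map `a ⊗ ω ↦ a ω₀ ⊗ ω₁` from `A ⊗_B Ω(A)` to `Ω(A) ⊗ H`. -/
def canonForm (hι : ∀ (a : A) (ω : Ω), a • ω = C.ι a * ω) :
    BalTensor ρ.coinv Ω →ₗ[k] Ω ⊗[k] H :=
  (balancedRel ρ.coinv Ω).liftQ
    (TensorProduct.lift ((LinearMap.mul k (Ω ⊗[k] H)).compl₁₂
      ((TensorProduct.mk k Ω H).flip 1 ∘ₗ C.ι.toLinearMap) Δ.coactZero))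
    (balancedRel_le_ker _ fun a b ω => by
      simp [Subalgebra.smul_def, hι, coactZero_ι_mul, ρ.coact_coinv, ← mul_assoc])

omit [IsScalarTower k A Ω] in
theorem toBalForm_balTmul (a : A) (ω : Ω) :
    Δ.toBalForm hι (balTmul ρ.coinv a ω) = Δ.tmul (C.ι a) ω := rfl

omit [IsScalarTower k A Ω] in
theorem canonForm_balTmul (a : A) (ω : Ω) :
    Δ.canonForm hι (balTmul ρ.coinv a ω) = (C.ι a ⊗ₜ 1) * Δ.coactZero ω := rfl

theorem toBalForm_balAct (z : BalTensor ρ.coinv A) (ω : Ω) :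
    Δ.toBalForm hι (balAct ρ.coinv Ω z ω) = balRight Δ.base ω (Δ.incl z) := by
  induction z using bal_induction with
  | zero => simp
  | add x y hx hy => simp only [map_add, LinearMap.add_apply, hx, hy]
  | tmul x y => rw [balAct_balTmul, hι, toBalForm_balTmul, incl_balTmul, balRight_balTmul]

theorem canonForm_balAct (z : BalTensor ρ.coinv A) (ω : Ω) :
    Δ.canonForm hι (balAct ρ.coinv Ω z ω) =
      Algebra.TensorProduct.map C.ι (AlgHom.id k H) (ρ.canon z) * Δ.coactZero ω := by
  induction z using bal_induction with
  | zero => simp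
  | add x y hx hy => simp only [map_add, LinearMap.add_apply, add_mul, hx, hy]
  | tmul x y =>
    rw [balAct_balTmul, hι, canonForm_balTmul, coactZero_ι_mul, canon_balTmul,
      map_mul (Algebra.TensorProduct.map _ _), mul_assoc, Algebra.TensorProduct.map_tmul, map_one]

include hS

/-- On the kernel of the horizontality defect, the passage from `A ⊗_B Ω(A)` to
`Ω(A) ⊗_{Ω(B)} Ω(A)` factors through the canonical map. -/
theorem toBalForm_of_balMap_eq_zero {s : BalTensor ρ.coinv Ω}
    (hs : balMap (Δ.horDefectB hι) s = 0) :
    Δ.toBalForm hι s = Δ.formTrans hρ (Δ.canonForm hι s) := by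
  have hex : Function.Exact (LinearMap.ker (Δ.horDefectB hι)).subtype (Δ.horDefectB hι) :=
    LinearMap.exact_subtype_ker_map _
  obtain ⟨z, rfl⟩ := ((hρ.faithfullyFlat _ _ _ _ _).1 hex _).1 hs
  clear hs
  induction z using bal_induction with
  | zero => simp
  | add x y hx hy => simp only [map_add, hx, hy]
  | tmul a v =>
    rw [balMap_balTmul, toBalForm_balTmul, canonForm_balTmul]
    exact Δ.tmul_horizontal hρ hS hι _ v.2

/-- The translation map takes values in the centralizer of the base forms. -/
theorem balRight_translation {β : Ω} (hβ : β ∈ Δ.base) (h : H) :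
    balRight Δ.base β (Δ.incl (ρ.translation hρ h)) =
      balLeft Δ.base Ω β (Δ.incl (ρ.translation hρ h)) := by
  have h1 : ∀ z : BalTensor ρ.coinv A, balRight Δ.base β (Δ.incl z) =
      Δ.formTrans hρ (Algebra.TensorProduct.map C.ι (AlgHom.id k H) (ρ.canon z) * (β ⊗ₜ 1)) := by
    intro z
    induction z using bal_induction with
    | zero => simp
    | add x y hx hy => simp only [map_add, add_mul, hx, hy]
    | tmul x y =>
      rw [incl_balTmul, balRight_balTmul]
      refine (Δ.tmul_horizontal hρ hS hι (C.ι x)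
        ((isHorizontal_of_mem_base hβ).ι_mul y)).trans ?_
      rw [coactZero_ι_mul, coactZero_base Δ hβ, canon_balTmul,
        map_mul (Algebra.TensorProduct.map _ _), mul_assoc, Algebra.TensorProduct.map_tmul, map_one]
  rw [h1, canon_translation]
  simp [formTrans_tmul]

/-- If `∑ aᵢ dbᵢ = 0` in `Γ`, then
`∑ d(bᵢ⁽¹⁾) aᵢ⁽¹⁾ ⊗ aᵢ⁽²⁾ bᵢ⁽²⁾ + bᵢ⁽¹⁾ aᵢ⁽¹⁾ ⊗ aᵢ⁽²⁾ d(bᵢ⁽²⁾) = 0`. The second summands add up to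
an element of `A ⊗_B hor(A)`, which is determined by its canonical image, and this image is
cancelled by the first summands. -/
theorem lift_balSandwich_eq_zero (hF : F.Bicovariance) (σ : H →ₗ[k] A ⊗[k] A)
    (hσ : ∀ h, toBal ρ.coinv A (σ h) = ρ.translation hρ h) (t : H ⊗[k] H)
    (ht : F.toForm t = 0) :
    TensorProduct.lift ((balSandwich Δ.base).flip.compl₁₂ (Δ.incl ∘ₗ ρ.translation hρ)
      ((TensorProduct.map (C.d ∘ₗ C.ι.toLinearMap) C.ι.toLinearMap +
        TensorProduct.map C.ι.toLinearMap (C.d ∘ₗ C.ι.toLinearMap)) ∘ₗ σ)) t = 0 := by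
  let S : H ⊗[k] H →ₗ[k] BalTensor ρ.coinv Ω :=
    TensorProduct.lift ((secondSummand hρ C).compl₂ σ)
  -- the sum of the second summands lies in `A ⊗_B hor(A)`
  have hS0 : balMap (Δ.horDefectB hι) (S t) = 0 := by
    have : ∀ t, balMap (Δ.horDefectB hι) (S t) =
        balRightForm C hF ρ ((ρ.translation hρ).rTensor Γ (hF.left (F.toForm t))) := by
      intro t
      induction t with
      | zero => simp
      | add x y hx hy => simp only [map_add, hx, hy]
      | tmul a b => exact Δ.balMap_horDefectB_secondSummand hρ hF hι a b (σ b) (hσ b)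
    rw [this, ht]
    simp
  have h1 : ∀ (a : H) (t : A ⊗[k] A), balSandwich Δ.base (TensorProduct.map C.ι.toLinearMap
      (C.d ∘ₗ C.ι.toLinearMap) t) (Δ.incl (ρ.translation hρ a)) =
      Δ.toBalForm hι (secondSummand hρ C a t) := by
    intro a t
    induction t with
    | zero => simp
    | add x y hx hy => simp only [map_add, LinearMap.add_apply, hx, hy]
    | tmul x y =>
      have : (x ⊗ₜ a : A ⊗[k] H) = (x ⊗ₜ 1) * (1 ⊗ₜ a) := by simp
      rw [secondSummand_tmul, toBalForm_balAct, this, canonInv_tmul_one_mul, incl_balLeft]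
      rfl
  -- Leibniz rule: the first summand and the canonical image of the second one add up to the
  -- differential of the `A`-component of `x Δ(y)`, for `t = x ⊗ y`
  have h2 : ∀ (a : H) (t : A ⊗[k] A), balSandwich Δ.base (TensorProduct.map
      (C.d ∘ₗ C.ι.toLinearMap) C.ι.toLinearMap t) (Δ.incl (ρ.translation hρ a)) +
      Δ.formTrans hρ (Δ.canonForm hι (secondSummand hρ C a t)) =
      Δ.formTrans hρ ((1 ⊗ₜ a) * (C.d ∘ₗ C.ι.toLinearMap).rTensor H
        (ρ.canon (toBal ρ.coinv A t))) := by
    intro a t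
    induction t with
    | zero => simp
    | add x y hx hy =>
      simp only [map_add, LinearMap.add_apply, mul_add] at hx hy ⊢
      rw [← hx, ← hy]
      abel
    | tmul x y =>
      have h3 : ∀ (ω : Ω) (z : BalTensor ρ.coinv A), balRight Δ.base (C.ι y)
          (balLeft Δ.base Ω ω (Δ.incl z)) = Δ.formTrans hρ ((ω ⊗ₜ 1) *
            Algebra.TensorProduct.map C.ι (AlgHom.id k H) (ρ.canon z * ρ.coact y)) := by
        intro ω z
        rw [formTrans_mul_map_ι, ← balRight_canonInv, canonInv_canon, balRight_balLeft]
        congr 1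
        induction z using bal_induction with
        | zero => simp
        | add x y hx hy => simp only [map_add, hx, hy]
        | tmul x y => simp
      have h4 : ρ.canon (toBal ρ.coinv A (x ⊗ₜ y)) = (x ⊗ₜ 1) * ρ.coact y := rfl
      rw [secondSummand_tmul, canonForm_balAct, canon_canonInv, coactZero_dι, h4,
        TensorProduct.map_tmul, balSandwich_tmul, LinearMap.comp_apply, AlgHom.toLinearMap_apply,
        AlgHom.toLinearMap_apply, h3, canon_translation, ← map_add]
      congr 1
      generalize ρ.coact y = c
      induction c with
      | zero => simp
      | add x y hx hy =>
        simp only [map_add, mul_add] at hx hy ⊢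
        rw [← hx, ← hy]
        abel
      | tmul c e => simp [C.d_mul, TensorProduct.add_tmul, mul_add]
  -- for the representatives `σ` the right-hand side of `h2` is a multiple of `d 1 = 0`
  have h5 : ∀ t, TensorProduct.lift ((balSandwich Δ.base).flip.compl₁₂
      (Δ.incl ∘ₗ ρ.translation hρ) ((TensorProduct.map (C.d ∘ₗ C.ι.toLinearMap) C.ι.toLinearMap +
        TensorProduct.map C.ι.toLinearMap (C.d ∘ₗ C.ι.toLinearMap)) ∘ₗ σ)) t =
      Δ.toBalForm hι (S t) - Δ.formTrans hρ (Δ.canonForm hι (S t)) := by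
    intro t
    induction t with
    | zero => simp
    | add x y hx hy => simp only [map_add, hx, hy]; abel
    | tmul a b =>
      have h6 := h2 a (σ b)
      rw [hσ, canon_translation] at h6
      simp only [LinearMap.rTensor_tmul, LinearMap.comp_apply, AlgHom.toLinearMap_apply, map_one,
        DiffCalc.d_one, TensorProduct.zero_tmul, mul_zero, map_zero] at h6
      simp only [TensorProduct.lift.tmul, LinearMap.compl₁₂_apply, LinearMap.flip_apply,
        LinearMap.comp_apply, LinearMap.add_apply, map_add, h1, S, LinearMap.compl₂_apply]
      rw [eq_neg_of_add_eq_zero_left h6]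
      abel
  rw [h5, Δ.toBalForm_of_balMap_eq_zero hρ hS hι hS0, sub_self]

end
end ComodAlg.Completeness

/-! ### The graded centralizer of the base forms -/

namespace DiffCalc

variable {k A Ω : Type u} [Field k] [Ring A] [Algebra k A] [Ring Ω] [Algebra k Ω]

theorem sgn_pow_of_mem (C : DiffCalc k A Ω) {n : ℕ} {ω : Ω} (h : ω ∈ C.gr n) (p : ℕ) :
    (C.sgn ^ p) ω = (-1 : k) ^ (n * p) • ω := by
  induction p with
  | zero => simp
  | succ p ih =>
    rw [pow_succ', Module.End.mul_apply, ih, map_smul, C.sgn_of_mem h, smul_smul, ← pow_add,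
      mul_add, mul_one]

@[simp] theorem sgn_pow_sgn_pow (C : DiffCalc k A Ω) (p : ℕ) (x : Ω) :
    (C.sgn ^ p) ((C.sgn ^ p) x) = x := by
  have h : C.sgn * C.sgn = 1 := LinearMap.ext C.sgn_sgn
  rw [← Module.End.mul_apply, ← pow_add, ← two_mul, pow_mul, pow_two, h, one_pow,
    Module.End.one_apply]

end DiffCalc

namespace ComodAlg.Completeness

variable {k H A Ω Ξ : Type u} [Field k] [Ring H] [HopfAlgebra k H] [Ring A]
  [Algebra k A] [Ring Ω] [Algebra k Ω] [Ring Ξ] [Algebra k Ξ]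
  {ρ : ComodAlg k H A} {C : DiffCalc k A Ω} {D : DiffCalc k H Ξ} (Δ : ρ.Completeness C D)

theorem sgn_pow_mem_base {β : Ω} (h : β ∈ Δ.base) (p : ℕ) : (C.sgn ^ p) β ∈ Δ.base := by
  induction p with
  | zero => simpa using h
  | succ p ih => rw [pow_succ', Module.End.mul_apply]; exact Δ.sgn_mem_base ih

/-- The grading involution `ω ⊗ η ↦ (-1)^(|ω| + |η|) ω ⊗ η` of `Ω(A) ⊗_{Ω(B)} Ω(A)`. -/
def balSgn : Δ.Bal →ₗ[k] Δ.Bal :=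
  (balancedRel Δ.base Ω).liftQ (toBal Δ.base Ω ∘ₗ TensorProduct.map C.sgn C.sgn)
    (balancedRel_le_ker _ fun x β y => by
      have h := balTmul_mul Δ.base (C.sgn x) ⟨C.sgn β, Δ.sgn_mem_base β.2⟩ (C.sgn y)
      simpa [Subalgebra.smul_def, C.sgn_mul, balTmul] using h)

/-- The differential `d(ω ⊗ η) = dω ⊗ η + (-1)^|ω| ω ⊗ dη` of `Ω(A) ⊗_{Ω(B)} Ω(A)`. -/
def balD : Δ.Bal →ₗ[k] Δ.Bal :=
  (balancedRel Δ.base Ω).liftQ (toBal Δ.base Ω ∘ₗ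
      (TensorProduct.map C.d LinearMap.id + TensorProduct.map C.sgn C.d))
    (balancedRel_le_ker _ fun x β y => by
      have h1 := balTmul_mul Δ.base (C.d x) β y
      have h2 := balTmul_mul Δ.base (C.sgn x) ⟨C.d β, Δ.d_mem_base β.2⟩ y
      have h3 := balTmul_mul Δ.base (C.sgn x) ⟨C.sgn β, Δ.sgn_mem_base β.2⟩ (C.d y)
      simp only [Subalgebra.smul_def, smul_eq_mul] at h1 h2 h3
      change balTmul Δ.base _ _ + balTmul Δ.base _ _ = balTmul Δ.base _ _ + balTmul Δ.base _ _
      simp only [Subalgebra.smul_def, smul_eq_mul, C.d_mul, C.sgn_mul, add_balTmul, balTmul_add,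
        LinearMap.id_apply, h1, h2, h3, add_assoc])

theorem balSgn_tmul (x y : Ω) : Δ.balSgn (Δ.tmul x y) = Δ.tmul (C.sgn x) (C.sgn y) := rfl

theorem balD_tmul (x y : Ω) :
    Δ.balD (Δ.tmul x y) = Δ.tmul (C.d x) y + Δ.tmul (C.sgn x) (C.d y) := rfl

theorem balSgn_balLeft (x : Ω) (m : Δ.Bal) :
    Δ.balSgn (balLeft Δ.base Ω x m) = balLeft Δ.base Ω (C.sgn x) (Δ.balSgn m) := by
  induction m using bal_induction with
  | zero => simp
  | add a b ha hb => simp only [map_add, ha, hb]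
  | tmul a b => simp [balSgn_tmul, C.sgn_mul]

theorem balSgn_balRight (y : Ω) (m : Δ.Bal) :
    Δ.balSgn (balRight Δ.base y m) = balRight Δ.base (C.sgn y) (Δ.balSgn m) := by
  induction m using bal_induction with
  | zero => simp
  | add a b ha hb => simp only [map_add, ha, hb]
  | tmul a b => simp [balSgn_tmul, C.sgn_mul]

@[simp] theorem balSgn_balSgn (m : Δ.Bal) : Δ.balSgn (Δ.balSgn m) = m := by
  induction m using bal_induction with
  | zero => simp
  | add a b ha hb => simp only [map_add, ha, hb]
  | tmul a b => simp [balSgn_tmul]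

theorem balSgn_balD (m : Δ.Bal) : Δ.balSgn (Δ.balD m) = -Δ.balD (Δ.balSgn m) := by
  induction m using bal_induction with
  | zero => simp
  | add a b ha hb => simp only [map_add, ha, hb, neg_add]
  | tmul a b =>
    have h (x y : Ω) : Δ.tmul (-x) y = -Δ.tmul x y := by
      simpa using smul_balTmul Δ.base (-1 : k) x y
    have h' (x y : Ω) : Δ.tmul x (-y) = -Δ.tmul x y := by
      simpa using balTmul_smul Δ.base (-1 : k) x y
    rw [balD_tmul, balSgn_tmul, balD_tmul, map_add, balSgn_tmul, balSgn_tmul, C.sgn_d, C.sgn_d, h,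
      h', neg_add]

theorem balD_balD (m : Δ.Bal) : Δ.balD (Δ.balD m) = 0 := by
  induction m using bal_induction with
  | zero => simp
  | add a b ha hb => simp only [map_add, ha, hb, add_zero]
  | tmul a b =>
    have h (x y : Ω) : Δ.tmul (-x) y = -Δ.tmul x y := by
      simpa using smul_balTmul Δ.base (-1 : k) x y
    have h0 (y : Ω) : Δ.tmul 0 y = 0 := by simpa using smul_balTmul Δ.base (0 : k) 0 y
    rw [balD_tmul, map_add, balD_tmul, balD_tmul, C.sgn_d, C.d_d, C.d_d, h, h0]
    simp

theorem balD_balLeft (x : Ω) (m : Δ.Bal) :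
    Δ.balD (balLeft Δ.base Ω x m) =
      balLeft Δ.base Ω (C.d x) m + balLeft Δ.base Ω (C.sgn x) (Δ.balD m) := by
  induction m using bal_induction with
  | zero => simp
  | add a b ha hb => simp only [map_add, ha, hb]; abel
  | tmul a b =>
    rw [balLeft_balTmul, balD_tmul, balD_tmul, map_add, C.d_mul, C.sgn_mul]
    simp only [balLeft_balTmul, add_balTmul, add_assoc]

theorem balD_balRight (y : Ω) (m : Δ.Bal) :
    Δ.balD (balRight Δ.base y m) =
      balRight Δ.base y (Δ.balD m) + balRight Δ.base (C.d y) (Δ.balSgn m) := by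
  induction m using bal_induction with
  | zero => simp
  | add a b ha hb => simp only [map_add, ha, hb]; abel
  | tmul a b =>
    rw [balRight_balTmul, balD_tmul, balD_tmul, balSgn_tmul, map_add, C.d_mul]
    simp only [balRight_balTmul, balTmul_add, add_assoc]

theorem balSgn_pow_balLeft (p : ℕ) (x : Ω) (m : Δ.Bal) :
    (Δ.balSgn ^ p) (balLeft Δ.base Ω x m) =
      balLeft Δ.base Ω ((C.sgn ^ p) x) ((Δ.balSgn ^ p) m) := by
  induction p with
  | zero => simp
  | succ p ih => simp only [pow_succ', Module.End.mul_apply, ih, balSgn_balLeft]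

theorem balSgn_pow_balRight (p : ℕ) (y : Ω) (m : Δ.Bal) :
    (Δ.balSgn ^ p) (balRight Δ.base y m) =
      balRight Δ.base ((C.sgn ^ p) y) ((Δ.balSgn ^ p) m) := by
  induction p with
  | zero => simp
  | succ p ih => simp only [pow_succ', Module.End.mul_apply, ih, balSgn_balRight]

theorem balSgn_pow_tmul (p : ℕ) (x y : Ω) :
    (Δ.balSgn ^ p) (Δ.tmul x y) = Δ.tmul ((C.sgn ^ p) x) ((C.sgn ^ p) y) := by
  induction p with
  | zero => simp
  | succ p ih => simp only [pow_succ', Module.End.mul_apply, ih, balSgn_tmul]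

theorem balSgn_pow_balD (p : ℕ) (m : Δ.Bal) :
    (Δ.balSgn ^ p) (Δ.balD m) = (-1 : k) ^ p • Δ.balD ((Δ.balSgn ^ p) m) := by
  induction p with
  | zero => simp
  | succ p ih =>
    simp only [pow_succ', Module.End.mul_apply, ih, map_smul, balSgn_balD, mul_smul, smul_neg,
      neg_smul, one_smul]

theorem balSgn_pow_add_two (p : ℕ) (m : Δ.Bal) : (Δ.balSgn ^ (p + 2)) m = (Δ.balSgn ^ p) m := by
  rw [pow_add, Module.End.mul_apply, pow_two, Module.End.mul_apply, balSgn_balSgn]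

/-- The left multiplication `ω · m = (-1)^(|ω| |m|) ω m` of forms on `Ω(A) ⊗_{Ω(B)} Ω(A)`, twisted
by the Koszul sign. -/
def koszulLeft : Ω →ₗ[k] Δ.Bal →ₗ[k] Δ.Bal :=
  DirectSum.toModule k ℕ (Δ.Bal →ₗ[k] Δ.Bal)
      (fun n => LinearMap.lcomp k Δ.Bal (Δ.balSgn ^ n) ∘ₗ balLeft Δ.base Ω ∘ₗ (C.gr n).subtype) ∘ₗ
    (DirectSum.decomposeLinearEquiv C.gr).toLinearMap

theorem koszulLeft_of_mem {n : ℕ} {x : Ω} (h : x ∈ C.gr n) (m : Δ.Bal) :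
    Δ.koszulLeft x m = balLeft Δ.base Ω x ((Δ.balSgn ^ n) m) := by
  simp only [koszulLeft, LinearMap.comp_apply, LinearEquiv.coe_coe,
    DirectSum.decomposeLinearEquiv_apply]
  rw [DirectSum.decompose_of_mem _ h]
  exact LinearMap.congr_fun (DirectSum.toModule_lof k n _) m

theorem koszulLeft_ι (a : A) (m : Δ.Bal) :
    Δ.koszulLeft (C.ι a) m = balLeft Δ.base Ω (C.ι a) m := by
  rw [Δ.koszulLeft_of_mem (C.ι_mem a), pow_zero, Module.End.one_apply]

theorem koszulLeft_dι (a : A) (m : Δ.Bal) :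
    Δ.koszulLeft (C.d (C.ι a)) m = balLeft Δ.base Ω (C.d (C.ι a)) (Δ.balSgn m) := by
  rw [Δ.koszulLeft_of_mem (C.d_mem (C.ι_mem a)), zero_add, pow_one]

theorem koszulLeft_one (m : Δ.Bal) : Δ.koszulLeft 1 m = m := by
  simpa using Δ.koszulLeft_ι 1 m

theorem koszulLeft_mul {p : ℕ} {x : Ω} (h : x ∈ C.gr p) (y : Ω) (m : Δ.Bal) :
    Δ.koszulLeft (x * y) m =
      balLeft Δ.base Ω x ((Δ.balSgn ^ p) (Δ.koszulLeft ((C.sgn ^ p) y) m)) := by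
  induction y using C.homogeneous_induction with
  | zero => simp
  | add a b ha hb => simp only [mul_add, map_add, LinearMap.add_apply, ha, hb]
  | homog q y hy =>
    have hy' : (C.sgn ^ p) y ∈ C.gr q := by
      rw [C.sgn_pow_of_mem hy]; exact Submodule.smul_mem _ _ hy
    rw [Δ.koszulLeft_of_mem (SetLike.mul_mem_graded h hy), Δ.koszulLeft_of_mem hy',
      balSgn_pow_balLeft, C.sgn_pow_sgn_pow, balLeft_mul, pow_add, Module.End.mul_apply]

theorem koszulLeft_one_tmul_one (x : Ω) : Δ.koszulLeft x (Δ.tmul 1 1) = Δ.tmul x 1 := by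
  have h1 : C.sgn 1 = 1 := by simpa using C.sgn_ι 1
  have h (n : ℕ) : (Δ.balSgn ^ n) (Δ.tmul 1 1) = Δ.tmul 1 1 := by
    induction n with
    | zero => rfl
    | succ n ih => rw [pow_succ', Module.End.mul_apply, ih, balSgn_tmul, h1]
  induction x using C.homogeneous_induction with
  | zero => simpa using (smul_balTmul Δ.base (0 : k) 0 (1 : Ω)).symm
  | add a b ha hb => rw [map_add, LinearMap.add_apply, ha, hb]; simp only [tmul, add_balTmul]
  | homog n x hx => rw [Δ.koszulLeft_of_mem hx, h, balLeft_balTmul, mul_one]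

theorem balSgn_koszulLeft (x : Ω) (m : Δ.Bal) :
    Δ.balSgn (Δ.koszulLeft x m) = Δ.koszulLeft (C.sgn x) (Δ.balSgn m) := by
  induction x using C.homogeneous_induction with
  | zero => simp
  | add a b ha hb => simp only [map_add, LinearMap.add_apply, ha, hb]
  | homog n x hx =>
    have hx' : C.sgn x ∈ C.gr n := by
      rw [C.sgn_of_mem hx]; exact Submodule.smul_mem _ _ hx
    rw [Δ.koszulLeft_of_mem hx, Δ.koszulLeft_of_mem hx', balSgn_balLeft,
      ← Module.End.mul_apply Δ.balSgn, ← Module.End.mul_apply _ Δ.balSgn, ← pow_succ, ← pow_succ']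

theorem balD_koszulLeft (x : Ω) (m : Δ.Bal) :
    Δ.balD (Δ.koszulLeft x m) =
      Δ.koszulLeft (C.d x) (Δ.balSgn m) + Δ.koszulLeft x (Δ.balD m) := by
  induction x using C.homogeneous_induction with
  | zero => simp
  | add a b ha hb => simp only [map_add, LinearMap.add_apply, ha, hb]; abel
  | homog n x hx =>
    rw [Δ.koszulLeft_of_mem hx, Δ.koszulLeft_of_mem hx, Δ.koszulLeft_of_mem (C.d_mem hx),
      balD_balLeft, C.sgn_of_mem hx, balSgn_pow_balD, ← Module.End.mul_apply _ Δ.balSgn, ← pow_succ,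
      balSgn_pow_add_two, map_smul, map_smul, LinearMap.smul_apply]

/-- The graded centralizer of `Ω(B)` in the `Ω(B)`-bimodule `Ω(A) ⊗_{Ω(B)} Ω(A)`. -/
def centralizer : Submodule k Δ.Bal where
  carrier := {m | ∀ β ∈ Δ.base, Δ.koszulLeft β m = balRight Δ.base β m}
  zero_mem' := by simp
  add_mem' ha hb β hβ := by rw [map_add, map_add, ha β hβ, hb β hβ]
  smul_mem' c m hm β hβ := by rw [map_smul, map_smul, hm β hβ]

/-- The insertion `z * (ω ⊗ η) = ω · z · η` of an element `z` of the graded centralizer, which is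
also the multiplication of the graded centralizer. -/
def insertBal : Δ.centralizer →ₗ[k] Δ.Bal →ₗ[k] Δ.Bal :=
  LinearMap.flip <| (balancedRel Δ.base Ω).liftQ
    (TensorProduct.lift (LinearMap.mk₂ k
      (fun x y => balRight Δ.base y ∘ₗ Δ.koszulLeft x ∘ₗ Δ.centralizer.subtype)
      (fun x x' y => by ext; simp) (fun c x y => by ext; simp)
      (fun x y y' => by ext; simp) (fun c x y => by ext; simp)))
    (balancedRel_le_ker _ fun x β y => by
      ext z
      suffices h : Δ.koszulLeft (x * β) z = balRight Δ.base β (Δ.koszulLeft x z) by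
        simp [h, Subalgebra.smul_def, balRight_mul]
      induction x using C.homogeneous_induction with
      | zero => simp
      | add a b ha hb => simp only [add_mul, map_add, LinearMap.add_apply, ha, hb]
      | homog n x hx =>
        rw [Δ.koszulLeft_mul hx, z.2 _ (Δ.sgn_pow_mem_base β.2 n), balSgn_pow_balRight,
          C.sgn_pow_sgn_pow, Δ.koszulLeft_of_mem hx, balRight_balLeft])

@[simp] theorem insertBal_tmul (z : Δ.centralizer) (x y : Ω) :
    Δ.insertBal z (Δ.tmul x y) = balRight Δ.base y (Δ.koszulLeft x z) := rfl

theorem insertBal_balRight (z : Δ.centralizer) (y : Ω) (m : Δ.Bal) :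
    Δ.insertBal z (balRight Δ.base y m) = balRight Δ.base y (Δ.insertBal z m) := by
  induction m using bal_induction with
  | zero => simp
  | add a b ha hb => simp only [map_add, ha, hb]
  | tmul a b => rw [balRight_balTmul, insertBal_tmul, insertBal_tmul, balRight_mul]

theorem insertBal_koszulLeft (z : Δ.centralizer) (x : Ω) (m : Δ.Bal) :
    Δ.insertBal z (Δ.koszulLeft x m) = Δ.koszulLeft x (Δ.insertBal z m) := by
  induction x using C.homogeneous_induction with
  | zero => simp
  | add a b ha hb => simp only [map_add, LinearMap.add_apply, ha, hb]
  | homog n x hx =>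
    induction m using bal_induction with
    | zero => simp
    | add a b ha hb => simp only [map_add, ha, hb]
    | tmul a b =>
      rw [Δ.koszulLeft_of_mem hx, Δ.koszulLeft_of_mem hx, balSgn_pow_tmul, balLeft_balTmul,
        insertBal_tmul, insertBal_tmul, Δ.koszulLeft_mul hx, C.sgn_pow_sgn_pow,
        balSgn_pow_balRight, balRight_balLeft]

theorem insertBal_mem (z w : Δ.centralizer) : Δ.insertBal z w ∈ Δ.centralizer := fun β hβ => by
  rw [← insertBal_koszulLeft, ← insertBal_balRight, w.2 β hβ]

theorem one_tmul_one_mem : Δ.tmul 1 1 ∈ Δ.centralizer := fun β hβ => by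
  rw [koszulLeft_one_tmul_one, balRight_balTmul]
  simpa [Subalgebra.smul_def] using balTmul_mul Δ.base 1 ⟨β, hβ⟩ (1 : Ω)

instance : One Δ.centralizer := ⟨⟨Δ.tmul 1 1, Δ.one_tmul_one_mem⟩⟩

instance : Mul Δ.centralizer := ⟨fun z w => ⟨Δ.insertBal z w, Δ.insertBal_mem z w⟩⟩

@[simp] theorem coe_one : ((1 : Δ.centralizer) : Δ.Bal) = Δ.tmul 1 1 := rfl

@[simp] theorem coe_mul (z w : Δ.centralizer) : ((z * w : Δ.centralizer) : Δ.Bal) =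
    Δ.insertBal z w := rfl

theorem insertBal_one (m : Δ.Bal) : Δ.insertBal 1 m = m := by
  induction m using bal_induction with
  | zero => simp
  | add a b ha hb => simp only [map_add, ha, hb]
  | tmul a b => rw [insertBal_tmul, coe_one, koszulLeft_one_tmul_one, balRight_balTmul, one_mul]

theorem insertBal_insertBal (z w : Δ.centralizer) (m : Δ.Bal) :
    Δ.insertBal z (Δ.insertBal w m) = Δ.insertBal (z * w) m := by
  induction m using bal_induction with
  | zero => simp
  | add a b ha hb => simp only [map_add, ha, hb]
  | tmul a b =>
    rw [insertBal_tmul, insertBal_tmul, insertBal_balRight, insertBal_koszulLeft, coe_mul]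

/-- The graded centralizer is an algebra with product `z * (ω ⊗ η) = ω · z · η`. -/
instance : Ring Δ.centralizer :=
  { (inferInstance : AddCommGroup Δ.centralizer), (inferInstance : Mul Δ.centralizer),
    (inferInstance : One Δ.centralizer) with
    left_distrib := fun a b c => Subtype.ext (by simp)
    right_distrib := fun a b c => Subtype.ext (by simp)
    zero_mul := fun a => Subtype.ext (by simp)
    mul_zero := fun a => Subtype.ext (by simp)
    mul_assoc := fun a b c => Subtype.ext (Δ.insertBal_insertBal a b c).symm
    one_mul := fun a => Subtype.ext (Δ.insertBal_one a)
    mul_one := fun a => Subtype.ext (by simp [koszulLeft_one]) }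

instance : Algebra k Δ.centralizer :=
  Algebra.ofModule (fun c a b => Subtype.ext (by simp)) (fun c a b => Subtype.ext (by simp))

/-- The differential of an element `z` of even degree of the graded centralizer lies in the graded
centralizer again. -/
theorem balD_mem {z : Δ.Bal} (hz : z ∈ Δ.centralizer) (hs : Δ.balSgn z = z) :
    Δ.balD z ∈ Δ.centralizer := fun β hβ => by
  have h := congrArg Δ.balD (hz β hβ)
  rw [balD_koszulLeft, balD_balRight, hs, hz _ (Δ.d_mem_base hβ), add_comm] at h
  exact add_right_cancel h

/-- The Leibniz rule for the product of the graded centralizer, in the case of a left factor of even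
degree. -/
theorem balD_insertBal {z : Δ.Bal} (hz : z ∈ Δ.centralizer) (hs : Δ.balSgn z = z) (m : Δ.Bal) :
    Δ.balD (Δ.insertBal ⟨z, hz⟩ m) =
      Δ.insertBal ⟨z, hz⟩ (Δ.balD m) + Δ.insertBal ⟨Δ.balD z, Δ.balD_mem hz hs⟩ m := by
  induction m using bal_induction with
  | zero => simp
  | add a b ha hb => simp only [map_add, ha, hb]; abel
  | tmul x y =>
    rw [balD_tmul, map_add, insertBal_tmul, insertBal_tmul, insertBal_tmul, insertBal_tmul,
      balD_balRight, balD_koszulLeft, balSgn_koszulLeft, hs, map_add]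
    abel

end ComodAlg.Completeness

/-! ### The extended translation map -/

theorem balSandwich_toBal {k R : Type u} [Field k] [Ring R] [Algebra k R] (S : Subalgebra k R)
    (t w : R ⊗[k] R) :
    balSandwich S t (toBal S R w) = toBal S R (DiffCalc.insert k R t w) := by
  induction t with
  | zero => simp
  | add a b ha hb => simp only [map_add, LinearMap.add_apply, ha, hb]
  | tmul a b =>
    induction w with
    | zero => simp
    | add a b ha hb => simp only [map_add, ha, hb]
    | tmul c d => rfl

namespace ComodAlg

variable {k H A Ω Ξ : Type u} [Field k] [Ring H] [HopfAlgebra k H] [Ring A] [Algebra k A]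
  [Ring Ω] [Algebra k Ω] [Ring Ξ] [Algebra k Ξ] {ρ : ComodAlg k H A}

/-- The translation map has a linear lift to `A ⊗ A`. -/
theorem exists_translation_section (hρ : ρ.IsQPB) :
    ∃ σ : H →ₗ[k] A ⊗[k] A, ∀ h, toBal ρ.coinv A (σ h) = ρ.translation hρ h := by
  obtain ⟨s, hs⟩ := (toBal ρ.coinv A).exists_rightInverse_of_surjective
    (LinearMap.range_eq_top.2 (Submodule.mkQ_surjective _))
  exact ⟨s ∘ₗ ρ.translation hρ, fun h => LinearMap.congr_fun hs _⟩

/-- The multiplication rule of the translation map, `τ(hg) = g⁽¹⁾ h⁽¹⁾ ⊗ h⁽²⁾ g⁽²⁾`, where `t`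
represents `τ(g)`. -/
theorem translation_mul (hρ : ρ.IsQPB) (h g : H) (t : A ⊗[k] A)
    (ht : toBal ρ.coinv A t = ρ.translation hρ g) :
    ρ.translation hρ (h * g) = balSandwich ρ.coinv t (ρ.translation hρ h) := by
  have key (t : A ⊗[k] A) : balSandwich ρ.coinv t (ρ.translation hρ h) =
      ρ.canonInv hρ ((1 ⊗ₜ h) * ρ.canon (toBal ρ.coinv A t)) := by
    induction t with
    | zero => simp
    | add a b ha hb => simp only [map_add, LinearMap.add_apply, mul_add, ha, hb]
    | tmul x y =>
      have h1 : (1 ⊗ₜ h : A ⊗[k] H) * ρ.canon (toBal ρ.coinv A (x ⊗ₜ y)) =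
          (x ⊗ₜ 1) * ((1 ⊗ₜ h) * ρ.coact y) := by
        change _ * ρ.canon (balTmul ρ.coinv x y) = _
        rw [canon_balTmul, ← mul_assoc, ← mul_assoc]
        simp
      rw [h1, canonInv_tmul_one_mul, ← balRight_canonInv, balSandwich_tmul, balRight_balLeft,
        translation_apply]
  rw [key, ht, canon_translation, Algebra.TensorProduct.tmul_mul_tmul, one_mul, translation_apply]

namespace Completeness

section General

variable {C : DiffCalc k A Ω} {D : DiffCalc k H Ξ} (Δ : ρ.Completeness C D)

theorem incl_toBal (t : A ⊗[k] A) : Δ.incl (toBal ρ.coinv A t) =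
    toBal Δ.base Ω (TensorProduct.map C.ι.toLinearMap C.ι.toLinearMap t) := rfl

theorem incl_balSandwich (t : A ⊗[k] A) (z : BalTensor ρ.coinv A) :
    Δ.incl (balSandwich ρ.coinv t z) = balSandwich Δ.base
      (TensorProduct.map C.ι.toLinearMap C.ι.toLinearMap t) (Δ.incl z) := by
  induction t with
  | zero => simp
  | add a b ha hb => simp only [map_add, LinearMap.add_apply, ha, hb]
  | tmul a b =>
    induction z using bal_induction with
    | zero => simp
    | add a b ha hb => simp only [map_add, ha, hb]
    | tmul c d => simp

theorem balSgn_incl (z : BalTensor ρ.coinv A) : Δ.balSgn (Δ.incl z) = Δ.incl z := by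
  induction z using bal_induction with
  | zero => simp
  | add a b ha hb => simp only [map_add, ha, hb]
  | tmul a b => rw [incl_balTmul, balSgn_tmul, C.sgn_ι, C.sgn_ι]

theorem koszulLeft_incl (x : Ω) (z : BalTensor ρ.coinv A) :
    Δ.koszulLeft x (Δ.incl z) = balLeft Δ.base Ω x (Δ.incl z) := by
  induction x using C.homogeneous_induction with
  | zero => simp
  | add a b ha hb => simp only [map_add, LinearMap.add_apply, ha, hb]
  | homog n x hx =>
    have h (n : ℕ) : (Δ.balSgn ^ n) (Δ.incl z) = Δ.incl z := by
      induction n with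
      | zero => rfl
      | succ n ih => rw [pow_succ', Module.End.mul_apply, ih, balSgn_incl]
    rw [Δ.koszulLeft_of_mem hx, h]

theorem insertBal_incl (z : Δ.centralizer) (t : A ⊗[k] A) :
    Δ.insertBal z (Δ.incl (toBal ρ.coinv A t)) = balSandwich Δ.base
      (TensorProduct.map C.ι.toLinearMap C.ι.toLinearMap t) z := by
  induction t with
  | zero => simp
  | add a b ha hb => simp only [map_add, LinearMap.add_apply, ha, hb]
  | tmul x y =>
    change Δ.insertBal z (Δ.tmul (C.ι x) (C.ι y)) = _
    rw [insertBal_tmul, koszulLeft_ι]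
    rfl

/-- The product of an element of degree `n` with `d(x ⊗ y)`, for `x, y ∈ A`. -/
theorem insertBal_balD_incl (z : Δ.centralizer) {n : ℕ}
    (hz : Δ.balSgn z = (-1 : k) ^ n • (z : Δ.Bal)) (t : A ⊗[k] A) :
    Δ.insertBal z (Δ.balD (Δ.incl (toBal ρ.coinv A t))) = balSandwich Δ.base
      ((-1 : k) ^ n • TensorProduct.map (C.d ∘ₗ C.ι.toLinearMap) C.ι.toLinearMap t +
        TensorProduct.map C.ι.toLinearMap (C.d ∘ₗ C.ι.toLinearMap) t) z := by
  induction t with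
  | zero => simp
  | add a b ha hb =>
    simp only [map_add, LinearMap.add_apply, map_smul, LinearMap.smul_apply, smul_add] at ha hb ⊢
    rw [ha, hb]
    abel
  | tmul x y =>
    change Δ.insertBal z (Δ.balD (Δ.tmul (C.ι x) (C.ι y))) = _
    rw [balD_tmul, map_add, insertBal_tmul, insertBal_tmul, koszulLeft_dι, hz, C.sgn_ι,
      koszulLeft_ι]
    simp

theorem balSgn_of_mem_balGr {n : ℕ} {z : Δ.Bal} (hz : z ∈ Δ.balGr n) :
    Δ.balSgn z = (-1 : k) ^ n • z := by
  induction hz using Submodule.span_induction with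
  | mem x h =>
    obtain ⟨r, s, ω, η, rfl, hω, hη, rfl⟩ := h
    rw [balSgn_tmul, C.sgn_of_mem hω, C.sgn_of_mem hη, tmul, smul_balTmul, balTmul_smul, smul_smul,
      pow_add]
  | zero => simp
  | add x y _ _ hx hy => rw [map_add, hx, hy, smul_add]
  | smul r x _ hx => rw [map_smul, hx, smul_comm]

theorem balRight_balLeft_mem_balGr {n p q : ℕ} {x y : Ω} {z : Δ.Bal} (hx : x ∈ C.gr p)
    (hy : y ∈ C.gr q) (hz : z ∈ Δ.balGr n) :
    balRight Δ.base y (balLeft Δ.base Ω x z) ∈ Δ.balGr (n + p + q) := by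
  induction hz using Submodule.span_induction with
  | mem z h =>
    obtain ⟨r, s, ω, η, rfl, hω, hη, rfl⟩ := h
    exact Submodule.subset_span ⟨p + r, s + q, x * ω, η * y, by omega,
      SetLike.mul_mem_graded hx hω, SetLike.mul_mem_graded hη hy, rfl⟩
  | zero => simp
  | add x y _ _ hx hy => rw [map_add, map_add]; exact add_mem hx hy
  | smul r x _ hx => rw [map_smul, map_smul]; exact Submodule.smul_mem _ _ hx

theorem balSandwich_map_mem_balGr {n p q : ℕ} {f g : A →ₗ[k] Ω} (hf : ∀ a, f a ∈ C.gr p)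
    (hg : ∀ a, g a ∈ C.gr q) (t : A ⊗[k] A) {z : Δ.Bal} (hz : z ∈ Δ.balGr n) :
    balSandwich Δ.base (TensorProduct.map f g t) z ∈ Δ.balGr (n + p + q) := by
  induction t with
  | zero => simp
  | add a b ha hb => rw [map_add, map_add, LinearMap.add_apply]; exact add_mem ha hb
  | tmul x y => exact Δ.balRight_balLeft_mem_balGr (hf x) (hg y) hz

theorem insertBal_balD_incl_mem_balGr (z : Δ.centralizer) {n : ℕ} (hz : (z : Δ.Bal) ∈ Δ.balGr n)
    (y : BalTensor ρ.coinv A) : Δ.insertBal z (Δ.balD (Δ.incl y)) ∈ Δ.balGr (n + 1) := by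
  obtain ⟨t, rfl⟩ := Submodule.mkQ_surjective _ y
  rw [Δ.insertBal_balD_incl z (Δ.balSgn_of_mem_balGr hz), map_add, map_smul, LinearMap.add_apply,
    LinearMap.smul_apply]
  have h0 (a : A) : C.ι.toLinearMap a ∈ C.gr 0 := C.ι_mem a
  have h1 (a : A) : (C.d ∘ₗ C.ι.toLinearMap) a ∈ C.gr 1 := C.d_mem (C.ι_mem a)
  have h2 := Δ.balSandwich_map_mem_balGr h1 h0 t hz
  have h3 := Δ.balSandwich_map_mem_balGr h0 h1 t hz
  rw [add_zero] at h2 h3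
  exact add_mem (Submodule.smul_mem _ _ h2) h3

theorem incl_mem_balGr (z : BalTensor ρ.coinv A) : Δ.incl z ∈ Δ.balGr 0 := by
  induction z using bal_induction with
  | zero => simp
  | add a b ha hb => rw [map_add]; exact add_mem ha hb
  | tmul a b => exact Submodule.subset_span ⟨0, 0, _, _, rfl, C.ι_mem a, C.ι_mem b, rfl⟩

end General

variable {Γ : Type u} [AddCommGroup Γ] [Module k Γ] [Module H Γ] [Module Hᵐᵒᵖ Γ]
  [SMulCommClass H Hᵐᵒᵖ Γ] [IsScalarTower k H Γ] [IsScalarTower k Hᵐᵒᵖ Γ] {F : FODC k H Γ}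
  {C : DiffCalc k A Ω} (Δ : ρ.Completeness C F.maxProlongation)
  (hS : Function.Bijective (HopfAlgebra.antipode k (A := H))) (hρ : ρ.IsQPB)

include hS in
theorem translation_mem_centralizer (h : H) :
    Δ.incl (ρ.translation hρ h) ∈ Δ.centralizer := fun β hβ => by
  let : Module A Ω := Module.compHom Ω C.ι.toRingHom
  have : IsScalarTower k A Ω := ⟨fun c a ω => by
    change C.ι (c • a) * ω = c • (C.ι a * ω)
    rw [map_smul, smul_mul_assoc]⟩
  rw [koszulLeft_incl, Δ.balRight_translation hρ hS (fun _ _ => rfl) hβ]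

/-- The translation map `H → A ⊗_B A → Ω(A) ⊗_{Ω(B)} Ω(A)`, as an algebra map to the graded
centralizer. -/
def translationHom : H →ₐ[k] Δ.centralizer :=
  AlgHom.ofLinearMap ((Δ.incl ∘ₗ ρ.translation hρ).codRestrict _
      (Δ.translation_mem_centralizer hS hρ))
    (Subtype.ext (by simp [translation_one]))
    (fun h g => Subtype.ext (by
      obtain ⟨σ, hσ⟩ := exists_translation_section hρ
      change Δ.incl (ρ.translation hρ (h * g)) = Δ.insertBal _ (Δ.incl (ρ.translation hρ g))
      rw [translation_mul hρ h g (σ g) (hσ g), ← hσ g, insertBal_incl, incl_balSandwich]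
      rfl))

theorem coe_translationHom (h : H) :
    (Δ.translationHom hS hρ h : Δ.Bal) = Δ.incl (ρ.translation hρ h) := rfl

/-- The differential of the translation map, `h ↦ d(h⁽¹⁾) ⊗ h⁽²⁾ + h⁽¹⁾ ⊗ d(h⁽²⁾)`. -/
def translationD : H →ₗ[k] Δ.centralizer :=
  (Δ.balD ∘ₗ Δ.incl ∘ₗ ρ.translation hρ).codRestrict _ fun h =>
    Δ.balD_mem (Δ.translation_mem_centralizer hS hρ h) (Δ.balSgn_incl _)

theorem coe_translationD (h : H) :
    (Δ.translationD hS hρ h : Δ.Bal) = Δ.balD (Δ.incl (ρ.translation hρ h)) := rfl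

theorem balD_translationHom_mul (h : H) (z : Δ.centralizer) :
    Δ.balD ((Δ.translationHom hS hρ h * z : Δ.centralizer) : Δ.Bal) =
      Δ.insertBal (Δ.translationHom hS hρ h) (Δ.balD z) +
        ((Δ.translationD hS hρ h * z : Δ.centralizer) : Δ.Bal) :=
  Δ.balD_insertBal (Δ.translationHom hS hρ h).2 (Δ.balSgn_incl _) z

theorem translationD_mul (h g : H) : Δ.translationD hS hρ (h * g) =
    Δ.translationHom hS hρ h * Δ.translationD hS hρ g +
      Δ.translationD hS hρ h * Δ.translationHom hS hρ g := by
  refine Subtype.ext ?_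
  rw [coe_translationD, ← Δ.coe_translationHom hS, map_mul, balD_translationHom_mul]
  rfl

theorem translationHom_mul_translationD_eq_zero (hF : F.IsBicovariant) {t : H ⊗[k] H}
    (ht : F.toForm t = 0) :
    TensorProduct.lift ((LinearMap.mul k Δ.centralizer).compl₁₂
      (Δ.translationHom hS hρ).toLinearMap (Δ.translationD hS hρ)) t = 0 := by
  obtain ⟨hF⟩ := hF
  obtain ⟨σ, hσ⟩ := exists_translation_section hρ
  let : Module A Ω := Module.compHom Ω C.ι.toRingHom
  have : IsScalarTower k A Ω := ⟨fun c a ω => by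
    change C.ι (c • a) * ω = c • (C.ι a * ω)
    rw [map_smul, smul_mul_assoc]⟩
  refine Subtype.ext (Eq.trans ?_ (Δ.lift_balSandwich_eq_zero hρ hS (fun _ _ => rfl) hF σ hσ t ht))
  clear ht
  induction t with
  | zero => simp
  | add a b ha hb => simp only [map_add, Submodule.coe_add, ha, hb]
  | tmul a b =>
    change Δ.insertBal (Δ.translationHom hS hρ a) (Δ.balD (Δ.incl (ρ.translation hρ b))) =
      balSandwich Δ.base _ (Δ.incl (ρ.translation hρ a))
    rw [← hσ b, Δ.insertBal_balD_incl (n := 0) _ (by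
      rw [pow_zero, one_smul]; exact Δ.balSgn_incl _), pow_zero,
      one_smul]
    rfl

variable (hF : F.IsBicovariant)

/-- The translation map on one-forms, `h dg ↦ τ(h) · d(τ(g))`, with values in the graded
centralizer. -/
def translationForm : Γ →ₗ[k] Δ.centralizer :=
  (LinearMap.ker F.toForm).liftQ
      (TensorProduct.lift ((LinearMap.mul k Δ.centralizer).compl₁₂
        (Δ.translationHom hS hρ).toLinearMap (Δ.translationD hS hρ)))
      (fun _ ht => Δ.translationHom_mul_translationD_eq_zero hS hρ hF ht) ∘ₗ
    (F.toForm.quotKerEquivOfSurjective (FODC.MaxProl.toForm_surjective F)).symm.toLinearMap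

theorem translationForm_smul_d (h g : H) : Δ.translationForm hS hρ hF (h • F.d g) =
    Δ.translationHom hS hρ h * Δ.translationD hS hρ g := by
  have h1 : (F.toForm.quotKerEquivOfSurjective (FODC.MaxProl.toForm_surjective F)).symm
      (h • F.d g) = (LinearMap.ker F.toForm).mkQ (h ⊗ₜ g) := by
    rw [LinearEquiv.symm_apply_eq]
    rfl
  rw [translationForm, LinearMap.comp_apply, LinearEquiv.coe_coe, h1]
  rfl

theorem translationForm_d (g : H) :
    Δ.translationForm hS hρ hF (F.d g) = Δ.translationD hS hρ g := by
  simpa using Δ.translationForm_smul_d hS hρ hF 1 g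

theorem translationForm_smul (h : H) (γ : Γ) : Δ.translationForm hS hρ hF (h • γ) =
    Δ.translationHom hS hρ h * Δ.translationForm hS hρ hF γ := by
  induction γ using FODC.MaxProl.form_induction F with
  | smul_d a b =>
    rw [← mul_smul, translationForm_smul_d, translationForm_smul_d, map_mul, mul_assoc]
  | add x y hx hy => rw [smul_add, map_add, hx, hy, map_add, mul_add]

theorem translationForm_op_smul (h : H) (γ : Γ) :
    Δ.translationForm hS hρ hF (MulOpposite.op h • γ) =
      Δ.translationForm hS hρ hF γ * Δ.translationHom hS hρ h := by
  induction γ using FODC.MaxProl.form_induction F with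
  | smul_d a b =>
    have h1 : MulOpposite.op h • a • F.d b = a • F.d (b * h) - (a * b) • F.d h := by
      rw [F.leibniz, smul_add, mul_smul, add_sub_cancel_right,
        ← smul_comm a (MulOpposite.op h)]
    rw [h1, map_sub, translationForm_smul_d, translationForm_smul_d, translationForm_smul_d,
      translationD_mul, map_mul]
    noncomm_ring
  | add x y hx hy => rw [smul_add, map_add, hx, hy, map_add, add_mul]

include hF in
/-- The relation `∑ dbᵢ ∧ dcᵢ = 0` of the maximal prolongation is respected by the translation map,
as the differential of the relation `∑ bᵢ dcᵢ = 0` on one-forms. -/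
theorem sum_translationD_mul_translationD {n : ℕ} (b c : Fin n → H)
    (h : ∑ i, b i • F.d (c i) = 0) :
    ∑ i, Δ.translationD hS hρ (b i) * Δ.translationD hS hρ (c i) = 0 := by
  have h0 := congrArg (Δ.translationForm hS hρ hF) h
  simp only [map_sum, translationForm_smul_d, map_zero] at h0
  have h1 := congrArg (fun z : Δ.centralizer => Δ.balD z) h0
  have h2 : ∀ i, Δ.balD ((Δ.translationHom hS hρ (b i) * Δ.translationD hS hρ (c i) :
      Δ.centralizer) : Δ.Bal) =
      ((Δ.translationD hS hρ (b i) * Δ.translationD hS hρ (c i) : Δ.centralizer) : Δ.Bal) := by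
    intro i
    rw [balD_translationHom_mul, coe_translationD, balD_balD, map_zero, zero_add]
  refine Subtype.ext ?_
  simpa only [AddSubmonoidClass.coe_finsetSum, map_sum, h2, ZeroMemClass.coe_zero,
    map_zero] using h1

/-- The extended translation map, as an algebra map from the maximal prolongation to the graded
centralizer of `Ω(B)` in `Ω(A) ⊗_{Ω(B)} Ω(A)`. -/
def extTranslation : F.MaxProl →ₐ[k] Δ.centralizer :=
  FODC.MaxProl.lift F (Δ.translationHom hS hρ) (Δ.translationForm hS hρ hF)
    (Δ.translationForm_smul hS hρ hF) (Δ.translationForm_op_smul hS hρ hF)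
    (fun _ b c h => by
      simpa only [translationForm_d] using Δ.sum_translationD_mul_translationD hS hρ hF b c h)

theorem extTranslation_ι (h : H) : Δ.extTranslation hS hρ hF (F.maxProlongation.ι h) =
    Δ.translationHom hS hρ h := FODC.MaxProl.lift_ofAlg F _ _ _ _ _ h

theorem extTranslation_dι (h : H) :
    Δ.extTranslation hS hρ hF (F.maxProlongation.d (F.maxProlongation.ι h)) =
      Δ.translationD hS hρ h := by
  rw [F.maxProlongation_d_ι, ← Δ.translationForm_d hS hρ hF]
  exact FODC.MaxProl.lift_ofForm F _ _ _ _ _ _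

theorem coe_extTranslation_mul_dι (θ : F.MaxProl) (g : H) :
    (Δ.extTranslation hS hρ hF (θ * F.maxProlongation.d (F.maxProlongation.ι g)) : Δ.Bal) =
      Δ.insertBal (Δ.extTranslation hS hρ hF θ) (Δ.balD (Δ.incl (ρ.translation hρ g))) := by
  rw [map_mul, extTranslation_dι]
  rfl

theorem extTranslation_mem_balGr {n : ℕ} {θ : F.MaxProl} (hθ : θ ∈ F.maxProlongation.gr n) :
    (Δ.extTranslation hS hρ hF θ : Δ.Bal) ∈ Δ.balGr n := by
  rw [F.maxProlongation.gr_eq_span] at hθ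
  induction hθ using Submodule.span_induction with
  | mem x h =>
    obtain ⟨a, l, rfl, rfl⟩ := h
    induction l using List.reverseRecOn with
    | nil =>
      rw [List.map_nil, List.prod_nil, mul_one, extTranslation_ι]
      exact Δ.incl_mem_balGr _
    | append_singleton l b ih =>
      rw [List.map_append, List.prod_append, ← mul_assoc, List.map_singleton, List.prod_singleton,
        coe_extTranslation_mul_dι, List.length_append, List.length_singleton]
      exact Δ.insertBal_balD_incl_mem_balGr _ ih _
  | zero => simp
  | add x y _ _ hx hy => rw [map_add]; exact add_mem hx hy
  | smul r x _ hx => rw [map_smul]; exact Submodule.smul_mem _ _ hx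

/-- The inductive step of the inside-out formula. -/
theorem extTranslation_mul_dι_eq_toBal {n : ℕ} {θ : F.MaxProl}
    (hθ : θ ∈ F.maxProlongation.gr n) (w : Ω ⊗[k] Ω)
    (hw : (Δ.extTranslation hS hρ hF θ : Δ.Bal) = toBal Δ.base Ω w) (g : H) (t : A ⊗[k] A)
    (ht : ρ.translation hρ g = toBal ρ.coinv A t) :
    (Δ.extTranslation hS hρ hF (θ * F.maxProlongation.d (F.maxProlongation.ι g)) : Δ.Bal) =
      toBal Δ.base Ω (C.insideOutStep n t w) := by
  rw [coe_extTranslation_mul_dι, ht, Δ.insertBal_balD_incl _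
    (Δ.balSgn_of_mem_balGr (Δ.extTranslation_mem_balGr hS hρ hF hθ)), hw, balSandwich_toBal,
    map_add, map_smul]
  rfl

theorem extTranslation_mul_prod_eq_toBal {hs : List H} {ts : List (A ⊗[k] A)}
    (h : List.Forall₂ (fun g s => ρ.translation hρ g = toBal ρ.coinv A s) hs ts) {n : ℕ}
    {θ : F.MaxProl} (hθ : θ ∈ F.maxProlongation.gr n) (w : Ω ⊗[k] Ω)
    (hw : (Δ.extTranslation hS hρ hF θ : Δ.Bal) = toBal Δ.base Ω w) :
    (Δ.extTranslation hS hρ hF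
      (θ * (hs.map fun b => F.maxProlongation.d (F.maxProlongation.ι b)).prod) : Δ.Bal) =
      toBal Δ.base Ω (C.insideOutAux n w ts) := by
  induction h generalizing n θ w with
  | nil => simpa [DiffCalc.insideOutAux] using hw
  | @cons g t hs ts hg _ ih =>
    rw [List.map_cons, List.prod_cons, ← mul_assoc, DiffCalc.insideOutAux]
    exact ih (SetLike.mul_mem_graded hθ
        (F.maxProlongation.d_mem (F.maxProlongation.ι_mem g))) _
      (Δ.extTranslation_mul_dι_eq_toBal hS hρ hF hθ w hw g t hg)

theorem extTranslation_form (h : H) (hs : List H) (t : A ⊗[k] A) (ts : List (A ⊗[k] A))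
    (ht : ρ.translation hρ h = toBal ρ.coinv A t)
    (hts : List.Forall₂ (fun g s => ρ.translation hρ g = toBal ρ.coinv A s) hs ts) :
    (Δ.extTranslation hS hρ hF (F.maxProlongation.form h hs) : Δ.Bal) =
      toBal Δ.base Ω (C.insideOut t ts) :=
  Δ.extTranslation_mul_prod_eq_toBal hS hρ hF hts (F.maxProlongation.ι_mem h) _ (by
    rw [extTranslation_ι, coe_translationHom, ht, incl_toBal])

end Completeness
end ComodAlg

namespace DiffCalc

variable {k A Ω : Type u} [Field k] [Ring A] [Algebra k A] [Ring Ω] [Algebra k Ω]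

theorem insert_tmul (x y ω η : Ω) : insert k Ω (x ⊗ₜ y) (ω ⊗ₜ η) = (x * ω) ⊗ₜ (η * y) := rfl

/-- Linear maps which agree on all forms `a₀ da₁ ⋯ daₙ` are equal. -/
theorem linearMap_ext (C : DiffCalc k A Ω) {M : Type*} [AddCommGroup M] [Module k M]
    {f g : Ω →ₗ[k] M} (h : ∀ a l, f (C.form a l) = g (C.form a l)) : f = g := by
  refine LinearMap.ext fun ω => ?_
  induction ω using C.homogeneous_induction with
  | zero => simp
  | add x y hx hy => rw [map_add, map_add, hx, hy]
  | homog n ω hω =>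
    rw [C.gr_eq_span] at hω
    refine LinearMap.eqOn_span ?_ hω
    rintro _ ⟨a, l, -, rfl⟩
    exact h a l

end DiffCalc

end NCG

end

theorem proposition5p2 {k H A Γ Ω : Type u} [Field k]
    [Ring H] [HopfAlgebra k H] (hS : Function.Bijective (HopfAlgebra.antipode k (A := H)))
    [Ring A] [Algebra k A] (ρ : NCG.ComodAlg k H A) (hρ : ρ.IsQPB)
    [AddCommGroup Γ] [Module k Γ] [Module H Γ] [Module Hᵐᵒᵖ Γ] [SMulCommClass H Hᵐᵒᵖ Γ]
    [IsScalarTower k H Γ] [IsScalarTower k Hᵐᵒᵖ Γ]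
    (F : NCG.FODC k H Γ) (hF : F.IsBicovariant)
    [Ring Ω] [Algebra k Ω] (C : NCG.DiffCalc k A Ω)
    (Δ : ρ.Completeness C F.maxProlongation) :
    ∃! T : F.MaxProl →ₗ[k] Δ.Bal,
      -- `T` is graded
      (∀ (n : ℕ), ∀ θ ∈ F.maxProlongation.gr n, T θ ∈ Δ.balGr n) ∧
      -- `T` extends the translation map
      (∀ h : H, T (F.maxProlongation.ι h) = Δ.incl (ρ.translation hρ h)) ∧
      -- the formula on one-forms `h dg`
      (∀ (h g : H) (m n : ℕ) (h₁ h₂ : Fin m → A) (g₁ g₂ : Fin n → A),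
        ρ.translation hρ h = ∑ i, NCG.balTmul ρ.coinv (h₁ i) (h₂ i) →
        ρ.translation hρ g = ∑ j, NCG.balTmul ρ.coinv (g₁ j) (g₂ j) →
        T (F.maxProlongation.ι h * F.maxProlongation.d (F.maxProlongation.ι g)) =
          ∑ i, ∑ j,
            (Δ.tmul (C.d (C.ι (g₁ j)) * C.ι (h₁ i)) (C.ι (h₂ i) * C.ι (g₂ j)) +
              Δ.tmul (C.ι (g₁ j) * C.ι (h₁ i)) (C.ι (h₂ i) * C.d (C.ι (g₂ j))))) ∧
      -- the formula on two-forms `h dg ∧ dl`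
      (∀ (h g l : H) (m n p : ℕ) (h₁ h₂ : Fin m → A) (g₁ g₂ : Fin n → A) (l₁ l₂ : Fin p → A),
        ρ.translation hρ h = ∑ i, NCG.balTmul ρ.coinv (h₁ i) (h₂ i) →
        ρ.translation hρ g = ∑ j, NCG.balTmul ρ.coinv (g₁ j) (g₂ j) →
        ρ.translation hρ l = ∑ q, NCG.balTmul ρ.coinv (l₁ q) (l₂ q) →
        T (F.maxProlongation.ι h * F.maxProlongation.d (F.maxProlongation.ι g) *
            F.maxProlongation.d (F.maxProlongation.ι l)) =
          ∑ i, ∑ j, ∑ q,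
            (-Δ.tmul (C.d (C.ι (l₁ q)) * C.d (C.ι (g₁ j)) * C.ι (h₁ i))
                (C.ι (h₂ i) * C.ι (g₂ j) * C.ι (l₂ q)) -
              Δ.tmul (C.d (C.ι (l₁ q)) * C.ι (g₁ j) * C.ι (h₁ i))
                (C.ι (h₂ i) * C.d (C.ι (g₂ j)) * C.ι (l₂ q)) +
              Δ.tmul (C.ι (l₁ q) * C.d (C.ι (g₁ j)) * C.ι (h₁ i))
                (C.ι (h₂ i) * C.ι (g₂ j) * C.d (C.ι (l₂ q))) +
              Δ.tmul (C.ι (l₁ q) * C.ι (g₁ j) * C.ι (h₁ i))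
                (C.ι (h₂ i) * C.d (C.ι (g₂ j)) * C.d (C.ι (l₂ q))))) ∧
      -- the inside-out formula on forms `h dh₁ ∧ ⋯ ∧ dhₙ` of arbitrary degree
      (∀ (h : H) (hs : List H) (t : A ⊗[k] A) (ts : List (A ⊗[k] A)),
        ρ.translation hρ h = NCG.toBal ρ.coinv A t →
        List.Forall₂ (fun g s => ρ.translation hρ g = NCG.toBal ρ.coinv A s) hs ts →
        T (F.maxProlongation.form h hs) = NCG.toBal Δ.base Ω (C.insideOut t ts)) := by
  have key := Δ.extTranslation_form hS hρ hF
  refine ⟨Δ.centralizer.subtype ∘ₗ (Δ.extTranslation hS hρ hF).toLinearMap,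
    ⟨fun n θ hθ => Δ.extTranslation_mem_balGr hS hρ hF hθ, fun h => ?_, ?_, ?_, key⟩, ?_⟩
  · change (Δ.extTranslation hS hρ hF (F.maxProlongation.ι h) : Δ.Bal) = _
    rw [Δ.extTranslation_ι]
    rfl
  · intro h g m n h₁ h₂ g₁ g₂ hh hg
    have e := key h [g] (∑ i, h₁ i ⊗ₜ h₂ i) [∑ j, g₁ j ⊗ₜ g₂ j]
      (by rw [hh, map_sum]; rfl) (.cons (by rw [hg, map_sum]; rfl) .nil)
    rw [NCG.DiffCalc.form, List.map_singleton, List.prod_singleton] at e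
    refine e.trans ?_
    simp only [NCG.DiffCalc.insideOut, NCG.DiffCalc.insideOutAux, NCG.DiffCalc.insideOutStep,
      pow_zero, one_smul, map_sum, map_add, LinearMap.sum_apply, TensorProduct.map_tmul,
      LinearMap.comp_apply, AlgHom.toLinearMap_apply, NCG.DiffCalc.insert_tmul,
      Finset.sum_add_distrib]
    rfl
  · intro h g l m n p h₁ h₂ g₁ g₂ l₁ l₂ hh hg hl
    have e := key h [g, l] (∑ i, h₁ i ⊗ₜ h₂ i) [∑ j, g₁ j ⊗ₜ g₂ j, ∑ q, l₁ q ⊗ₜ l₂ q]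
      (by rw [hh, map_sum]; rfl)
      (.cons (by rw [hg, map_sum]; rfl) (.cons (by rw [hl, map_sum]; rfl) .nil))
    rw [NCG.DiffCalc.form, List.map_cons, List.map_singleton, List.prod_cons, List.prod_singleton,
      ← mul_assoc] at e
    refine e.trans ?_
    simp only [NCG.DiffCalc.insideOut, NCG.DiffCalc.insideOutAux, NCG.DiffCalc.insideOutStep,
      pow_zero, one_smul, zero_add, pow_one, neg_smul, map_sum, map_add, map_neg,
      LinearMap.sum_apply, TensorProduct.map_tmul,
      LinearMap.comp_apply, AlgHom.toLinearMap_apply, NCG.DiffCalc.insert_tmul, ← mul_assoc,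
      sub_eq_add_neg, Finset.sum_add_distrib, Finset.sum_neg_distrib]
    rw [neg_add, ← add_assoc]
    rfl
  · rintro T ⟨-, -, -, -, hT⟩
    obtain ⟨σ, hσ⟩ := NCG.ComodAlg.exists_translation_section hρ
    refine F.maxProlongation.linearMap_ext fun h hs => ?_
    have hts : List.Forall₂ (fun g s => ρ.translation hρ g = NCG.toBal ρ.coinv A s) hs
        (hs.map σ) := by
      rw [List.forall₂_map_right_iff, List.forall₂_same]
      exact fun g _ => (hσ g).symm
    exact (hT h hs _ _ (hσ h).symm hts).trans (key h hs _ _ (hσ h).symm hts).symm
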